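/- Model. Time is divided into blocks of length $T_B>0$. A master and a slave node exchange packets of $\ell>0$ nats over independent downlink and uplink bands; all relevant block power gains $\gamma$ are i.i.d. exponential with rate $\lambda>0$. A transmission block with gain $\gamma$ carries $\gamma P_tT_B/N_0$ nats ($P_t,N_0>0$), and the service time $S$ of a packet is the number of blocks until the accumulated amount, starting afresh with each packet, reaches $\ell$. Downlink: whenever the master's queue is empty at the beginning of a block, a packet is generated with probability $p\in[0,1]$. If none is generated, the block is an idle block. Otherwise a busy period starts with that packet; in each of its blocks one further packet is generated with probability $p$, the packets are served first-come-first-served with independent service times distributed as $S$, and the period ends at the end of the first block at which the queue is empty. Let $B_{\rm D}$ be its length (possibly infinite), and let $F$ be the number of consecutive busy periods before an idle block, so $\Pr\{F=j\}=p^j(1-p)$ if $p<1$ and $F=\infty$ if $p=1$. All packet generations are mutually independent and independent of the gains. Uplink: the slave acts only in idle blocks. It starts with a fixed stored energy $e_0\ge 0$. In an idle block with stored energy at least $P_tT_B$ it transmits; otherwise it harvests $\eta\gamma P_tT_B$ ($\eta>0$), and transmits in the same block if the stored energy has then reached $P_tT_B$. Each transmission uses the energy $P_tT_B$; thus the $i$-th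 transmission takes $s_i=\max\{1,\tau_{{\rm H}i}\}$ idle blocks, where $\tau_{{\rm H}i}$ is the number of harvesting blocks needed for it. A new uplink packet is generated immediately after the delivery of the previous one. A packet needing $S$ transmissions has uplink service time $S_{\rm UL}=\sum s_i$ (the sum over its $S$ transmissions) and system time $$T=S_{\rm UL}+\sum_{i=1}^{S_{\rm UL}}\sum_{j=1}^{F_i}B_{{\rm D}j},$$ with independent copies of $F$ and $B_{\rm D}$ for each of its idle blocks. Let $K(N)$ be the number of uplink packets delivered within the first $N$ blocks. The age of information in block $n\ge1$ is $\Delta(n)=n-U(n)$, where $U(n)$ is the generation epoch of the latest packet delivered by the end of block $n-1$ (and $U(n)=-\Delta_0$ if there is none, with an initial age $\Delta_0\in\{0,1,2,\dots\}$). Put $\bar\Delta=\lim_{N\to\infty}\frac1N\sum_{n=1}^N\Delta(n)$ and $q(p)=\lim_{N\to\infty}K(N)/N$. Theorem. Let $\theta=\frac{\lambda N_0\ell}{P_tT_B}$. If $(\theta+1)p<1$, then almost surely both limits exist and $$\bar\Delta=\frac{1-p+p^2+\theta p^2}{2(1-p)(1-p-\theta p)}\left(\frac{\frac{\lambda^2}{\eta^2}+\frac\lambda\eta+e^{-\lambda/\eta}}{\frac\lambda\eta+e^{-\lambda/\eta}}+\Big(\frac\lambda\eta+e^{-\lambda/\eta}\Big)\frac{3\theta^2+6\theta+2}{1+\theta}\right)+\frac{p(1+\theta)^2-p^3(2-p)(1+\theta)^3+\theta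 p(1-p)}{2(1-p)(1-p-\theta p)^2(1-p+p^2+\theta p^2)}+\frac12,$$ $$q(p)=\frac{(1-p)(1-p-\theta p)}{\big(\frac\lambda\eta+e^{-\lambda/\eta}\big)(1+\theta)(1-p+p^2+\theta p^2)}.$$ If $(\theta+1)p\ge1$, then almost surely $\bar\Delta=\infty$ and $q(p)=0$. -/

import Mathlib

open MeasureTheory ProbabilityTheory Filter Topology

noncomputable section

namespace TwoWay

/-- Physical parameters: `lam` is the rate of the exponentially distributed channel power gain,
`N0` the noise spectrum density, `ell` the packet length in nats, `Pt` the transmit power,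
`TB` the block length, `eta` the efficiency of the downlink energy transfer, and `p` the downlink
data rate (a probability). -/
structure Params where
  lam : ℝ
  N0 : ℝ
  ell : ℝ
  Pt : ℝ
  TB : ℝ
  eta : ℝ
  p : ℝ
  lam_pos : 0 < lam
  N0_pos : 0 < N0
  ell_pos : 0 < ell
  Pt_pos : 0 < Pt
  TB_pos : 0 < TB
  eta_pos : 0 < eta
  p_nonneg : 0 ≤ p
  p_le_one : p ≤ 1

/-- The blocks whose channel power gain matters. All indices start from `0`.
* `up k i`: the block of the `i`-th transmission of uplink packet `k` (uplink band);
* `harvest m`: the `m`-th downlink idle block in which the slave node harvests energy;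
* `down k i j m n`: the `n`-th service block of the `m`-th candidate packet of the `j`-th downlink
  busy period which precedes the `i`-th block of the uplink service time of uplink packet `k`. -/
inductive Slot : Type
  | up (k i : ℕ) : Slot
  | harvest (m : ℕ) : Slot
  | down (k i j m n : ℕ) : Slot

/-- The occasions at which the master node generates a new downlink packet with probability `p`.
* `start k i j`: the queue is empty, `j` busy periods have occurred since the previous idle block,
  and the next block would be the `i`-th block of the uplink service time of packet `k`; if a packet
  is generated, a further busy period starts, otherwise the block is a downlink idle block;
* `during k i j m`: the `m`-th block of the `j`-th of these busy periods. -/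
inductive Trial : Type
  | start (k i j : ℕ) : Trial
  | during (k i j m : ℕ) : Trial

/-- The first `n` with `Q n`, and `⊤` if there is none. -/
def firstTime (Q : ℕ → Prop) : ℕ∞ := ⨅ (n : ℕ) (_ : Q n), (n : ℕ∞)

/-- The sum of the first `n` terms of `f`, where `n` may be infinite. -/
def sumTo (n : ℕ∞) (f : ℕ → ℕ∞) : ℕ∞ := ⨆ (m : ℕ) (_ : (m : ℕ∞) ≤ n), ∑ i ∈ Finset.range m, f i

variable (P : Params)

/-- The information delivered in a block with power gain `x`, in the low-SNR regime. -/
def blockInfo (x : ℝ) : ℝ := x * P.Pt * P.TB / P.N0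

/-- The energy received by the slave node in a downlink idle block with power gain `x`. -/
def blockEnergy (x : ℝ) : ℝ := P.eta * x * P.Pt * P.TB

/-- The number of blocks used to deliver a packet when the successive gains are `x 0, x 1, …`
(almost surely the set is nonempty). -/
def serviceTime (x : ℕ → ℝ) : ℕ :=
  sInf {n : ℕ | P.ell ≤ ∑ i ∈ Finset.range n, blockInfo P (x i)}

/-- With stored energy `e`, the number of harvesting blocks, with gains `x 0, x 1, …`, until the
energy suffices for a block of transmission (almost surely the set is nonempty). -/
def harvestCount (e : ℝ) (x : ℕ → ℝ) : ℕ :=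
  sInf {j : ℕ | P.Pt * P.TB ≤ e + ∑ i ∈ Finset.range j, blockEnergy P (x i)}

/-- The number of harvesting blocks used so far and the stored energy, just after the first `r`
uplink transmissions, when the harvesting gains are `x` and the initial energy is `e₀`. -/
def battery (e₀ : ℝ) (x : ℕ → ℝ) : ℕ → ℕ × ℝ
  | 0 => (0, e₀)
  | r + 1 =>
    let M := (battery e₀ x r).1
    let e := (battery e₀ x r).2
    let τ := harvestCount P e (fun i => x (M + i))
    (M + τ, e + ∑ i ∈ Finset.range τ, blockEnergy P (x (M + i)) - P.Pt * P.TB)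

/-- `τ_H`: the number of harvesting blocks needed for the `r`-th uplink transmission. -/
def tauH (e₀ : ℝ) (x : ℕ → ℝ) (r : ℕ) : ℕ :=
  harvestCount P (battery P e₀ x r).2 (fun i => x ((battery P e₀ x r).1 + i))

/-- The length of a downlink busy period that starts with packet `0` in the queue: packet `m + 1`
is generated in its `m`-th block iff `a m`, the `m`-th packet has service time
`serviceTime P (x m)`, and the period ends at the first `n` such that all packets generated within
its first `n` blocks require at most `n` blocks of service altogether. It may be infinite. -/
def busyPeriod (a : ℕ → Bool) (x : ℕ → ℕ → ℝ) : ℕ∞ :=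
  firstTime fun n =>
    serviceTime P (x 0) + ∑ m ∈ Finset.range n, (if a m then serviceTime P (x (m + 1)) else 0) ≤ n

variable (e₀ : ℝ) (d₀ : ℕ) (g : Slot → ℝ) (a : Trial → Bool)

/-- The number `S` of transmission blocks of uplink packet `k`. -/
def upService (k : ℕ) : ℕ := serviceTime P (fun i => g (Slot.up k i))

/-- The number of downlink idle blocks `s = max {1, τ_H}` spent on the `r`-th uplink
transmission. -/
def upBlocks (r : ℕ) : ℕ := max 1 (tauH P e₀ (fun m => g (Slot.harvest m)) r)

/-- Uplink service time `S_UL` of packet `k`, in downlink idle blocks. -/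
def upServiceUL (k : ℕ) : ℕ :=
  ∑ i ∈ Finset.range (upService P g k),
    upBlocks P e₀ g (∑ k' ∈ Finset.range k, upService P g k' + i)

/-- `F`: the number of uninterrupted downlink busy periods just before the `i`-th block of the
uplink service time of packet `k`. -/
def numBusy (k i : ℕ) : ℕ∞ := firstTime fun j => a (Trial.start k i j) = false

/-- `B_D`: the length of the `j`-th of these busy periods. -/
def busyLength (k i j : ℕ) : ℕ∞ :=
  busyPeriod P (fun m => a (Trial.during k i j m)) (fun m n => g (Slot.down k i j m n))

/-- Uplink system time `T` of packet `k`. -/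
def systemTime (k : ℕ) : ℕ∞ :=
  (upServiceUL P e₀ g k : ℕ∞) +
    ∑ i ∈ Finset.range (upServiceUL P e₀ g k), sumTo (numBusy a k i) (busyLength P g a k i)

/-- The epoch (number of elapsed blocks) at which packet `k` is generated; it is the departure
epoch of packet `k - 1` if `k ≥ 1`, and `0` if `k = 0`. -/
def genEpoch (k : ℕ) : ℕ∞ := ∑ k' ∈ Finset.range k, systemTime P e₀ g a k'

/-- `K`: the number of uplink packets delivered within the first `N` blocks. -/
def delivered (N : ℕ) : ℕ := Set.ncard {k : ℕ | genEpoch P e₀ g a (k + 1) ≤ (N : ℕ∞)}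

/-- `U(n)`: the generation epoch of the latest packet received before block `n ≥ 1`, and `-d₀` if
there is none. The age is reset at the end of a departure block, so the packets
received before block `n` are those delivered within the first `n - 1` blocks. -/
def latestGen (n : ℕ) : ℝ :=
  if delivered P e₀ g a (n - 1) = 0 then -(d₀ : ℝ)
  else ((genEpoch P e₀ g a (delivered P e₀ g a (n - 1) - 1)).toNat : ℝ)

/-- Uplink age of information in block `n ≥ 1`; `d₀` is the initial age. -/
def age (n : ℕ) : ℝ := (n : ℝ) - latestGen P e₀ d₀ g a n

/-- Average uplink age of information over the first `N` blocks. -/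
def avgAge (N : ℕ) : ℝ := (1 / (N : ℝ)) * ∑ n ∈ Finset.Icc 1 N, age P e₀ d₀ g a n

/-- The number of delivered uplink packets per block over the first `N` blocks. -/
def upRate (N : ℕ) : ℝ := (delivered P e₀ g a N : ℝ) / (N : ℝ)

/-- The random model: all power gains are exponential with rate `lam`, all packet generations have
probability `p`, and everything is mutually independent. -/
structure IsModel {Ω : Type*} [MeasurableSpace Ω] (μ : Measure Ω)
    (γ : Slot → Ω → ℝ) (A : Trial → Ω → Bool) : Prop where
  measurable_gain : ∀ s, Measurable (γ s)
  measurable_gen : ∀ t, Measurable (A t)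
  gain_law : ∀ s, μ.map (γ s) = expMeasure P.lam
  gen_law : ∀ t, μ {ω | A t ω = true} = ENNReal.ofReal P.p
  gain_indep : iIndepFun γ μ
  gen_indep : iIndepFun A μ
  gain_gen_indep : IndepFun (fun ω s => γ s ω) (fun ω t => A t ω) μ

end TwoWay

end

/-! The age is a renewal reward. If the packets have finite system times t_k ≥ 1, then during packet
k ≥ 1 the age runs through t_{k-1}+1, …, t_{k-1}+t_k, with sum t_{k-1} t_k + (t_k² + t_k)/2. As soon
as the averages of t_k, t_k² and t_k t_{k+1} tend to m, v and m², the delivery rate tends to 1/m and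
the average age to m + v/(2m) + 1/2 (`tendsto_upRate`, `tendsto_avgAge`). If the t_k have infinite
mean, the rate vanishes; and since a period of length t contributes at least t²/2 ≥ Lt - L²/2 for
every L, the average age exceeds every bound (`le_sum_age`).

The stochastic point is that the system times become i.i.d. although the stored energy links them.
Measure energy in units of gain and put the stored energy in front of the unused harvesting gains as
a zeroth term. A transmission is then a first passage of the partial sums over the level 1/η: the
passing index is the number of harvesting blocks, the overshoot is the energy left. For i.i.d.
exponential terms the index is Poisson, and by memorylessness the overshoot followed by the unused
gains is again an i.i.d. exponential sequence, independent of the index (`expSeq_isPass_shiftAt`,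
`refresh_passTime`). `Refresh` abstracts this property and turns it into independence along orbits.
A deterministic initial energy does not have the exponential law, but the state has exactly the
stationary law once enough packets have used that energy up (`map_nextState_iterate_seqCons`), and
finitely many packets do not affect averages.

The rest is moments. A service time is 1 + Poisson(θ). During a downlink busy period the mean work
arriving per block is p(1+θ); if this is less than 1, Wald's two identities give the mean and second
moment of its length, and if it is at least 1, the first identity forces an infinite mean
(`lintegral_emptyTime`, `lintegral_emptyTime_sq`, `lintegral_emptyTime_eq_top`). The gap between
idle blocks is 1 plus a geometric sum of busy periods. A system time is the sum of the gaps over the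
idle blocks of a packet, whose number is a sum of S independent copies of max(1, Poisson(λ/η)). All
these random sums are handled by one conditioning argument (`lintegral_randomSum`,
`lintegral_randomSum_sq`). -/

open scoped ENNReal NNReal

namespace TwoWay

/-! ### Measurability of first times and of sums with a random number of terms. -/

section Measurability

variable {Ω : Type*} [MeasurableSpace Ω]

theorem measurable_comp_index {ι β : Type*} [Countable ι] [MeasurableSpace ι]
    [MeasurableSingletonClass ι] [MeasurableSpace β]
    {J : Ω → ι} (hJ : Measurable J) {f : ι → Ω → β} (hf : ∀ j, Measurable (f j)) :
    Measurable fun ω => f (J ω) ω :=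
  (measurable_from_prod_countable_right (f := fun q : ι × Ω => f q.1 q.2) hf).comp
    (hJ.prodMk measurable_id)

theorem measurable_sInf_nat {Q : ℕ → Ω → Prop} (hQ : ∀ n, MeasurableSet {ω | Q n ω}) :
    Measurable fun ω => sInf {n | Q n ω} := by
  classical
  have h0 : MeasurableSet {ω | ∃ n, Q n ω} := by
    have : {ω | ∃ n, Q n ω} = ⋃ n, {ω | Q n ω} := by ext; simp
    rw [this]; exact MeasurableSet.iUnion hQ
  refine measurable_to_countable' fun j => ?_
  -- The second piece is there because `sInf ∅ = 0` in `ℕ`.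
  have : (fun ω => sInf {n | Q n ω}) ⁻¹' {j} =
      ({ω | Q j ω} ∩ ⋂ i ∈ Finset.range j, {ω | Q i ω}ᶜ) ∪
        ({ω | ∃ n, Q n ω}ᶜ ∩ {_ω | j = 0}) := by
    ext ω
    simp only [Set.mem_preimage, Set.mem_singleton_iff, Set.mem_union, Set.mem_inter_iff,
      Set.mem_ofPred_eq, Set.mem_iInter, Finset.mem_range, Set.mem_compl_iff, not_exists]
    constructor
    · rintro rfl
      by_cases h : ∃ n, Q n ω
      · left
        exact ⟨Nat.sInf_mem (s := {n | Q n ω}) h, fun i hi => Nat.notMem_of_lt_sInf hi⟩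
      · right
        push Not at h
        refine ⟨h, ?_⟩
        have : {n | Q n ω} = ∅ := by ext n; simp [h n]
        rw [this, Nat.sInf_empty]
    · rintro (⟨h1, h2⟩ | ⟨h1, rfl⟩)
      · refine le_antisymm (Nat.sInf_le h1) ?_
        by_contra hlt
        push Not at hlt
        exact h2 _ hlt (Nat.sInf_mem (s := {n | Q n ω}) ⟨j, h1⟩)
      · have : {n | Q n ω} = ∅ := by ext n; simp [h1 n]
        rw [this, Nat.sInf_empty]
  rw [this]
  exact ((hQ j).inter (Finset.measurableSet_biInter _ fun i _ => (hQ i).compl)).union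
    (h0.compl.inter (MeasurableSet.const _))

theorem lt_firstTime_iff {Q : ℕ → Prop} {n : ℕ} :
    (n : ℕ∞) < firstTime Q ↔ ∀ i ≤ n, ¬ Q i := by
  rw [← not_iff_not]
  push Not
  unfold firstTime
  constructor
  · intro h
    by_contra hc
    push Not at hc
    have : ((n + 1 : ℕ) : ℕ∞) ≤ ⨅ (m : ℕ) (_ : Q m), (m : ℕ∞) := by
      refine le_iInf₂ fun m hm => ?_
      rw [Nat.cast_le]
      by_contra hlt
      exact hc m (by omega) hm
    have h2 := this.trans h
    rw [Nat.cast_le] at h2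
    omega
  · rintro ⟨i, hi, hQ⟩
    exact (iInf₂_le i hQ).trans (by exact_mod_cast hi)

theorem firstTime_eq_coe_iff {Q : ℕ → Prop} {n : ℕ} :
    firstTime Q = n ↔ Q n ∧ ∀ i < n, ¬ Q i := by
  constructor
  · intro h
    have h1 : ∀ i < n, ¬ Q i := by
      intro i hi
      have : (i : ℕ∞) < firstTime Q := by rw [h]; exact_mod_cast hi
      exact lt_firstTime_iff.1 this i le_rfl
    have h2 : ¬ (n : ℕ∞) < firstTime Q := by rw [h]; exact lt_irrefl _
    rw [lt_firstTime_iff] at h2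
    push Not at h2
    obtain ⟨i, hi, hQ⟩ := h2
    rcases hi.lt_or_eq with h3 | rfl
    · exact absurd hQ (h1 i h3)
    · exact ⟨hQ, h1⟩
  · rintro ⟨h1, h2⟩
    refine le_antisymm (iInf₂_le n h1) (le_iInf₂ fun m hm => ?_)
    rw [Nat.cast_le]
    by_contra hlt
    exact h2 m (by omega) hm

theorem measurable_of_lt {f : Ω → ℕ∞} (h : ∀ n : ℕ, MeasurableSet {ω | (n : ℕ∞) < f ω}) :
    Measurable f := by
  refine ENat.measurable_iff.2 fun n => ?_
  have : f ⁻¹' {(n : ℕ∞)} = {ω | (n : ℕ∞) < f ω}ᶜ ∩ ⋂ m ∈ Finset.range n, {ω | (m : ℕ∞) < f ω} := by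
    ext ω
    simp only [Set.mem_preimage, Set.mem_singleton_iff, Set.mem_inter_iff, Set.mem_compl_iff,
      Set.mem_ofPred_eq, not_lt, Set.mem_iInter, Finset.mem_range]
    constructor
    · intro h; rw [h]; exact ⟨le_rfl, fun m hm => by exact_mod_cast hm⟩
    · rintro ⟨h1, h2⟩
      refine le_antisymm h1 ?_
      rcases n with _ | n
      · simp
      · have := Order.add_one_le_of_lt (h2 n (by omega))
        exact_mod_cast this
  rw [this]
  exact (h n).compl.inter (Finset.measurableSet_biInter _ fun i _ => h i)

theorem measurable_firstTime {Q : ℕ → Ω → Prop} (hQ : ∀ n, MeasurableSet {ω | Q n ω}) :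
    Measurable fun ω => firstTime fun n => Q n ω := by
  refine measurable_of_lt fun n => ?_
  have : {ω | (n : ℕ∞) < firstTime fun n => Q n ω} =
      ⋂ i ∈ Finset.range (n + 1), {ω | Q i ω}ᶜ := by
    ext ω
    simp [lt_firstTime_iff]
  rw [this]
  exact Finset.measurableSet_biInter _ fun i _ => (hQ i).compl

theorem measurable_enat_sum {f : ℕ → Ω → ℕ∞} (hf : ∀ i, Measurable (f i)) (n : ℕ) :
    Measurable fun ω => ∑ i ∈ Finset.range n, f i ω := by
  induction n with
  | zero => simp
  | succ n ih =>
    simp only [Finset.sum_range_succ]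
    exact (measurable_of_countable (fun q : ℕ∞ × ℕ∞ => q.1 + q.2)).comp (ih.prodMk (hf n))

theorem measurable_sumTo {N : Ω → ℕ∞} (hN : Measurable N) {f : ℕ → Ω → ℕ∞}
    (hf : ∀ i, Measurable (f i)) : Measurable fun ω => sumTo (N ω) fun i => f i ω := by
  refine measurable_of_lt fun n => ?_
  have : {ω | (n : ℕ∞) < sumTo (N ω) fun i => f i ω} =
      ⋃ m : ℕ, {ω | (m : ℕ∞) ≤ N ω} ∩ {ω | (n : ℕ∞) < ∑ i ∈ Finset.range m, f i ω} := by
    ext ω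
    simp [sumTo, lt_iSup_iff]
  rw [this]
  refine MeasurableSet.iUnion fun m => ?_
  exact (hN (MeasurableSet.of_discrete (s := {k | (m : ℕ∞) ≤ k}))).inter
    (measurable_enat_sum hf m (MeasurableSet.of_discrete (s := {k | (n : ℕ∞) < k})))

theorem sumTo_coe (n : ℕ) (f : ℕ → ℕ∞) : sumTo n f = ∑ i ∈ Finset.range n, f i := by
  unfold sumTo
  refine le_antisymm (iSup₂_le fun m hm => ?_) (le_iSup₂ (f := fun (m : ℕ) (_ : (m : ℕ∞) ≤ n) =>
    ∑ i ∈ Finset.range m, f i) n le_rfl)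
  exact Finset.sum_le_sum_of_subset (Finset.range_mono (by exact_mod_cast hm))

theorem sum_le_sumTo {m : ℕ} {n : ℕ∞} (h : (m : ℕ∞) ≤ n) (f : ℕ → ℕ∞) :
    ∑ i ∈ Finset.range m, f i ≤ sumTo n f :=
  le_iSup₂ (f := fun (m : ℕ) (_ : (m : ℕ∞) ≤ n) => ∑ i ∈ Finset.range m, f i) m h

end Measurability

/-! ### Independence of functions of disjoint blocks of coordinates. -/

section Independence

variable {Ω ι E : Type*} [MeasurableSpace Ω] {μ : Measure Ω} [MeasurableSpace E]

/-- The fibres of `g` partition the index set. Regrouping the product law by fibres (currying over a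
sigma type) gives independence of the blocks, and each `φ k` reads only its own block. -/
theorem iIndepFun_of_dependsOn [Zero E] {κ : Type*} {X : ι → Ω → E} (hX : iIndepFun X μ)
    (mX : ∀ i, Measurable (X i)) (g : ι → κ) {𝒴 : κ → Type*} [∀ k, MeasurableSpace (𝒴 k)]
    {φ : ∀ k, (ι → E) → 𝒴 k} (mφ : ∀ k, Measurable (φ k))
    (hφ : ∀ k, DependsOn (φ k) {i | g i = k}) :
    iIndepFun (fun k ω => φ k fun i => X i ω) μ := by
  classical
  have := hX.isProbabilityMeasure
  have hp : ∀ i, IsProbabilityMeasure (μ.map (X i)) :=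
    fun i => Measure.isProbabilityMeasure_map (mX i).aemeasurable
  let e := Equiv.sigmaFiberEquiv g
  have h1 : iIndepFun (fun s : (k : κ) × {i // g i = k} => X s.2.1) μ :=
    hX.precomp (g := fun s : (k : κ) × {i // g i = k} => s.2.1) e.injective
  have h2 : iIndepFun (fun k ω => fun i : {i // g i = k} => X i.1 ω) μ := by
    rw [iIndepFun_iff_map_fun_eq_infinitePi_map (by fun_prop)]
    have h3 := h1.map_fun_eq_infinitePi_map (fun s => mX _)
    have h4 := congrArg (fun m => m.map (MeasurableEquiv.piCurry (fun k (i : {i // g i = k}) => E))) h3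
    rw [Measure.map_map (by fun_prop) (by fun_prop)] at h4
    rw [Measure.infinitePi_map_piCurry (fun k (i : {i // g i = k}) => μ.map (X i.1))] at h4
    have h5 : ∀ k, Measure.infinitePi (fun i : {i // g i = k} => μ.map (X i.1)) =
        μ.map fun ω => fun i : {i // g i = k} => X i.1 ω := fun k =>
      (iIndepFun.map_fun_eq_infinitePi_map (fun i => mX _)
        (hX.precomp (g := fun i : {i // g i = k} => i.1) Subtype.val_injective)).symm
    simp_rw [h5] at h4
    exact h4
  -- A block is extended by zero to a full family; the added values are irrelevant since `φ k`
  -- depends only on the fibre over `k`.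
  let ψ : ∀ k, ({i // g i = k} → E) → ι → E := fun k y i => if h : g i = k then y ⟨i, h⟩ else 0
  have mψ : ∀ k, Measurable (ψ k) := by
    intro k
    refine measurable_pi_iff.2 fun i => ?_
    by_cases h : g i = k
    · simp only [ψ, h, dite_true]; exact measurable_pi_apply _
    · simp only [ψ, h, dite_false]; exact measurable_const
  have h6 := h2.comp (fun k => φ k ∘ ψ k) fun k => (mφ k).comp (mψ k)
  convert h6 using 3 with k ω
  refine hφ k fun i hi => ?_
  have hi' : g i = k := hi
  simp [ψ, hi']

theorem indepFun_of_dependsOn [Zero E] {X : ι → Ω → E} (hX : iIndepFun X μ)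
    (mX : ∀ i, Measurable (X i)) {s t : Set ι} (hst : Disjoint s t) {𝒴 𝒵 : Type*}
    [MeasurableSpace 𝒴] [MeasurableSpace 𝒵] {φ : (ι → E) → 𝒴} {ψ : (ι → E) → 𝒵}
    (mφ : Measurable φ) (mψ : Measurable ψ) (hφ : DependsOn φ s) (hψ : DependsOn ψ t) :
    IndepFun (fun ω => φ fun i => X i ω) (fun ω => ψ fun i => X i ω) μ := by
  classical
  -- Two blocks, labelled by membership in `s`. Masking with zeros produces measurable maps that
  -- keep exactly the coordinates `φ` and `ψ` need.
  have h := iIndepFun_of_dependsOn hX mX (fun i => decide (i ∈ s)) (𝒴 := fun _ => ι → E)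
    (φ := fun b x i => if i ∈ (if b then s else t) ∧ decide (i ∈ s) = b then x i else 0) (by
      intro b
      refine measurable_pi_iff.2 fun i => ?_
      by_cases hi : i ∈ (if b then s else t) ∧ decide (i ∈ s) = b
      · simp only [hi, and_self, if_true]; exact measurable_pi_apply _
      · simp only [hi, if_false]; exact measurable_const) (by
      intro b x y h
      funext i
      by_cases hi : i ∈ (if b then s else t) ∧ decide (i ∈ s) = b
      · simp only [hi]; rw [h i hi.2]
      · simp only [hi, if_false])
  have h' := (h.indepFun (i := true) (j := false) (by simp)).comp mφ mψ
  convert h' using 1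
  · funext ω
    refine hφ fun i hi => ?_
    simp [hi]
  · funext ω
    refine hψ fun i hi => ?_
    have : i ∉ s := fun h => (Set.disjoint_left.1 hst) h hi
    simp [hi, this]

theorem map_comp_embedding {α : Type*} {X : ι → Ω → E} (hX : iIndepFun X μ)
    (mX : ∀ i, Measurable (X i)) {f : α → ι} (hf : Function.Injective f) :
    μ.map (fun ω a => X (f a) ω) = Measure.infinitePi fun a => μ.map (X (f a)) :=
  (hX.precomp hf).map_fun_eq_infinitePi_map fun _ => mX _

end Independence

theorem indepFun_comp_measurePreserving {Ω Ω' α β : Type*} [MeasurableSpace Ω]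
    [MeasurableSpace Ω'] {μ : Measure Ω} {ν : Measure Ω'}
    [MeasurableSpace α] [MeasurableSpace β] {f : Ω' → α} {g : Ω' → β} {h : Ω → Ω'}
    (hfg : IndepFun f g ν) (hf : Measurable f) (hg : Measurable g) (hh : MeasurePreserving h μ ν) :
    IndepFun (fun ω => f (h ω)) (fun ω => g (h ω)) μ := by
  rw [indepFun_iff_measure_inter_preimage_eq_mul] at hfg ⊢
  intro s t hs ht
  have h1 := hfg s t hs ht
  rw [← hh.measure_preimage (hf hs).nullMeasurableSet,
    ← hh.measure_preimage (hg ht).nullMeasurableSet,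
    ← hh.measure_preimage ((hf hs).inter (hg ht)).nullMeasurableSet] at h1
  exact h1

/-! ### Moments of sums with an independent random number of terms. -/

section RandomSum

variable {Ω : Type*} [MeasurableSpace Ω] {μ : Measure Ω} [IsProbabilityMeasure μ]

theorem lintegral_of_indepFun {𝒲 𝒴 : Type*} [MeasurableSpace 𝒲] [MeasurableSpace 𝒴]
    {W : Ω → 𝒲} {Y : Ω → 𝒴} (hW : Measurable W) (hY : Measurable Y) (h : IndepFun W Y μ)
    {F : 𝒲 × 𝒴 → ℝ≥0∞} (hF : Measurable F) :
    ∫⁻ ω, F (W ω, Y ω) ∂μ = ∫⁻ ω, ∫⁻ ω', F (W ω, Y ω') ∂μ ∂μ := by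
  have := Measure.isProbabilityMeasure_map (μ := μ) hY.aemeasurable
  rw [← lintegral_map (μ := μ) (f := F) hF (hW.prodMk hY),
    (indepFun_iff_map_prod_eq_prod_map_map hW.aemeasurable hY.aemeasurable).1 h,
    lintegral_prod _ hF.aemeasurable, lintegral_map hF.lintegral_prod_right' hW]
  refine lintegral_congr fun ω => ?_
  exact lintegral_map (f := fun y => F (W ω, y)) (hF.comp measurable_prodMk_left) hY

theorem lintegral_sq_sum {Z : ℕ → Ω → ℝ≥0∞} (hZ : ∀ i, Measurable (Z i)) {a b : ℝ≥0∞}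
    (ha : ∀ i, ∫⁻ ω, Z i ω ∂μ = a) (hb : ∀ i, ∫⁻ ω, Z i ω ^ 2 ∂μ = b)
    (hi : Pairwise fun i j => IndepFun (Z i) (Z j) μ) (n : ℕ) :
    ∫⁻ ω, (∑ i ∈ Finset.range n, Z i ω) ^ 2 ∂μ = n * b + (n * (n - 1) : ℕ) * a ^ 2 := by
  induction n with
  | zero => simp
  | succ n ih =>
    have h1 : ∀ ω, (∑ i ∈ Finset.range (n + 1), Z i ω) ^ 2 =
        (∑ i ∈ Finset.range n, Z i ω) ^ 2 + (2 * (∑ i ∈ Finset.range n, Z i ω * Z n ω) + Z n ω ^ 2) := by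
      intro ω; rw [Finset.sum_range_succ, ← Finset.sum_mul]; ring
    have h2 : ∀ i ∈ Finset.range n, ∫⁻ ω, Z i ω * Z n ω ∂μ = a * a := by
      intro i hin
      have := lintegral_mul_eq_lintegral_mul_lintegral_of_indepFun (hZ i) (hZ n)
        (hi (Finset.mem_range.1 hin).ne)
      simpa [ha] using this
    simp_rw [h1]
    rw [lintegral_add_left (by fun_prop), ih, lintegral_add_left (by fun_prop), hb,
      lintegral_const_mul _ (by fun_prop), lintegral_finsetSum _ (by fun_prop),
      Finset.sum_congr rfl h2]
    have h3 : (n + 1) * (n + 1 - 1) = n * (n - 1) + 2 * n := by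
      rcases n with _ | n
      · rfl
      · simp only [Nat.add_sub_cancel]; ring
    rw [h3]
    simp only [Finset.sum_const, Finset.card_range, nsmul_eq_mul]
    push_cast
    ring

theorem lintegral_randomSum {W : Ω → ℕ} {Z : ℕ → Ω → ℝ≥0∞} (hW : Measurable W)
    (hZ : ∀ i, Measurable (Z i)) {a : ℝ≥0∞} (ha : ∀ i, ∫⁻ ω, Z i ω ∂μ = a)
    (h : IndepFun W (fun ω i => Z i ω) μ) :
    ∫⁻ ω, ∑ i ∈ Finset.range (W ω), Z i ω ∂μ = (∫⁻ ω, (W ω : ℝ≥0∞) ∂μ) * a := by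
  have hF : Measurable fun q : ℕ × (ℕ → ℝ≥0∞) => ∑ i ∈ Finset.range q.1, q.2 i :=
    measurable_from_prod_countable_right fun n => by dsimp only; fun_prop
  rw [lintegral_of_indepFun hW (measurable_pi_iff.2 hZ) h hF, ← lintegral_mul_const _ (by fun_prop)]
  refine lintegral_congr fun ω => ?_
  dsimp only
  rw [lintegral_finsetSum _ (by fun_prop)]
  simp [ha]

/-- Condition on `W = n` and expand the square: n diagonal terms and n(n-1) ordered pairs, each pair
factoring by pairwise independence. Hence the factorial moment of `W`. -/
theorem lintegral_randomSum_sq {W : Ω → ℕ} {Z : ℕ → Ω → ℝ≥0∞} (hW : Measurable W)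
    (hZ : ∀ i, Measurable (Z i)) {a b : ℝ≥0∞} (ha : ∀ i, ∫⁻ ω, Z i ω ∂μ = a)
    (hb : ∀ i, ∫⁻ ω, Z i ω ^ 2 ∂μ = b) (hi : Pairwise fun i j => IndepFun (Z i) (Z j) μ)
    (h : IndepFun W (fun ω i => Z i ω) μ) :
    ∫⁻ ω, (∑ i ∈ Finset.range (W ω), Z i ω) ^ 2 ∂μ =
      (∫⁻ ω, (W ω : ℝ≥0∞) ∂μ) * b + (∫⁻ ω, ((W ω * (W ω - 1) : ℕ) : ℝ≥0∞) ∂μ) * a ^ 2 := by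
  have hF : Measurable fun q : ℕ × (ℕ → ℝ≥0∞) => (∑ i ∈ Finset.range q.1, q.2 i) ^ 2 :=
    measurable_from_prod_countable_right fun n => by dsimp only; fun_prop
  have h2 : Measurable fun ω => ((W ω * (W ω - 1) : ℕ) : ℝ≥0∞) :=
    (measurable_of_countable fun n : ℕ => ((n * (n - 1) : ℕ) : ℝ≥0∞)).comp hW
  rw [lintegral_of_indepFun hW (measurable_pi_iff.2 hZ) h hF, ← lintegral_mul_const _ (by fun_prop),
    ← lintegral_mul_const _ h2, ← lintegral_add_left (by fun_prop)]
  exact lintegral_congr fun ω => lintegral_sq_sum hZ ha hb hi (W ω)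

theorem lintegral_prod_fst {𝒲 𝒴 : Type*} [MeasurableSpace 𝒲] [MeasurableSpace 𝒴] (υ : Measure 𝒲)
    [IsProbabilityMeasure υ] (ν : Measure 𝒴) [IsProbabilityMeasure ν] {f : 𝒲 → ℝ≥0∞}
    (hf : Measurable f) : ∫⁻ q, f q.1 ∂υ.prod ν = ∫⁻ w, f w ∂υ :=
  (measurePreserving_fst (μ := υ) (ν := ν)).lintegral_comp hf

theorem lintegral_prod_snd {𝒲 𝒴 : Type*} [MeasurableSpace 𝒲] [MeasurableSpace 𝒴] (υ : Measure 𝒲)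
    [IsProbabilityMeasure υ] (ν : Measure 𝒴) [IsProbabilityMeasure ν] {f : 𝒴 → ℝ≥0∞}
    (hf : Measurable f) : ∫⁻ q, f q.2 ∂υ.prod ν = ∫⁻ y, f y ∂ν :=
  (measurePreserving_snd (μ := υ) (ν := ν)).lintegral_comp hf

end RandomSum

/-! ### Transitions whose output is independent of the next, stationary state. -/

section Refresh

variable {X : Type*} [MeasurableSpace X]

/-- The output `O` is independent of the next state `N`, and `N` preserves the measure `m`. -/
structure Refresh {𝒪 : Type*} [MeasurableSpace 𝒪] (m : Measure X) (O : X → 𝒪) (N : X → X) :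
    Prop where
  measurable_out : Measurable O
  measurable_next : Measurable N
  map_eq : m.map (fun x => (O x, N x)) = (m.map O).prod m

namespace Refresh

variable {𝒪 𝒪' : Type*} [MeasurableSpace 𝒪] [MeasurableSpace 𝒪'] {m : Measure X}
  [IsProbabilityMeasure m] {O : X → 𝒪} {O' : X → 𝒪'} {N N' : X → X}

theorem measurePreserving (h : Refresh m O N) : MeasurePreserving N m m := by
  have := Measure.isProbabilityMeasure_map (μ := m) h.measurable_out.aemeasurable
  refine ⟨h.measurable_next, ?_⟩
  have h1 := congrArg (fun q => q.map Prod.snd) h.map_eq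
  rw [Measure.map_map measurable_snd (h.measurable_out.prodMk h.measurable_next)] at h1
  simpa [Measure.map_snd_prod] using! h1

theorem measure_eq (h : Refresh m O N) {C : Set 𝒪} {D : Set X} (hC : MeasurableSet C)
    (hD : MeasurableSet D) : m {x | O x ∈ C ∧ N x ∈ D} = m (O ⁻¹' C) * m D := by
  have h1 := congrArg (fun q => q (C ×ˢ D)) h.map_eq
  have := Measure.isProbabilityMeasure_map (μ := m) h.measurable_out.aemeasurable
  simp only [Measure.prod_prod] at h1
  rw [Measure.map_apply (h.measurable_out.prodMk h.measurable_next) (hC.prod hD),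
    Measure.map_apply h.measurable_out hC] at h1
  exact h1

theorem of_measure_eq (hO : Measurable O) (hN : Measurable N)
    (h : ∀ C D, MeasurableSet C → MeasurableSet D →
      m {x | O x ∈ C ∧ N x ∈ D} = m (O ⁻¹' C) * m D) : Refresh m O N := by
  have := Measure.isProbabilityMeasure_map (μ := m) hO.aemeasurable
  refine ⟨hO, hN, (Measure.prod_eq fun C D hC hD => ?_).symm⟩
  rw [Measure.map_apply (hO.prodMk hN) (hC.prod hD), Measure.map_apply hO hC]
  exact h C D hC hD

theorem map_out (h : Refresh m O N) {f : 𝒪 → 𝒪'} (hf : Measurable f) :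
    Refresh m (fun x => f (O x)) N :=
  of_measure_eq (hf.comp h.measurable_out) h.measurable_next fun _ _ hC hD =>
    h.measure_eq (hf hC) hD

/-- Apply the second transition to the second factor of the product law of the first: the two
outputs and the final state are then jointly independent, and associating the product the other way
gives the claim. -/
theorem comp (h : Refresh m O N) (h' : Refresh m O' N') :
    Refresh m (fun x => (O x, O' (N x))) (fun x => N' (N x)) := by
  have := Measure.isProbabilityMeasure_map (μ := m) h.measurable_out.aemeasurable
  have := Measure.isProbabilityMeasure_map (μ := m) h'.measurable_out.aemeasurable
  have mO := h.measurable_out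
  have mN := h.measurable_next
  have mO' := h'.measurable_out
  have mN' := h'.measurable_next
  have h1 : m.map (fun x => (O x, (O' (N x), N' (N x)))) =
      (m.map O).prod ((m.map O').prod m) := by
    rw [← h'.map_eq]
    have h2 := congrArg (fun q => q.map (Prod.map id fun x => (O' x, N' x))) h.map_eq
    rw [Measure.map_map (by fun_prop) (by fun_prop),
      ← Measure.map_prod_map _ _ measurable_id (by fun_prop), Measure.map_id] at h2
    exact h2
  have h3 : m.map (fun x => (O x, O' (N x))) = (m.map O).prod (m.map O') := by
    have h2 := congrArg (fun q => q.map (Prod.map id O')) h.map_eq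
    rw [Measure.map_map (by fun_prop) (by fun_prop),
      ← Measure.map_prod_map _ _ measurable_id (by fun_prop), Measure.map_id] at h2
    exact h2
  refine ⟨by fun_prop, by fun_prop, ?_⟩
  refine MeasurableEquiv.prodAssoc.map_measurableEquiv_injective ?_
  rw [h3, Measure.prodAssoc_prod, Measure.map_map (by fun_prop) (by fun_prop)]
  exact h1

/-- The first output is independent of the next state, which has law `m` again; so its factor splits
off and the induction continues from the next state. -/
theorem measure_iterate (h : Refresh m O N) (n : ℕ) (C : ℕ → Set 𝒪)
    (hC : ∀ k, MeasurableSet (C k)) :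
    m {x | ∀ k < n, O (N^[k] x) ∈ C k} = ∏ k ∈ Finset.range n, m (O ⁻¹' C k) := by
  induction n generalizing C with
  | zero => simp
  | succ n ih =>
    have hD : MeasurableSet {x | ∀ k < n, O (N^[k] x) ∈ C (k + 1)} := by
      simp only [Set.ofPred_forall]
      exact MeasurableSet.iInter fun k => MeasurableSet.iInter fun _ =>
        (h.measurable_out.comp (h.measurable_next.iterate k)) (hC _)
    rw [Finset.prod_range_succ', ← ih (fun k => C (k + 1)) (fun k => hC _), mul_comm,
      ← h.measure_eq (hC 0) hD]
    congr 1
    ext x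
    simp only [Set.mem_ofPred_eq]
    constructor
    · intro hx
      exact ⟨hx 0 (by omega), fun k hk => by simpa using hx (k + 1) (by omega)⟩
    · rintro ⟨h0, h1⟩ k hk
      rcases k with _ | k
      · exact h0
      · simpa using h1 k (by omega)

theorem iIndepFun_iterate (h : Refresh m O N) : iIndepFun (fun k x => O (N^[k] x)) m := by
  classical
  rw [iIndepFun_iff_measure_inter_preimage_eq_mul]
  intro S C hC
  obtain ⟨n, hn⟩ : ∃ n, S ⊆ Finset.range n := S.exists_nat_subset_range
  let C' : ℕ → Set 𝒪 := fun k => if k ∈ S then C k else Set.univ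
  have hC' : ∀ k, MeasurableSet (C' k) := by
    intro k
    by_cases hk : k ∈ S
    · simpa [C', hk] using hC k hk
    · simp [C', hk]
  have h1 := h.measure_iterate n C' hC'
  have h2 : {x | ∀ k < n, O (N^[k] x) ∈ C' k} = ⋂ k ∈ S, (fun x => O (N^[k] x)) ⁻¹' C k := by
    ext x
    simp only [Set.mem_ofPred_eq, Set.mem_iInter, Set.mem_preimage]
    constructor
    · intro hx k hk
      simpa [C', hk] using hx k (Finset.mem_range.1 (hn hk))
    · intro hx k _
      by_cases hk : k ∈ S
      · simpa [C', hk] using hx k hk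
      · simp [C', hk]
  rw [← h2, h1, ← Finset.prod_subset hn]
  · refine Finset.prod_congr rfl fun k hk => ?_
    have h3 := (h.measurePreserving.iterate k).measure_preimage
      (h.measurable_out (hC k hk)).nullMeasurableSet
    simp only [C', hk, if_true]
    rw [← h3]; rfl
  · intro k _ hk
    simp [C', hk]

/-- A transition with a random parameter whose every value gives a refreshing transition. -/
theorem param {U : Type*} [MeasurableSpace U] {υ : Measure U} [IsProbabilityMeasure υ]
    {O : U → X → 𝒪} {N : U → X → X} (hO : Measurable fun q : U × X => O q.1 q.2)
    (hN : Measurable fun q : U × X => N q.1 q.2) (h : ∀ᵐ u ∂υ, Refresh m (O u) (N u)) :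
    (υ.prod m).map (fun q => (O q.1 q.2, N q.1 q.2)) =
      ((υ.prod m).map fun q => O q.1 q.2).prod m := by
  have := Measure.isProbabilityMeasure_map (μ := υ.prod m) hO.aemeasurable
  refine (Measure.prod_eq fun C D hC hD => ?_).symm
  rw [Measure.map_apply (hO.prodMk hN) (hC.prod hD), Measure.map_apply hO hC,
    Measure.prod_apply ((hO.prodMk hN) (hC.prod hD)), Measure.prod_apply (hO hC),
    ← lintegral_mul_const _ (measurable_measure_prodMk_left (hO hC))]
  refine lintegral_congr_ae ?_
  filter_upwards [h] with u hu
  exact hu.measure_eq hC hD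

end Refresh

end Refresh

/-! ### Sequences of independent exponential variables. -/

section Sequences

/-- The sequence that starts with `a` and continues with `x`. -/
def seqCons (a : ℝ) (x : ℕ → ℝ) : ℕ → ℝ
  | 0 => a
  | n + 1 => x n

@[simp] theorem seqCons_zero (a : ℝ) (x : ℕ → ℝ) : seqCons a x 0 = a := rfl

@[simp] theorem seqCons_succ (a : ℝ) (x : ℕ → ℝ) (n : ℕ) : seqCons a x (n + 1) = x n := rfl

theorem seqCons_eta (y : ℕ → ℝ) : seqCons (y 0) (fun n => y (n + 1)) = y := by
  funext n; cases n <;> rfl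

@[fun_prop]
theorem measurable_seqCons : Measurable fun q : ℝ × (ℕ → ℝ) => seqCons q.1 q.2 := by
  refine measurable_pi_iff.2 fun n => ?_
  cases n with
  | zero => exact measurable_fst
  | succ n => exact (measurable_pi_apply n).comp measurable_snd

instance (lam : ℝ) [h : Fact (0 < lam)] : IsProbabilityMeasure (expMeasure lam) :=
  isProbabilityMeasure_expMeasure h.out

/-- The law of a sequence of independent exponential variables. -/
noncomputable def expSeq (lam : ℝ) [Fact (0 < lam)] : Measure (ℕ → ℝ) :=
  Measure.infinitePi fun _ => expMeasure lam

instance (lam : ℝ) [Fact (0 < lam)] : IsProbabilityMeasure (expSeq lam) := by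
  unfold expSeq; infer_instance

theorem map_head_tail_infinitePi {Y : Type*} [MeasurableSpace Y] (υ : Measure Y)
    [IsProbabilityMeasure υ] :
    (Measure.infinitePi fun _ : ℕ => υ).map (fun y => (y 0, fun n => y (n + 1))) =
      υ.prod (Measure.infinitePi fun _ : ℕ => υ) := by
  have h0 : iIndepFun (fun (n : ℕ) (y : ℕ → Y) => y n) (Measure.infinitePi fun _ : ℕ => υ) :=
    iIndepFun_infinitePi (P := fun _ : ℕ => υ) (X := fun _ y => y) fun _ => measurable_id
  have h1 : IndepFun (fun y : ℕ → Y => y 0) (fun y (n : ℕ) => y (n + 1))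
      (Measure.infinitePi fun _ : ℕ => υ) := by
    have h2 := indep_iSup_of_disjoint (m := fun n : ℕ => MeasurableSpace.comap (fun y : ℕ → Y => y n) inferInstance)
      (fun n => (measurable_pi_apply n).comap_le) h0 (S := {0}) (T := {n | 0 < n}) (by simp)
    refine indep_of_indep_of_le_left (indep_of_indep_of_le_right h2 ?_) (by simp)
    rw [← measurable_iff_comap_le]
    refine @measurable_pi_lambda _ _ _ (_) _ _ fun n => ?_
    rw [measurable_iff_comap_le]
    exact le_iSup₂_of_le (n + 1) (Nat.succ_pos n) le_rfl
  rw [(indepFun_iff_map_prod_eq_prod_map_map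
      (measurable_pi_apply 0).aemeasurable
      (measurable_pi_lambda _ fun n => measurable_pi_apply (n + 1)).aemeasurable).1 h1,
    Measure.infinitePi_map_eval,
    Measure.map_infinitePi_infinitePi_of_inj (P := fun _ : ℕ => υ) (add_left_injective 1)]

theorem map_seqCons (lam : ℝ) [Fact (0 < lam)] :
    ((expMeasure lam).prod (expSeq lam)).map (fun q => seqCons q.1 q.2) = expSeq lam := by
  unfold expSeq
  rw [← map_head_tail_infinitePi, Measure.map_map (by fun_prop) (by fun_prop)]
  convert Measure.map_id
  funext y
  exact seqCons_eta y

end Sequences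

/-! ### Two integrals behind the Poisson process. -/

section Exponential

variable {lam : ℝ}

theorem lintegral_expMeasure {f : ℝ → ℝ≥0∞} (hf : Measurable f) :
    ∫⁻ x, f x ∂expMeasure lam =
      ∫⁻ x in Set.Ici 0, ENNReal.ofReal (lam * Real.exp (-(lam * x))) * f x := by
  have h1 : expMeasure lam = volume.withDensity (exponentialPDF lam) := rfl
  have hm : Measurable (exponentialPDF lam) :=
    (measurable_exponentialPDFReal lam).ennreal_ofReal
  rw [h1, lintegral_withDensity_eq_lintegral_mul _ hm hf, ← lintegral_indicator measurableSet_Ici]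
  refine lintegral_congr fun x => ?_
  by_cases hx : 0 ≤ x
  · simp [exponentialPDF_of_nonneg hx, hx]
  · simp [exponentialPDF_of_neg (not_le.1 hx), hx]

/-- Memorylessness: after translation by `t` the density acquires only the factor exp(-λt). -/
theorem lintegral_expMeasure_memoryless {t : ℝ} (ht : 0 ≤ t) {f : ℝ → ℝ≥0∞}
    (hf : Measurable f) :
    ∫⁻ x, (if t ≤ x then f (x - t) else 0) ∂expMeasure lam =
      ENNReal.ofReal (Real.exp (-(lam * t))) * ∫⁻ x, f x ∂expMeasure lam := by
  have hm : Measurable fun x => if t ≤ x then f (x - t) else 0 :=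
    Measurable.ite measurableSet_Ici (by fun_prop) measurable_const
  rw [lintegral_expMeasure hf, lintegral_expMeasure hm,
    ← lintegral_const_mul _ (by fun_prop), ← lintegral_indicator measurableSet_Ici,
    ← lintegral_indicator measurableSet_Ici, ← lintegral_add_right_eq_self _ t]
  refine lintegral_congr fun x => ?_
  by_cases hx : 0 ≤ x
  · have h1 : (0 : ℝ) ≤ x + t := by linarith
    simp only [Set.mem_Ici, hx, h1, Set.indicator_of_mem, le_add_iff_nonneg_left, if_true,
      add_sub_cancel_right]
    rw [← mul_assoc, ← ENNReal.ofReal_mul (by positivity)]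
    congr 2
    rw [mul_left_comm, ← Real.exp_add]
    ring_nf
  · simp only [Set.mem_Ici, hx, not_false_eq_true, Set.indicator_of_notMem]
    by_cases h1 : (0 : ℝ) ≤ x + t
    · simp [h1, hx]
    · simp [h1]

/-- The recursion of the Poisson weights when one conditions on the first gain x < t: the
exponentials combine to exp(-λt), and integrating (t - x)^j over [0, t) raises the power by one. -/
theorem lintegral_expMeasure_poisson (hl : 0 < lam) {t : ℝ} (ht : 0 ≤ t) (j : ℕ) :
    ∫⁻ x, (if x < t then ENNReal.ofReal (Real.exp (-(lam * (t - x))) * (lam * (t - x)) ^ j / j.factorial)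
      else 0) ∂expMeasure lam =
      ENNReal.ofReal (Real.exp (-(lam * t)) * (lam * t) ^ (j + 1) / (j + 1).factorial) := by
  rw [lintegral_expMeasure (Measurable.ite measurableSet_Iio (by fun_prop) measurable_const),
    ← lintegral_indicator measurableSet_Ici]
  have h1 : ∀ x, (Set.Ici 0).indicator (fun x => ENNReal.ofReal (lam * Real.exp (-(lam * x))) *
      (if x < t then ENNReal.ofReal (Real.exp (-(lam * (t - x))) * (lam * (t - x)) ^ j / j.factorial)
      else 0)) x = (Set.Ico 0 t).indicator (fun x => ENNReal.ofReal
        (Real.exp (-(lam * t)) * lam ^ (j + 1) / j.factorial * (t - x) ^ j)) x := by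
    intro x
    by_cases hx : 0 ≤ x
    · by_cases hxt : x < t
      · simp only [Set.mem_Ici, hx, hxt, Set.indicator_of_mem, if_true, Set.mem_Ico, and_self]
        rw [← ENNReal.ofReal_mul (by positivity)]
        congr 1
        have : Real.exp (-(lam * t)) = Real.exp (-(lam * x)) * Real.exp (-(lam * (t - x))) := by
          rw [← Real.exp_add]; ring_nf
        rw [this, mul_pow]; ring
      · simp [hx, hxt]
    · simp [hx]
  simp_rw [h1]
  rw [lintegral_indicator measurableSet_Ico, ← ofReal_integral_eq_lintegral_ofReal]
  · congr 1
    rw [integral_Ico_eq_integral_Ioc, ← intervalIntegral.integral_of_le ht,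
      intervalIntegral.integral_const_mul, intervalIntegral.integral_comp_sub_left (fun x => x ^ j)]
    simp only [sub_self, sub_zero, integral_pow, Nat.factorial_succ]
    push_cast
    field_simp
    simp [mul_pow]
  · exact ((by fun_prop : Continuous fun x : ℝ =>
      Real.exp (-(lam * t)) * lam ^ (j + 1) / j.factorial * (t - x) ^ j).integrableOn_Icc).mono_set
        Set.Ico_subset_Icc_self
  · refine (ae_restrict_iff' measurableSet_Ico).2 (Eventually.of_forall fun x hx => ?_)
    have : 0 ≤ t - x := by linarith [hx.2]
    simp only [Pi.zero_apply]
    positivity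

end Exponential

/-! ### First passage of exponential partial sums and the law of the overshoot. -/

section Passage

/-- The partial sums of `y` reach the level `t` at the index `j` for the first time. -/
def IsPass (j : ℕ) (t : ℝ) (y : ℕ → ℝ) : Prop :=
  t ≤ ∑ i ∈ Finset.range (j + 1), y i ∧ ∀ k < j, ∑ i ∈ Finset.range (k + 1), y i < t

/-- The index at which the partial sums of `y` reach the level `t`. -/
noncomputable def passTime (t : ℝ) (y : ℕ → ℝ) : ℕ :=
  sInf {j | t ≤ ∑ i ∈ Finset.range (j + 1), y i}

/-- The overshoot over the level `t` of the first `j + 1` terms, followed by the other terms. -/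
def shiftAt (j : ℕ) (t : ℝ) (y : ℕ → ℝ) : ℕ → ℝ :=
  seqCons (∑ i ∈ Finset.range (j + 1), y i - t) fun n => y (j + 1 + n)

/-- The overshoot over the level `t`, followed by the terms not used to reach it. -/
noncomputable def passShift (t : ℝ) (y : ℕ → ℝ) : ℕ → ℝ := shiftAt (passTime t y) t y

theorem isPass_zero_seqCons {t a : ℝ} {x : ℕ → ℝ} : IsPass 0 t (seqCons a x) ↔ t ≤ a := by
  simp [IsPass]

theorem isPass_succ_seqCons {j : ℕ} {t a : ℝ} {x : ℕ → ℝ} :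
    IsPass (j + 1) t (seqCons a x) ↔ a < t ∧ IsPass j (t - a) x := by
  simp only [IsPass, Finset.sum_range_succ' _ (_ + 1), seqCons_succ, seqCons_zero,
    tsub_le_iff_right]
  constructor
  · rintro ⟨h1, h2⟩
    refine ⟨by simpa using h2 0 (by omega), h1, fun k hk => ?_⟩
    have := h2 (k + 1) (by omega)
    rw [Finset.sum_range_succ'] at this
    simp only [seqCons_succ, seqCons_zero] at this
    linarith
  · rintro ⟨h1, h2, h3⟩
    refine ⟨h2, fun k hk => ?_⟩
    rcases k with _ | k
    · simpa using h1
    · have := h3 k (by omega)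
      rw [Finset.sum_range_succ']
      simp only [seqCons_succ, seqCons_zero]
      linarith

theorem shiftAt_zero_seqCons {t a : ℝ} {x : ℕ → ℝ} :
    shiftAt 0 t (seqCons a x) = seqCons (a - t) x := by
  funext n
  cases n with
  | zero => simp [shiftAt]
  | succ n => simp only [shiftAt, seqCons_succ]; rw [show 0 + 1 + n = n + 1 by omega, seqCons_succ]

theorem shiftAt_succ_seqCons {j : ℕ} {t a : ℝ} {x : ℕ → ℝ} :
    shiftAt (j + 1) t (seqCons a x) = shiftAt j (t - a) x := by
  funext n
  cases n with
  | zero =>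
    simp only [shiftAt, seqCons_zero, Finset.sum_range_succ' _ (j + 1), seqCons_succ]
    ring
  | succ n =>
    simp only [shiftAt, seqCons_succ]
    rw [show j + 1 + 1 + n = (j + 1 + n) + 1 by omega, seqCons_succ]

theorem IsPass.passTime_eq {j : ℕ} {t : ℝ} {y : ℕ → ℝ} (h : IsPass j t y) : passTime t y = j := by
  refine le_antisymm (Nat.sInf_le h.1) ?_
  by_contra hlt
  push Not at hlt
  have h1 : t ≤ ∑ i ∈ Finset.range (passTime t y + 1), y i :=
    Nat.sInf_mem (s := {j | t ≤ ∑ i ∈ Finset.range (j + 1), y i}) ⟨j, h.1⟩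
  exact absurd (h.2 _ hlt) (not_lt.2 h1)

@[fun_prop]
theorem measurable_shiftAt (j : ℕ) : Measurable fun q : ℝ × (ℕ → ℝ) => shiftAt j q.1 q.2 := by
  unfold shiftAt
  exact measurable_seqCons.comp (Measurable.prodMk (by fun_prop) (by fun_prop))

theorem measurableSet_isPass (j : ℕ) : MeasurableSet {q : ℝ × (ℕ → ℝ) | IsPass j q.1 q.2} := by
  have : {q : ℝ × (ℕ → ℝ) | IsPass j q.1 q.2} =
      {q | q.1 ≤ ∑ i ∈ Finset.range (j + 1), q.2 i} ∩
        ⋂ k ∈ Finset.range j, {q | ∑ i ∈ Finset.range (k + 1), q.2 i < q.1} := by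
    ext q; simp [IsPass]
  rw [this]
  refine (measurableSet_le (by fun_prop) (by fun_prop)).inter
    (Finset.measurableSet_biInter _ fun k _ => measurableSet_lt (by fun_prop) (by fun_prop))

@[fun_prop]
theorem measurable_passTime (t : ℝ) : Measurable (passTime t) :=
  measurable_sInf_nat fun _ => measurableSet_le (by fun_prop) (by fun_prop)

@[fun_prop]
theorem measurable_passShift (t : ℝ) : Measurable (passShift t) :=
  measurable_comp_index (measurable_passTime t) (f := fun j y => shiftAt j t y) fun j =>
    (measurable_shiftAt j).comp (measurable_prodMk_left (x := t))

variable {lam : ℝ} [hl : Fact (0 < lam)]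

theorem expSeq_apply {D : Set (ℕ → ℝ)} (hD : MeasurableSet D) :
    expSeq lam D = ∫⁻ a, expSeq lam {x | seqCons a x ∈ D} ∂expMeasure lam := by
  conv_lhs => rw [← map_seqCons lam]
  rw [Measure.map_apply measurable_seqCons hD, Measure.prod_apply (measurable_seqCons hD)]
  rfl

theorem measurable_expSeq_section {D : Set (ℕ → ℝ)} (hD : MeasurableSet D) :
    Measurable fun a => expSeq lam {x | seqCons a x ∈ D} :=
  measurable_measure_prodMk_left (measurable_seqCons hD)

/-- Induct on `j`, conditioning on the first term a. For `j = 0` memorylessness makes the overshoot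
a - t exponential again. For `j + 1` one has a < t, the problem restarts at level t - a, and the
Poisson recursion adds up the weights. The factor for `D` stays untouched throughout, which is the
independence wanted. -/
theorem expSeq_isPass_shiftAt (j : ℕ) {t : ℝ} (ht : 0 ≤ t) {D : Set (ℕ → ℝ)}
    (hD : MeasurableSet D) :
    expSeq lam {y | IsPass j t y ∧ shiftAt j t y ∈ D} =
      ENNReal.ofReal (Real.exp (-(lam * t)) * (lam * t) ^ j / j.factorial) * expSeq lam D := by
  have hm : ∀ (j : ℕ) (t : ℝ), MeasurableSet {y | IsPass j t y ∧ shiftAt j t y ∈ D} := by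
    intro j t
    exact ((measurable_prodMk_left (x := t)) (measurableSet_isPass j)).inter
      (((measurable_shiftAt j).comp (measurable_prodMk_left (x := t))) hD)
  induction j generalizing t with
  | zero =>
    rw [expSeq_apply (hm 0 t), expSeq_apply hD]
    simp only [Set.mem_ofPred_eq, isPass_zero_seqCons, shiftAt_zero_seqCons, pow_zero, mul_one,
      Nat.factorial_zero, Nat.cast_one, div_one]
    rw [← lintegral_expMeasure_memoryless ht (measurable_expSeq_section hD)]
    refine lintegral_congr fun a => ?_
    by_cases h : t ≤ a
    · simp [h]
    · simp [h]
  | succ j ih =>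
    rw [expSeq_apply (hm _ t), ← lintegral_expMeasure_poisson hl.out ht, ← lintegral_mul_const _
      (Measurable.ite measurableSet_Iio (by fun_prop) measurable_const)]
    simp only [Set.mem_ofPred_eq, isPass_succ_seqCons, shiftAt_succ_seqCons]
    refine lintegral_congr fun a => ?_
    by_cases h : a < t
    · simp only [h, true_and, if_true]
      exact ih (by linarith)
    · simp [h]

theorem expSeq_isPass (j : ℕ) {t : ℝ} (ht : 0 ≤ t) :
    expSeq lam {y | IsPass j t y} =
      ENNReal.ofReal (Real.exp (-(lam * t)) * (lam * t) ^ j / j.factorial) := by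
  simpa using expSeq_isPass_shiftAt (lam := lam) j ht MeasurableSet.univ

/-- The events for different indices are disjoint and the Poisson weights sum to 1. -/
theorem ae_exists_isPass {t : ℝ} (ht : 0 ≤ t) : ∀ᵐ y ∂expSeq lam, ∃ j, IsPass j t y := by
  have hm : ∀ j, MeasurableSet {y | IsPass j t y} := fun j =>
    (measurable_prodMk_left (x := t)) (measurableSet_isPass j)
  have h1 : expSeq lam (⋃ j, {y | IsPass j t y}) = 1 := by
    rw [measure_iUnion _ hm]
    · simp_rw [expSeq_isPass _ ht]
      have h2 := hasSum_one_poissonMeasure (lam * t).toNNReal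
      rw [Real.coe_toNNReal _ (mul_nonneg hl.out.le ht)] at h2
      have hn : ∀ n : ℕ, 0 ≤ Real.exp (-(lam * t)) * (lam * t) ^ n / n.factorial := by
        intro n; have := mul_nonneg hl.out.le ht; positivity
      rw [← ENNReal.ofReal_tsum_of_nonneg hn h2.summable]
      have h3 := h2.tsum_eq
      rw [h3, ENNReal.ofReal_one]
    · intro i j hij
      refine Set.disjoint_left.2 fun y hi hj => hij ?_
      exact (IsPass.passTime_eq hi).symm.trans (IsPass.passTime_eq hj)
  have h2 := (prob_compl_eq_zero_iff (MeasurableSet.iUnion hm)).2 h1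
  rw [ae_iff]
  convert h2 using 2
  ext y; simp

/-- Almost surely the level is reached, so the default value 0 of `passTime` matters only on a null
set. -/
theorem expSeq_passTime_passShift (j : ℕ) {t : ℝ} (ht : 0 ≤ t) {D : Set (ℕ → ℝ)}
    (hD : MeasurableSet D) :
    expSeq lam {y | passTime t y = j ∧ passShift t y ∈ D} =
      ENNReal.ofReal (Real.exp (-(lam * t)) * (lam * t) ^ j / j.factorial) * expSeq lam D := by
  rw [← expSeq_isPass_shiftAt j ht hD]
  refine measure_congr ?_
  filter_upwards [ae_exists_isPass (lam := lam) ht] with y ⟨i, hi⟩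
  apply propext
  change (passTime t y = j ∧ passShift t y ∈ D) ↔ (IsPass j t y ∧ shiftAt j t y ∈ D)
  rw [passShift, hi.passTime_eq]
  constructor
  · rintro ⟨rfl, h⟩; exact ⟨hi, h⟩
  · rintro ⟨h1, h2⟩
    have := hi.passTime_eq.symm.trans h1.passTime_eq
    subst this
    exact ⟨rfl, h2⟩

theorem map_passTime {t : ℝ} (ht : 0 ≤ t) :
    (expSeq lam).map (passTime t) = poissonMeasure (lam * t).toNNReal := by
  refine Measure.ext_of_singleton fun j => ?_
  rw [Measure.map_apply (measurable_passTime t) (measurableSet_singleton j),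
    poissonMeasure_singleton, Real.coe_toNNReal _ (mul_nonneg hl.out.le ht)]
  simpa using! expSeq_passTime_passShift (lam := lam) j ht MeasurableSet.univ

/-- An exponential stored energy is stationary, and what remains after a transmission carries no
information on how many blocks were harvested for it. -/
theorem refresh_passTime {t : ℝ} (ht : 0 ≤ t) :
    Refresh (expSeq lam) (passTime t) (passShift t) := by
  refine Refresh.of_measure_eq (measurable_passTime t) (measurable_passShift t)
    fun C D hC hD => ?_
  have h1 : {y | passTime t y ∈ C ∧ passShift t y ∈ D} =
      ⋃ j ∈ C, {y | passTime t y = j ∧ passShift t y ∈ D} := by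
    ext y; simp
  have h2 : passTime t ⁻¹' C = ⋃ j ∈ C, {y | passTime t y = j} := by
    ext y; simp
  have m1 : ∀ j, MeasurableSet {y | passTime t y = j} := fun j =>
    (measurable_passTime t) (measurableSet_singleton j)
  rw [h1, h2, measure_biUnion C.to_countable, measure_biUnion C.to_countable,
    ← ENNReal.tsum_mul_right]
  · refine tsum_congr fun j => ?_
    rw [expSeq_passTime_passShift _ ht hD]
    congr 1
    simpa using (expSeq_passTime_passShift (lam := lam) j ht MeasurableSet.univ).symm
  · exact fun i _ j _ hij => Set.disjoint_left.2 fun y hi hj => hij (hi.symm.trans hj)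
  · exact fun j _ => m1 j
  · exact fun i _ j _ hij => Set.disjoint_left.2 fun y hi hj => hij (hi.1.symm.trans hj.1)
  · exact fun j _ => (m1 j).inter ((measurable_passShift t) hD)

/-- From a deterministic first term `e`, the law of the sequence becomes that of independent
exponential variables as soon as the first term is used up. -/
theorem map_iterate_passShift_seqCons {t : ℝ} (ht : 0 < t) (n : ℕ) {e : ℝ} (he : 0 ≤ e)
    (hn : e < n * t) :
    (expSeq lam).map (fun x => (passShift t)^[n] (seqCons e x)) = expSeq lam := by
  induction n generalizing e with
  | zero => simp at hn; linarith
  | succ n ih =>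
    -- If the stored energy suffices, nothing is harvested and `e` drops by `t`. Otherwise the
    -- missing amount `t - e` is collected from fresh gains alone, after which the law is the
    -- stationary one and stays so.
    by_cases h : t ≤ e
    · have h1 : ∀ x, passShift t (seqCons e x) = seqCons (e - t) x := by
        intro x
        have hp : IsPass 0 t (seqCons e x) := isPass_zero_seqCons.2 h
        rw [passShift, hp.passTime_eq, shiftAt_zero_seqCons]
      simp_rw [Function.iterate_succ_apply, h1]
      exact ih (by linarith) (by push_cast at hn; linarith)
    · push Not at h
      have h1 : ∀ᵐ x ∂expSeq lam, passShift t (seqCons e x) = passShift (t - e) x := by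
        filter_upwards [ae_exists_isPass (lam := lam) (sub_nonneg.2 h.le)] with x ⟨j, hj⟩
        have hp : IsPass (j + 1) t (seqCons e x) := isPass_succ_seqCons.2 ⟨h, hj⟩
        rw [passShift, passShift, hp.passTime_eq, hj.passTime_eq, shiftAt_succ_seqCons]
      have h2 : (expSeq lam).map (fun x => (passShift t)^[n + 1] (seqCons e x)) =
          (expSeq lam).map ((passShift t)^[n] ∘ passShift (t - e)) := by
        refine Measure.map_congr ?_
        filter_upwards [h1] with x hx
        rw [Function.iterate_succ_apply, hx, Function.comp_apply]
      rw [h2, ← Measure.map_map ((measurable_passShift t).iterate n) (measurable_passShift _),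
        (refresh_passTime (sub_nonneg.2 h.le)).measurePreserving.map_eq,
        ((refresh_passTime ht.le).measurePreserving.iterate n).map_eq]

end Passage

/-! ### Moments of the Poisson law. -/

section PoissonMoments

/-- Comes from (n+1) P{n+1} = r P{n}; it generates the moments below. -/
theorem lintegral_poisson_mul (r : ℝ≥0) (f : ℕ → ℝ≥0∞) :
    ∫⁻ n, n * f n ∂poissonMeasure r = r * ∫⁻ n, f (n + 1) ∂poissonMeasure r := by
  rw [lintegral_countable', lintegral_countable', tsum_eq_zero_add' ENNReal.summable,
    ← ENNReal.tsum_mul_left]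
  simp only [Nat.cast_zero, zero_mul, zero_add]
  refine tsum_congr fun n => ?_
  have h1 : ((n + 1 : ℕ) : ℝ≥0∞) * poissonMeasure r {n + 1} = r * poissonMeasure r {n} := by
    rw [poissonMeasure_singleton, poissonMeasure_singleton, ← ENNReal.ofReal_natCast,
      ← ENNReal.ofReal_coe_nnreal, ← ENNReal.ofReal_mul (by positivity),
      ← ENNReal.ofReal_mul (by positivity), Nat.factorial_succ]
    congr 1
    push_cast
    field_simp
    ring
  calc ((n + 1 : ℕ) : ℝ≥0∞) * f (n + 1) * poissonMeasure r {n + 1}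
      = f (n + 1) * (((n + 1 : ℕ) : ℝ≥0∞) * poissonMeasure r {n + 1}) := by ring
    _ = r * (f (n + 1) * poissonMeasure r {n}) := by rw [h1]; ring

theorem lintegral_poisson_id (r : ℝ≥0) : ∫⁻ n, (n : ℝ≥0∞) ∂poissonMeasure r = r := by
  simpa using lintegral_poisson_mul r fun _ => 1

theorem lintegral_poisson_sq (r : ℝ≥0) :
    ∫⁻ n, (n : ℝ≥0∞) ^ 2 ∂poissonMeasure r = r ^ 2 + r := by
  have := lintegral_poisson_mul r fun n => n
  simp_rw [← sq] at this
  rw [this]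
  push_cast
  rw [lintegral_add_left (by fun_prop), lintegral_poisson_id]
  simp
  ring

theorem lintegral_poisson_succ (r : ℝ≥0) :
    ∫⁻ n, ((n + 1 : ℕ) : ℝ≥0∞) ∂poissonMeasure r = 1 + r := by
  push_cast
  rw [lintegral_add_left (by fun_prop), lintegral_poisson_id]
  simp [add_comm]

theorem lintegral_poisson_succ_sq (r : ℝ≥0) :
    ∫⁻ n, ((n + 1 : ℕ) : ℝ≥0∞) ^ 2 ∂poissonMeasure r = r ^ 2 + 3 * r + 1 := by
  have h : ∀ n : ℕ, ((n + 1 : ℕ) : ℝ≥0∞) ^ 2 = (n : ℝ≥0∞) ^ 2 + (2 * n + 1) := by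
    intro n; push_cast; ring
  simp_rw [h]
  rw [lintegral_add_left (by fun_prop), lintegral_poisson_sq, lintegral_add_left (by fun_prop),
    lintegral_const_mul _ (by fun_prop), lintegral_poisson_id]
  simp
  ring

theorem lintegral_poisson_zero (r : ℝ≥0) :
    ∫⁻ n, (if n = 0 then 1 else 0) ∂poissonMeasure r = ENNReal.ofReal (Real.exp (-r)) := by
  have : (fun n : ℕ => if n = 0 then (1 : ℝ≥0∞) else 0) = Set.indicator {0} 1 := by
    funext n; simp [Set.indicator_apply]
  rw [this, lintegral_indicator_one (measurableSet_singleton 0), poissonMeasure_singleton]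
  simp

/-- The exponential term is the probability that no harvesting is needed, in which case the
transmission still occupies one block. -/
theorem lintegral_poisson_max (r : ℝ≥0) :
    ∫⁻ n, ((max 1 n : ℕ) : ℝ≥0∞) ∂poissonMeasure r = r + ENNReal.ofReal (Real.exp (-r)) := by
  have h : ∀ n : ℕ, ((max 1 n : ℕ) : ℝ≥0∞) = n + (if n = 0 then 1 else 0) := by
    intro n; cases n <;> simp
  simp_rw [h]
  rw [lintegral_add_left (by fun_prop), lintegral_poisson_id, lintegral_poisson_zero]

theorem lintegral_poisson_max_sq (r : ℝ≥0) :
    ∫⁻ n, ((max 1 n : ℕ) : ℝ≥0∞) ^ 2 ∂poissonMeasure r =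
      r ^ 2 + r + ENNReal.ofReal (Real.exp (-r)) := by
  have h : ∀ n : ℕ, ((max 1 n : ℕ) : ℝ≥0∞) ^ 2 = (n : ℝ≥0∞) ^ 2 + (if n = 0 then 1 else 0) := by
    intro n; cases n <;> simp
  simp_rw [h]
  rw [lintegral_add_left (by fun_prop), lintegral_poisson_sq, lintegral_poisson_zero]

end PoissonMoments

/-! ### Idle blocks used by a number of transmissions. -/

section Harvest

/-- The number of idle blocks spent on the first `n` transmissions from the state `y`, where the
energy needed for a transmission is the level `t`. -/
noncomputable def idleBlocks (t : ℝ) (n : ℕ) (y : ℕ → ℝ) : ℕ :=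
  ∑ i ∈ Finset.range n, max 1 (passTime t ((passShift t)^[i] y))

@[fun_prop]
theorem measurable_idleBlocks (t : ℝ) (n : ℕ) : Measurable (idleBlocks t n) := by
  unfold idleBlocks
  refine Finset.measurable_sum _ fun i _ => ?_
  exact (measurable_of_countable (fun n : ℕ => max 1 n)).comp
    ((measurable_passTime t).comp ((measurable_passShift t).iterate i))

theorem le_idleBlocks (t : ℝ) (n : ℕ) (y : ℕ → ℝ) : n ≤ idleBlocks t n y := by
  unfold idleBlocks
  calc n = ∑ i ∈ Finset.range n, 1 := by simp
    _ ≤ _ := Finset.sum_le_sum fun i _ => le_max_left _ _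

variable {lam : ℝ} [hl : Fact (0 < lam)]

/-- Compose the transition of one transmission with that of the remaining `n`, and keep only the sum
of the two outputs. -/
theorem refresh_idleBlocks {t : ℝ} (ht : 0 ≤ t) (n : ℕ) :
    Refresh (expSeq lam) (idleBlocks t n) (passShift t)^[n] := by
  induction n with
  | zero =>
    refine Refresh.of_measure_eq (measurable_idleBlocks t 0) measurable_id fun C D _ _ => ?_
    have h0 : ∀ y, idleBlocks t 0 y = 0 := fun y => rfl
    by_cases h : 0 ∈ C
    · simp [h0, h, Set.preimage]
    · simp [h0, h, Set.preimage]
  | succ n ih =>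
    have h1 := ((refresh_passTime (lam := lam) ht).comp ih).map_out
      (f := fun q : ℕ × ℕ => q.2 + max 1 q.1) (measurable_of_countable _)
    have h2 : idleBlocks t (n + 1) = fun y => idleBlocks t n (passShift t y) +
        max 1 (passTime t y) := by
      funext y
      simp only [idleBlocks, Finset.sum_range_succ', Function.iterate_succ_apply]
      rfl
    rw [h2]
    exact h1

theorem lintegral_passTime {t : ℝ} (ht : 0 ≤ t) (f : ℕ → ℝ≥0∞) :
    ∫⁻ y, f (passTime t y) ∂expSeq lam = ∫⁻ n, f n ∂poissonMeasure (lam * t).toNNReal := by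
  rw [← map_passTime ht, lintegral_map (measurable_of_countable f) (measurable_passTime t)]

theorem lintegral_passTime_iterate {t : ℝ} (ht : 0 ≤ t) (f : ℕ → ℝ≥0∞) (i : ℕ) :
    ∫⁻ y, f (passTime t ((passShift t)^[i] y)) ∂expSeq lam =
      ∫⁻ n, f n ∂poissonMeasure (lam * t).toNNReal := by
  rw [← lintegral_passTime ht]
  exact ((refresh_passTime (lam := lam) ht).measurePreserving.iterate i).lintegral_comp
    ((measurable_of_countable f).comp (measurable_passTime t))

section RandomNumber

variable {t : ℝ}

/-- The number of idle blocks spent on transmission `i`, as an extended nonnegative real. -/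
noncomputable def idleTerm (t : ℝ) (i : ℕ) (y : ℕ → ℝ) : ℝ≥0∞ :=
  ((max 1 (passTime t ((passShift t)^[i] y)) : ℕ) : ℝ≥0∞)

theorem coe_idleBlocks (n : ℕ) (y : ℕ → ℝ) :
    (idleBlocks t n y : ℝ≥0∞) = ∑ i ∈ Finset.range n, idleTerm t i y := by
  simp [idleBlocks, idleTerm]

@[fun_prop]
theorem measurable_idleTerm (i : ℕ) : Measurable (idleTerm t i) :=
  (measurable_of_countable (fun n : ℕ => ((max 1 n : ℕ) : ℝ≥0∞))).comp
    ((measurable_passTime t).comp ((measurable_passShift t).iterate i))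

theorem lintegral_idleTerm (ht : 0 ≤ t) (σ : Measure ℕ) [IsProbabilityMeasure σ] (i : ℕ) :
    ∫⁻ q, idleTerm t i q.2 ∂σ.prod (expSeq lam) =
      ENNReal.ofReal (lam * t) + ENNReal.ofReal (Real.exp (-(lam * t))) := by
  rw [lintegral_prod_snd σ (expSeq lam) (f := idleTerm t i) (measurable_idleTerm i)]
  unfold idleTerm
  rw [lintegral_passTime_iterate ht fun n => ((max 1 n : ℕ) : ℝ≥0∞), lintegral_poisson_max,
    Real.coe_toNNReal _ (mul_nonneg hl.out.le ht)]
  rfl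

theorem lintegral_idleTerm_sq (ht : 0 ≤ t) (σ : Measure ℕ) [IsProbabilityMeasure σ] (i : ℕ) :
    ∫⁻ q, idleTerm t i q.2 ^ 2 ∂σ.prod (expSeq lam) =
      ENNReal.ofReal (lam * t) ^ 2 + ENNReal.ofReal (lam * t) +
        ENNReal.ofReal (Real.exp (-(lam * t))) := by
  rw [lintegral_prod_snd σ (expSeq lam) (f := fun y => idleTerm t i y ^ 2) (by fun_prop)]
  unfold idleTerm
  rw [lintegral_passTime_iterate ht fun n => ((max 1 n : ℕ) : ℝ≥0∞) ^ 2, lintegral_poisson_max_sq,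
    Real.coe_toNNReal _ (mul_nonneg hl.out.le ht)]
  rfl

theorem indepFun_idleTerm (σ : Measure ℕ) [IsProbabilityMeasure σ] :
    IndepFun (fun q : ℕ × (ℕ → ℝ) => q.1) (fun q i => idleTerm t i q.2) (σ.prod (expSeq lam)) :=
  indepFun_prod (X := fun n : ℕ => n) (Y := fun (y : ℕ → ℝ) i => idleTerm t i y) measurable_id
    (by fun_prop)

theorem pairwise_indepFun_idleTerm (ht : 0 ≤ t) (σ : Measure ℕ) [IsProbabilityMeasure σ] :
    Pairwise fun i j => IndepFun (fun q : ℕ × (ℕ → ℝ) => idleTerm t i q.2)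
      (fun q => idleTerm t j q.2) (σ.prod (expSeq lam)) := by
  intro i j hij
  have h := ((refresh_passTime (lam := lam) ht).iIndepFun_iterate.indepFun hij).comp
    (φ := fun n : ℕ => ((max 1 n : ℕ) : ℝ≥0∞))
    (ψ := fun n : ℕ => ((max 1 n : ℕ) : ℝ≥0∞)) (measurable_of_countable _)
    (measurable_of_countable _)
  exact indepFun_comp_measurePreserving (f := idleTerm t i) (g := idleTerm t j) h
    (measurable_idleTerm i) (measurable_idleTerm j)
    (measurePreserving_snd (μ := σ) (ν := expSeq lam))

/-- Mean of the number of idle blocks over a random number of transmissions. -/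
theorem lintegral_idleBlocks (ht : 0 ≤ t) (σ : Measure ℕ) [IsProbabilityMeasure σ] :
    ∫⁻ q, (idleBlocks t q.1 q.2 : ℝ≥0∞) ∂σ.prod (expSeq lam) =
      (∫⁻ n, (n : ℝ≥0∞) ∂σ) *
        (ENNReal.ofReal (lam * t) + ENNReal.ofReal (Real.exp (-(lam * t)))) := by
  rw [← lintegral_prod_fst σ (expSeq lam) (f := fun n : ℕ => (n : ℝ≥0∞)) (by fun_prop),
    ← lintegral_randomSum measurable_fst (fun i => (measurable_idleTerm i).comp measurable_snd)
      (lintegral_idleTerm ht σ)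
      (indepFun_idleTerm σ)]
  simp_rw [coe_idleBlocks]
  rfl

/-- Second moment of the number of idle blocks over a random number of transmissions. -/
theorem lintegral_idleBlocks_sq (ht : 0 ≤ t) (σ : Measure ℕ) [IsProbabilityMeasure σ] :
    ∫⁻ q, (idleBlocks t q.1 q.2 : ℝ≥0∞) ^ 2 ∂σ.prod (expSeq lam) =
      (∫⁻ n, (n : ℝ≥0∞) ∂σ) * (ENNReal.ofReal (lam * t) ^ 2 + ENNReal.ofReal (lam * t) +
        ENNReal.ofReal (Real.exp (-(lam * t)))) +
      (∫⁻ n, ((n * (n - 1) : ℕ) : ℝ≥0∞) ∂σ) *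
        (ENNReal.ofReal (lam * t) + ENNReal.ofReal (Real.exp (-(lam * t)))) ^ 2 := by
  rw [← lintegral_prod_fst σ (expSeq lam) (f := fun n : ℕ => (n : ℝ≥0∞)) (by fun_prop),
    ← lintegral_prod_fst σ (expSeq lam) (f := fun n : ℕ => ((n * (n - 1) : ℕ) : ℝ≥0∞))
      (by fun_prop),
    ← lintegral_randomSum_sq measurable_fst (fun i => (measurable_idleTerm i).comp measurable_snd)
      (lintegral_idleTerm ht σ)
      (lintegral_idleTerm_sq ht σ) (pairwise_indepFun_idleTerm ht σ) (indepFun_idleTerm σ)]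
  simp_rw [coe_idleBlocks]
  rfl

end RandomNumber

end Harvest

/-! ### The emptying time of a discrete-time queue. -/

section Queue

/-- The work of `w 0, …, w n`. -/
def totalWork (w : ℕ → ℕ) (n : ℕ) : ℕ := ∑ i ∈ Finset.range (n + 1), w i

/-- The time at which a queue that receives the work `w n` at time `n` becomes empty. -/
noncomputable def emptyTime (w : ℕ → ℕ) : ℕ∞ := firstTime fun n => totalWork w n ≤ n

open scoped Classical in
/-- The indicator of the queue being busy after `n` blocks. -/
noncomputable def busyInd (n : ℕ) (w : ℕ → ℕ) : ℕ := if (n : ℕ∞) < emptyTime w then 1 else 0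

/-- The minimum of `n` and the time at which the queue becomes empty. -/
noncomputable def busyCount (n : ℕ) (w : ℕ → ℕ) : ℕ := ∑ i ∈ Finset.range n, busyInd i w

/-- The work received until the queue becomes empty or `n` blocks have passed. -/
noncomputable def stoppedWork (n : ℕ) (w : ℕ → ℕ) : ℕ :=
  w 0 + ∑ i ∈ Finset.range n, busyInd i w * w (i + 1)

theorem busyInd_le_one (n : ℕ) (w : ℕ → ℕ) : busyInd n w ≤ 1 := by
  unfold busyInd; split_ifs <;> simp

theorem busyCount_le (n : ℕ) (w : ℕ → ℕ) : busyCount n w ≤ n := by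
  unfold busyCount
  calc _ ≤ ∑ i ∈ Finset.range n, 1 := Finset.sum_le_sum fun i _ => busyInd_le_one i w
    _ = n := by simp

theorem busyInd_mul_self (n : ℕ) (w : ℕ → ℕ) : busyInd n w * busyInd n w = busyInd n w := by
  unfold busyInd; split_ifs <;> simp

theorem busyCount_eq_of_le {n : ℕ} {w : ℕ → ℕ} (h : (n : ℕ∞) ≤ emptyTime w) :
    busyCount n w = n ∧ stoppedWork n w = totalWork w n := by
  have h1 : ∀ i ∈ Finset.range n, busyInd i w = 1 := by
    intro i hi
    have : (i : ℕ∞) < emptyTime w :=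
      lt_of_lt_of_le (by exact_mod_cast Finset.mem_range.1 hi) h
    simp [busyInd, this]
  constructor
  · rw [busyCount, Finset.sum_congr rfl h1]; simp
  · rw [stoppedWork, totalWork, Finset.sum_range_succ', add_comm]
    congr 1
    exact Finset.sum_congr rfl fun i hi => by rw [h1 i hi, one_mul]

/-- One unit of work is served per busy block. At the emptying time `k` the work received is at most
`k`, and just before it exceeded `k - 1`; so it equals `k`, and both counters freeze there. -/
theorem busyCount_eq_of_ge {n k : ℕ} {w : ℕ → ℕ} (hk : emptyTime w = k) (h : k ≤ n) :
    busyCount n w = k ∧ stoppedWork n w = k := by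
  have h0 := busyCount_eq_of_le (w := w) (n := k) hk.ge
  have h1 : ∀ i, k ≤ i → busyInd i w = 0 := by
    intro i hi
    have : ¬ (i : ℕ∞) < emptyTime w := by rw [hk, not_lt]; exact_mod_cast hi
    simp [busyInd, this]
  have h2 : totalWork w k = k := by
    obtain ⟨ha, hb⟩ := firstTime_eq_coe_iff.1 hk
    refine le_antisymm ha ?_
    rcases k with _ | k
    · simp
    · have h3 := hb k (by omega)
      have h4 : totalWork w k ≤ totalWork w (k + 1) := by
        unfold totalWork; rw [Finset.sum_range_succ _ (k + 1)]; omega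
      omega
  obtain ⟨j, rfl⟩ := Nat.exists_eq_add_of_le h
  constructor
  · rw [busyCount, Finset.sum_range_add, Finset.sum_eq_zero (s := Finset.range j)
      fun i _ => h1 _ (by omega), add_zero]
    exact h0.1
  · rw [stoppedWork, Finset.sum_range_add, Finset.sum_eq_zero (s := Finset.range j)
      fun i _ => by rw [h1 _ (by omega), zero_mul], add_zero]
    exact h0.2.trans h2

/-- The server cannot do more work than has arrived. This bound makes the a priori estimates
possible. -/
theorem busyCount_le_stoppedWork (n : ℕ) (w : ℕ → ℕ) : busyCount n w ≤ stoppedWork n w := by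
  rcases le_or_gt (n : ℕ∞) (emptyTime w) with h | h
  · obtain ⟨h1, h2⟩ := busyCount_eq_of_le h
    rw [h1, h2]
    rcases n with _ | n
    · simp
    · have h3 : (n : ℕ∞) < emptyTime w := lt_of_lt_of_le (by exact_mod_cast n.lt_succ_self) h
      have h4 := lt_firstTime_iff.1 h3 n le_rfl
      have h5 : totalWork w n ≤ totalWork w (n + 1) := by
        unfold totalWork; rw [Finset.sum_range_succ _ (n + 1)]; omega
      omega
  · obtain ⟨k, hk⟩ := ENat.ne_top_iff_exists.1 h.ne_top
    have hkn : k ≤ n := by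
      have : (k : ℕ∞) < n := hk ▸ h
      exact_mod_cast this.le
    obtain ⟨h1, h2⟩ := busyCount_eq_of_ge hk.symm hkn
    rw [h1, h2]

theorem monotone_busyCount (w : ℕ → ℕ) : Monotone fun n => busyCount n w :=
  fun _ _ h => Finset.sum_le_sum_of_subset (Finset.range_mono h)

theorem monotone_stoppedWork (w : ℕ → ℕ) : Monotone fun n => stoppedWork n w :=
  fun _ _ h => Nat.add_le_add_left (Finset.sum_le_sum_of_subset (Finset.range_mono h)) _

theorem coe_emptyTime_eq_iSup (w : ℕ → ℕ) :
    (emptyTime w : ℝ≥0∞) = ⨆ n, (busyCount n w : ℝ≥0∞) := by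
  rcases eq_or_ne (emptyTime w) ⊤ with h | h
  · have : ∀ n, busyCount n w = n := fun n => (busyCount_eq_of_le (by rw [h]; exact le_top)).1
    simp_rw [this, h, ENNReal.iSup_natCast]
    rfl
  · obtain ⟨k, hk⟩ := ENat.ne_top_iff_exists.1 h
    rw [← hk, ENat.toENNReal_coe]
    refine le_antisymm (le_iSup_of_le k ?_) (iSup_le fun n => ?_)
    · rw [(busyCount_eq_of_ge hk.symm le_rfl).1]
    · rw [Nat.cast_le]
      calc busyCount n w ≤ busyCount (max n k) w := monotone_busyCount w (le_max_left _ _)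
        _ = k := (busyCount_eq_of_ge hk.symm (le_max_right _ _)).1

theorem coe_emptyTime_eq_iSup_stoppedWork {w : ℕ → ℕ} (h : emptyTime w ≠ ⊤) :
    (emptyTime w : ℝ≥0∞) = ⨆ n, (stoppedWork n w : ℝ≥0∞) := by
  obtain ⟨k, hk⟩ := ENat.ne_top_iff_exists.1 h
  rw [← hk, ENat.toENNReal_coe]
  refine le_antisymm (le_iSup_of_le k ?_) (iSup_le fun n => ?_)
  · rw [(busyCount_eq_of_ge hk.symm le_rfl).2]
  · rw [Nat.cast_le]
    calc stoppedWork n w ≤ stoppedWork (max n k) w := monotone_stoppedWork w (le_max_left _ _)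
      _ = k := (busyCount_eq_of_ge hk.symm (le_max_right _ _)).2

@[fun_prop]
theorem measurable_totalWork (n : ℕ) : Measurable fun w => totalWork w n := by
  unfold totalWork; fun_prop

@[fun_prop]
theorem measurable_emptyTime : Measurable emptyTime :=
  measurable_firstTime fun n => (measurable_totalWork n) (MeasurableSet.of_discrete (s := {k | k ≤ n}))

@[fun_prop]
theorem measurable_busyInd (n : ℕ) : Measurable (busyInd n) := by
  unfold busyInd
  exact Measurable.ite (measurable_emptyTime (MeasurableSet.of_discrete (s := {k | (n : ℕ∞) < k})))
    measurable_const measurable_const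

@[fun_prop]
theorem measurable_busyCount (n : ℕ) : Measurable (busyCount n) := by
  unfold busyCount; fun_prop

@[fun_prop]
theorem measurable_stoppedWork (n : ℕ) : Measurable (stoppedWork n) := by
  unfold stoppedWork; fun_prop

/-- The stopping-time property: being busy after `n` blocks is decided by the works up to index `n`,
hence is independent of the work `w (n + 1)` that multiplies it in `stoppedWork`. -/
theorem dependsOn_busyInd (n : ℕ) : DependsOn (busyInd n) {i | i ≤ n} := by
  intro w w' h
  have h1 : ∀ i ≤ n, totalWork w i = totalWork w' i := by
    intro i hi
    refine Finset.sum_congr rfl fun j hj => h j ?_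
    have := Finset.mem_range.1 hj
    simp only [Set.mem_ofPred_eq]
    omega
  have h2 : (n : ℕ∞) < emptyTime w ↔ (n : ℕ∞) < emptyTime w' := by
    unfold emptyTime
    rw [lt_firstTime_iff, lt_firstTime_iff]
    refine forall₂_congr fun i hi => ?_
    rw [h1 i hi]
  simp only [busyInd, h2]

theorem dependsOn_busyCount (n : ℕ) : DependsOn (busyCount n) {i | i ≤ n} := by
  intro w w' h
  refine Finset.sum_congr rfl fun j hj => dependsOn_busyInd j fun i hi => h i ?_
  have := Finset.mem_range.1 hj
  simp only [Set.mem_ofPred_eq] at hi ⊢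
  omega

theorem dependsOn_stoppedWork (n : ℕ) : DependsOn (stoppedWork n) {i | i ≤ n} := by
  intro w w' h
  unfold stoppedWork
  rw [h 0 (Nat.zero_le n)]
  congr 1
  refine Finset.sum_congr rfl fun j hj => ?_
  have hj' := Finset.mem_range.1 hj
  rw [h (j + 1) (by simp only [Set.mem_ofPred_eq]; omega), dependsOn_busyInd j fun i hi => h i ?_]
  simp only [Set.mem_ofPred_eq] at hi ⊢
  omega

/-! ### Wald's identities for the emptying time. -/

section Moments

variable {π : Measure (ℕ → ℕ)} [IsProbabilityMeasure π]

theorem indepFun_next {𝒴 : Type*} [MeasurableSpace 𝒴]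
    (hπ : iIndepFun (fun i (w : ℕ → ℕ) => w i) π) (n : ℕ) {f : (ℕ → ℕ) → 𝒴}
    (mf : Measurable f) (hf : DependsOn f {i | i ≤ n}) : IndepFun f (fun w => w (n + 1)) π := by
  refine indepFun_of_dependsOn (t := {n + 1}) hπ measurable_pi_apply ?_ mf
    (measurable_pi_apply (n + 1)) hf fun x y h => h (n + 1) rfl
  rw [Set.disjoint_singleton_right]
  simp

theorem lintegral_stoppedWork (hπ : iIndepFun (fun i (w : ℕ → ℕ) => w i) π) {m y : ℝ≥0∞}
    (hm : ∫⁻ w, (w 0 : ℝ≥0∞) ∂π = m) (hy : ∀ n, ∫⁻ w, (w (n + 1) : ℝ≥0∞) ∂π = y) (n : ℕ) :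
    ∫⁻ w, (stoppedWork n w : ℝ≥0∞) ∂π = m + y * ∫⁻ w, (busyCount n w : ℝ≥0∞) ∂π := by
  have h1 : ∀ i, ∫⁻ w : ℕ → ℕ, (busyInd i w : ℝ≥0∞) * w (i + 1) ∂π =
      y * ∫⁻ w, (busyInd i w : ℝ≥0∞) ∂π := by
    intro i
    have := lintegral_mul_eq_lintegral_mul_lintegral_of_indepFun (μ := π)
      (f := fun w => (busyInd i w : ℝ≥0∞)) (g := fun w => (w (i + 1) : ℝ≥0∞))
      (by fun_prop) (by fun_prop)
      ((indepFun_next hπ i (measurable_busyInd i) (dependsOn_busyInd i)).comp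
        (φ := fun n : ℕ => (n : ℝ≥0∞)) (ψ := fun n : ℕ => (n : ℝ≥0∞))
        (measurable_of_countable _) (measurable_of_countable _))
    rw [hy] at this
    rw [mul_comm y]
    exact this
  simp only [stoppedWork, busyCount]
  push_cast
  rw [lintegral_add_left (by fun_prop), hm, lintegral_finsetSum _ (by fun_prop),
    lintegral_finsetSum _ (by fun_prop), Finset.mul_sum]
  simp_rw [h1]

theorem lintegral_emptyTime_eq_iSup :
    ∫⁻ w, (emptyTime w : ℝ≥0∞) ∂π = ⨆ n, ∫⁻ w, (busyCount n w : ℝ≥0∞) ∂π := by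
  simp_rw [coe_emptyTime_eq_iSup]
  exact lintegral_iSup (fun n => by fun_prop) fun i j h w =>
    Nat.cast_le.2 (monotone_busyCount w h)

theorem ae_ne_top_of_lintegral_emptyTime (h : ∫⁻ w, (emptyTime w : ℝ≥0∞) ∂π ≠ ∞) :
    ∀ᵐ w ∂π, emptyTime w ≠ ⊤ := by
  have h1 : Measurable fun w => (emptyTime w : ℝ≥0∞) :=
    (measurable_of_countable (fun n : ℕ∞ => (n : ℝ≥0∞))).comp measurable_emptyTime
  filter_upwards [ae_lt_top h1 h] with w hw h2
  rw [h2] at hw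
  simp at hw

/-- Monotone convergence in Wald's identity for the stopped queue; at a finite emptying time the
work received equals the time. The identity holds in [0, ∞] and is used in both regimes. -/
theorem lintegral_emptyTime_eq (hπ : iIndepFun (fun i (w : ℕ → ℕ) => w i) π) {m y : ℝ≥0∞}
    (hm : ∫⁻ w, (w 0 : ℝ≥0∞) ∂π = m) (hy : ∀ n, ∫⁻ w, (w (n + 1) : ℝ≥0∞) ∂π = y)
    (h : ∀ᵐ w ∂π, emptyTime w ≠ ⊤) :
    ∫⁻ w, (emptyTime w : ℝ≥0∞) ∂π = m + y * ∫⁻ w, (emptyTime w : ℝ≥0∞) ∂π := by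
  have h1 : ∫⁻ w, (emptyTime w : ℝ≥0∞) ∂π = ⨆ n, ∫⁻ w, (stoppedWork n w : ℝ≥0∞) ∂π := by
    rw [← lintegral_iSup (f := fun n w => (stoppedWork n w : ℝ≥0∞)) (fun n => by fun_prop)
      fun i j h w => Nat.cast_le.2 (monotone_stoppedWork w h)]
    refine lintegral_congr_ae ?_
    filter_upwards [h] with w hw
    exact coe_emptyTime_eq_iSup_stoppedWork hw
  simp_rw [lintegral_stoppedWork hπ hm hy] at h1
  rwa [← ENNReal.add_iSup, ← ENNReal.mul_iSup, ← lintegral_emptyTime_eq_iSup] at h1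

/-- A finite mean E would make the emptying time finite almost surely, and the identity would give E
≥ m + E with m > 0. -/
theorem lintegral_emptyTime_eq_top (hπ : iIndepFun (fun i (w : ℕ → ℕ) => w i) π) {m y : ℝ≥0∞}
    (hm : ∫⁻ w, (w 0 : ℝ≥0∞) ∂π = m) (hy : ∀ n, ∫⁻ w, (w (n + 1) : ℝ≥0∞) ∂π = y)
    (hm0 : m ≠ 0) (hy1 : 1 ≤ y) : ∫⁻ w, (emptyTime w : ℝ≥0∞) ∂π = ∞ := by
  by_contra h
  have h1 := lintegral_emptyTime_eq hπ hm hy (ae_ne_top_of_lintegral_emptyTime h)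
  have h2 : m + ∫⁻ w, (emptyTime w : ℝ≥0∞) ∂π ≤ ∫⁻ w, (emptyTime w : ℝ≥0∞) ∂π := by
    conv_rhs => rw [h1]
    gcongr
    exact le_mul_of_one_le_left' hy1
  rw [add_comm] at h2
  exact absurd h2 (not_le.2 (ENNReal.lt_add_right h hm0))

theorem lintegral_emptyTime (hπ : iIndepFun (fun i (w : ℕ → ℕ) => w i) π) {m y : ℝ}
    (hm0 : 0 ≤ m) (hy0 : 0 ≤ y) (hm : ∫⁻ w, (w 0 : ℝ≥0∞) ∂π = ENNReal.ofReal m)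
    (hy : ∀ n, ∫⁻ w, (w (n + 1) : ℝ≥0∞) ∂π = ENNReal.ofReal y) (hy1 : y < 1) :
    ∫⁻ w, (emptyTime w : ℝ≥0∞) ∂π = ENNReal.ofReal (m / (1 - y)) := by
  have h1y : 0 < 1 - y := by linarith
  -- Comparing `busyCount` with `stoppedWork` in the stopped identity bounds the mean uniformly in
  -- `n`. Only this finiteness allows solving the limit identity for the mean.
  have hfin : ∀ n, ∫⁻ w, (busyCount n w : ℝ≥0∞) ∂π ≤ ENNReal.ofReal (m / (1 - y)) := by
    intro n
    have h1 : ∫⁻ w, (busyCount n w : ℝ≥0∞) ∂π ≤ n := by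
      calc _ ≤ ∫⁻ w, (n : ℝ≥0∞) ∂π := by
            exact lintegral_mono fun w => Nat.cast_le.2 (busyCount_le n w)
        _ = n := by simp
    have h1' : ∫⁻ w, (busyCount n w : ℝ≥0∞) ∂π ≠ ∞ := ne_top_of_le_ne_top (by simp) h1
    have h2 : ∫⁻ w, (busyCount n w : ℝ≥0∞) ∂π ≤ ∫⁻ w, (stoppedWork n w : ℝ≥0∞) ∂π :=
      lintegral_mono fun w => Nat.cast_le.2 (busyCount_le_stoppedWork n w)
    rw [lintegral_stoppedWork hπ hm hy] at h2
    rw [ENNReal.le_ofReal_iff_toReal_le h1' (by positivity), le_div_iff₀ h1y]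
    have h3 := ENNReal.toReal_mono (by finiteness) h2
    rw [ENNReal.toReal_add (by simp) (by finiteness), ENNReal.toReal_mul,
      ENNReal.toReal_ofReal hm0, ENNReal.toReal_ofReal hy0] at h3
    linarith
  have hB : ∫⁻ w, (emptyTime w : ℝ≥0∞) ∂π ≠ ∞ := by
    rw [lintegral_emptyTime_eq_iSup]
    exact ne_top_of_le_ne_top ENNReal.ofReal_ne_top (iSup_le hfin)
  have h1 := lintegral_emptyTime_eq hπ hm hy (ae_ne_top_of_lintegral_emptyTime hB)
  have h2 := congrArg ENNReal.toReal h1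
  rw [ENNReal.toReal_add (by simp) (by finiteness), ENNReal.toReal_mul,
    ENNReal.toReal_ofReal hm0, ENNReal.toReal_ofReal hy0] at h2
  rw [← ENNReal.ofReal_toReal hB]
  congr 1
  rw [eq_div_iff h1y.ne']
  linarith

section SecondMoment

theorem memLp_two_of_lintegral {Ω : Type*} [MeasurableSpace Ω] {μ : Measure Ω} {f : Ω → ℕ}
    (hf : Measurable f) (h : ∫⁻ ω, (f ω : ℝ≥0∞) ^ 2 ∂μ ≠ ∞) : MemLp (fun ω => (f ω : ℝ)) 2 μ := by
  rw [memLp_two_iff_integrable_sq (by fun_prop)]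
  refine ⟨by fun_prop, ?_⟩
  rw [hasFiniteIntegral_iff_ofReal (Eventually.of_forall fun ω => by positivity)]
  refine lt_of_eq_of_lt (lintegral_congr fun ω => ?_) (lt_top_iff_ne_top.2 h)
  rw [ENNReal.ofReal_pow (by positivity), ENNReal.ofReal_natCast]

theorem integral_natCast_eq {Ω : Type*} [MeasurableSpace Ω] {μ : Measure Ω} {f : Ω → ℕ}
    (hf : Measurable f) : ∫ ω, (f ω : ℝ) ∂μ = (∫⁻ ω, (f ω : ℝ≥0∞) ∂μ).toReal := by
  rw [integral_eq_lintegral_of_nonneg_ae (Eventually.of_forall fun ω => by positivity)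
    (by fun_prop)]
  simp

theorem integral_natCast_sq_eq {Ω : Type*} [MeasurableSpace Ω] {μ : Measure Ω} {f : Ω → ℕ}
    (hf : Measurable f) : ∫ ω, (f ω : ℝ) ^ 2 ∂μ = (∫⁻ ω, (f ω : ℝ≥0∞) ^ 2 ∂μ).toReal := by
  rw [integral_eq_lintegral_of_nonneg_ae (Eventually.of_forall fun ω => by positivity)
    (by fun_prop)]
  congr 1
  refine lintegral_congr fun ω => ?_
  rw [ENNReal.ofReal_pow (by positivity), ENNReal.ofReal_natCast]

/-- The stopped work minus its mean drift. -/
noncomputable def drifted (y : ℝ) (n : ℕ) (w : ℕ → ℕ) : ℝ :=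
  (stoppedWork n w : ℝ) - y * busyCount n w

theorem drifted_succ (y : ℝ) (n : ℕ) (w : ℕ → ℕ) :
    drifted y (n + 1) w = drifted y n w + busyInd n w * (w (n + 1) - y) := by
  simp only [drifted, stoppedWork, busyCount, Finset.sum_range_succ]
  push_cast
  ring

@[fun_prop]
theorem measurable_drifted (y : ℝ) (n : ℕ) : Measurable (drifted y n) := by
  unfold drifted; fun_prop

variable {v y s : ℝ}

theorem memLp_drifted (h0 : MemLp (fun w : ℕ → ℕ => (w 0 : ℝ)) 2 π)
    (h1 : ∀ n, MemLp (fun w : ℕ → ℕ => (w (n + 1) : ℝ)) 2 π) (n : ℕ) :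
    MemLp (drifted y n) 2 π ∧
      MemLp (fun w : ℕ → ℕ => (busyInd n w : ℝ) * (w (n + 1) - y)) 2 π := by
  have h2 : ∀ n, MemLp (fun w : ℕ → ℕ => (busyInd n w : ℝ) * (w (n + 1) - y)) 2 π := by
    intro n
    refine MemLp.of_le ((h1 n).sub (memLp_const y))
      (Measurable.aestronglyMeasurable (by fun_prop)) (Eventually.of_forall fun w => ?_)
    rw [norm_mul]
    refine mul_le_of_le_one_left (norm_nonneg _) ?_
    rw [Real.norm_natCast]
    exact_mod_cast busyInd_le_one n w
  refine ⟨?_, h2 n⟩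
  induction n with
  | zero =>
    convert h0 using 2 with w
    simp [drifted, stoppedWork, busyCount]
  | succ n ih =>
    have : drifted y (n + 1) = drifted y n + fun w => (busyInd n w : ℝ) * (w (n + 1) - y) := by
      funext w; exact drifted_succ y n w
    rw [this]
    exact ih.add (h2 n)

/-- Wald's second identity. `drifted` is a martingale whose increments are a centred work times an
indicator decided earlier; cross terms vanish, and the squared increment has mean `s` times the
probability of being busy. -/
theorem integral_drifted_sq (hπ : iIndepFun (fun i (w : ℕ → ℕ) => w i) π)
    (h0 : MemLp (fun w : ℕ → ℕ => (w 0 : ℝ)) 2 π)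
    (h1 : ∀ n, MemLp (fun w : ℕ → ℕ => (w (n + 1) : ℝ)) 2 π)
    (hv : ∫ w, (w 0 : ℝ) ^ 2 ∂π = v) (hy : ∀ n, ∫ w, (w (n + 1) : ℝ) ∂π = y)
    (hs : ∀ n, ∫ w, ((w (n + 1) : ℝ) - y) ^ 2 ∂π = s) (n : ℕ) :
    ∫ w, drifted y n w ^ 2 ∂π = v + s * ∫ w, (busyCount n w : ℝ) ∂π := by
  induction n with
  | zero =>
    rw [← hv]
    simp [drifted, stoppedWork, busyCount]
  | succ n ih =>
    obtain ⟨hX, hV⟩ := memLp_drifted (y := y) h0 h1 n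
    have e1 : ∀ w, drifted y (n + 1) w ^ 2 = drifted y n w ^ 2 +
        (2 * (drifted y n w * (busyInd n w * (w (n + 1) - y))) +
          (busyInd n w * (w (n + 1) - y)) ^ 2) := by
      intro w; rw [drifted_succ]; ring
    have hXV : Integrable (fun w => drifted y n w * (busyInd n w * (w (n + 1) - y))) π :=
      hX.integrable_mul hV
    have hind : ∀ f : (ℕ → ℕ) → ℝ, Measurable f → DependsOn f {i | i ≤ n} → ∀ g : ℝ → ℝ,
        Measurable g → ∫ w, f w * g (w (n + 1)) ∂π = (∫ w, f w ∂π) * ∫ w, g (w (n + 1)) ∂π := by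
      intro f mf hf g mg
      have h2 := (indepFun_next hπ n mf hf).comp (φ := id) (ψ := fun k : ℕ => g k) measurable_id
        (measurable_of_countable _)
      exact h2.integral_mul_eq_mul_integral mf.aestronglyMeasurable
        (by fun_prop : Measurable fun w : ℕ → ℕ => g (w (n + 1))).aestronglyMeasurable
    have hdep : DependsOn (drifted y n) {i | i ≤ n} := by
      intro w w' h
      simp only [drifted, dependsOn_stoppedWork n h, dependsOn_busyCount n h]
    have e2 : ∫ w, drifted y n w * (busyInd n w * (w (n + 1) - y)) ∂π = 0 := by
      have h2 := hind (fun w => drifted y n w * busyInd n w) (by fun_prop) (by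
        intro w w' h
        simp only [hdep h, dependsOn_busyInd n h]) (fun x => x - y) (by fun_prop)
      have h3 : ∫ w : ℕ → ℕ, ((w (n + 1) : ℝ) - y) ∂π = 0 := by
        rw [integral_sub ((h1 n).integrable (by norm_num)) (integrable_const y), hy]
        simp
      rw [h3, mul_zero] at h2
      rw [← h2]
      simp only [mul_assoc]
    have e3 : ∫ w, ((busyInd n w : ℝ) * (w (n + 1) - y)) ^ 2 ∂π =
        (∫ w, (busyInd n w : ℝ) ∂π) * s := by
      have h2 := hind (fun w => busyInd n w) (by fun_prop) (by
        intro w w' h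
        simp only [dependsOn_busyInd n h]) (fun x => (x - y) ^ 2) (by fun_prop)
      rw [hs] at h2
      rw [← h2]
      refine integral_congr_ae (Eventually.of_forall fun w => ?_)
      have h3 : ((busyInd n w : ℝ)) * busyInd n w = busyInd n w := by
        exact_mod_cast busyInd_mul_self n w
      simp only [mul_pow, sq (busyInd n w : ℝ), h3]
    have hb : ∀ k, Integrable (fun w => (busyInd k w : ℝ)) π := fun k =>
      Integrable.of_bound (by fun_prop) 1 (Eventually.of_forall fun w => by
        rw [Real.norm_natCast]; exact_mod_cast busyInd_le_one k w)
    simp_rw [e1]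
    rw [integral_add hX.integrable_sq (by exact (hXV.const_mul 2).add hV.integrable_sq),
      integral_add (hXV.const_mul 2) hV.integrable_sq, integral_const_mul, e2, e3, ih]
    have e4 : ∀ m, ∫ w, (busyCount m w : ℝ) ∂π = ∑ i ∈ Finset.range m, ∫ w, (busyInd i w : ℝ) ∂π := by
      intro m
      simp only [busyCount]
      push_cast
      exact integral_finsetSum _ fun i _ => hb i
    rw [e4, e4, Finset.sum_range_succ]
    ring

/-- At the emptying time B both counters equal B, so `drifted` converges to (1 - y) B. Its second
moment converges to the bracket by Wald's second identity, and dominated convergence identifies the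
two limits. -/
theorem lintegral_emptyTime_sq (hπ : iIndepFun (fun i (w : ℕ → ℕ) => w i) π) {m v y u : ℝ}
    (hm0 : 0 ≤ m) (hv0 : 0 ≤ v) (hy0 : 0 ≤ y) (hu0 : 0 ≤ u)
    (hm : ∫⁻ w, (w 0 : ℝ≥0∞) ∂π = ENNReal.ofReal m)
    (hv : ∫⁻ w, (w 0 : ℝ≥0∞) ^ 2 ∂π = ENNReal.ofReal v)
    (hy : ∀ n, ∫⁻ w, (w (n + 1) : ℝ≥0∞) ∂π = ENNReal.ofReal y)
    (hu : ∀ n, ∫⁻ w, (w (n + 1) : ℝ≥0∞) ^ 2 ∂π = ENNReal.ofReal u) (hy1 : y < 1) :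
    ∫⁻ w, (emptyTime w : ℝ≥0∞) ^ 2 ∂π =
      ENNReal.ofReal ((v + (u - y ^ 2) * (m / (1 - y))) / (1 - y) ^ 2) := by
  have h1y : 0 < 1 - y := by linarith
  have hL0 : MemLp (fun w : ℕ → ℕ => (w 0 : ℝ)) 2 π :=
    memLp_two_of_lintegral (measurable_pi_apply 0) (by rw [hv]; simp)
  have hL1 : ∀ n, MemLp (fun w : ℕ → ℕ => (w (n + 1) : ℝ)) 2 π := fun n =>
    memLp_two_of_lintegral (measurable_pi_apply _) (by rw [hu]; simp)
  have hv' : ∫ w, (w 0 : ℝ) ^ 2 ∂π = v := by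
    rw [integral_natCast_sq_eq (measurable_pi_apply 0), hv, ENNReal.toReal_ofReal hv0]
  have hy' : ∀ n, ∫ w, (w (n + 1) : ℝ) ∂π = y := fun n => by
    rw [integral_natCast_eq (measurable_pi_apply _), hy, ENNReal.toReal_ofReal hy0]
  have hs : ∀ n, ∫ w, ((w (n + 1) : ℝ) - y) ^ 2 ∂π = u - y ^ 2 := by
    intro n
    have e1 : ∀ w : ℕ → ℕ, ((w (n + 1) : ℝ) - y) ^ 2 =
        (w (n + 1) : ℝ) ^ 2 - (2 * y * w (n + 1) - y ^ 2) := fun w => by ring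
    have i1 : Integrable (fun w : ℕ → ℕ => 2 * y * (w (n + 1) : ℝ)) π :=
      ((hL1 n).integrable (by norm_num)).const_mul _
    simp_rw [e1]
    rw [integral_sub (hL1 n).integrable_sq (by exact i1.sub (integrable_const _)),
      integral_sub i1 (integrable_const _), integral_const_mul, hy',
      integral_natCast_sq_eq (measurable_pi_apply _), hu, ENNReal.toReal_ofReal hu0]
    simp
    ring
  have hs0 : 0 ≤ u - y ^ 2 := by
    rw [← hs 0]; exact integral_nonneg fun w => sq_nonneg _
  have hE := lintegral_emptyTime hπ hm0 hy0 hm hy hy1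
  have hfin := ae_ne_top_of_lintegral_emptyTime (π := π) (by rw [hE]; simp)
  have hD := integral_drifted_sq hπ hL0 hL1 hv' hy' hs
  have hcount : ∀ n, ∫ w, (busyCount n w : ℝ) ∂π ≤ m / (1 - y) := by
    intro n
    rw [integral_natCast_eq (measurable_busyCount n)]
    refine ENNReal.toReal_le_of_le_ofReal (by positivity) ?_
    rw [← hE, lintegral_emptyTime_eq_iSup]
    exact le_iSup (fun n => ∫⁻ w, (busyCount n w : ℝ≥0∞) ∂π) n
  have hcount_lim : Tendsto (fun n => ∫ w, (busyCount n w : ℝ) ∂π) atTop (𝓝 (m / (1 - y))) := by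
    have h1 : Tendsto (fun n => ∫⁻ w, (busyCount n w : ℝ≥0∞) ∂π) atTop
        (𝓝 (ENNReal.ofReal (m / (1 - y)))) := by
      rw [← hE, lintegral_emptyTime_eq_iSup]
      exact tendsto_atTop_iSup fun i j h => lintegral_mono fun w =>
        Nat.cast_le.2 (monotone_busyCount w h)
    have h2 := (ENNReal.tendsto_toReal ENNReal.ofReal_ne_top).comp h1
    rw [ENNReal.toReal_ofReal (by positivity)] at h2
    refine h2.congr fun n => ?_
    rw [integral_natCast_eq (measurable_busyCount n)]
    rfl
  -- This bounds the second moment of `busyCount` uniformly, so the second moment of the emptying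
  -- time is finite before any limit is taken under the integral.
  have hpt : ∀ n w, (1 - y) * (busyCount n w : ℝ) ≤ drifted y n w := by
    intro n w
    have : (busyCount n w : ℝ) ≤ stoppedWork n w := by exact_mod_cast busyCount_le_stoppedWork n w
    simp only [drifted]; linarith
  have hsqfin : ∀ n, ∫⁻ w, (busyCount n w : ℝ≥0∞) ^ 2 ∂π ≤
      ENNReal.ofReal ((v + (u - y ^ 2) * (m / (1 - y))) / (1 - y) ^ 2) := by
    intro n
    have h1 : ∫ w, (1 - y) ^ 2 * (busyCount n w : ℝ) ^ 2 ∂π ≤ ∫ w, drifted y n w ^ 2 ∂π := by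
      refine integral_mono_of_nonneg (Eventually.of_forall fun w => by positivity)
        (memLp_drifted hL0 hL1 n).1.integrable_sq (Eventually.of_forall fun w => ?_)
      have := hpt n w
      simp only [← mul_pow]
      gcongr
    have hb : Integrable (fun w => (busyCount n w : ℝ) ^ 2) π := by
      refine Integrable.of_bound (Measurable.aestronglyMeasurable (by fun_prop)) ((n : ℝ) ^ 2)
        (Eventually.of_forall fun w => ?_)
      have h3 : (busyCount n w : ℝ) ≤ n := by exact_mod_cast busyCount_le n w
      rw [Real.norm_of_nonneg (by positivity)]
      gcongr
    rw [integral_const_mul, hD] at h1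
    have h2 : ∫⁻ w, (busyCount n w : ℝ≥0∞) ^ 2 ∂π =
        ENNReal.ofReal (∫ w, (busyCount n w : ℝ) ^ 2 ∂π) := by
      rw [ofReal_integral_eq_lintegral_ofReal hb (Eventually.of_forall fun w => by positivity)]
      refine lintegral_congr fun w => ?_
      rw [ENNReal.ofReal_pow (by positivity), ENNReal.ofReal_natCast]
    rw [h2]
    refine ENNReal.ofReal_le_ofReal ?_
    rw [le_div_iff₀ (by positivity)]
    have h3 := mul_le_mul_of_nonneg_left (hcount n) hs0
    linarith
  have hsq_iSup : ∫⁻ w, (emptyTime w : ℝ≥0∞) ^ 2 ∂π =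
      ⨆ n, ∫⁻ w, (busyCount n w : ℝ≥0∞) ^ 2 ∂π := by
    rw [← lintegral_iSup (f := fun n w => (busyCount n w : ℝ≥0∞) ^ 2) (fun n => by fun_prop)
      fun i j h w => pow_le_pow_left' (Nat.cast_le.2 (monotone_busyCount w h)) 2]
    refine lintegral_congr fun w => ?_
    have h1 : Tendsto (fun n => (busyCount n w : ℝ≥0∞)) atTop (𝓝 (emptyTime w : ℝ≥0∞)) := by
      rw [coe_emptyTime_eq_iSup]
      exact tendsto_atTop_iSup fun i j h => Nat.cast_le.2 (monotone_busyCount w h)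
    exact tendsto_nhds_unique (ENNReal.Tendsto.pow (n := 2) h1) (tendsto_atTop_iSup fun i j h =>
      pow_le_pow_left' (Nat.cast_le.2 (monotone_busyCount w h)) 2)
  have hBfin : ∫⁻ w, (emptyTime w : ℝ≥0∞) ^ 2 ∂π ≠ ∞ := by
    rw [hsq_iSup]
    exact ne_top_of_le_ne_top ENNReal.ofReal_ne_top (iSup_le hsqfin)
  have mB : Measurable fun w => (emptyTime w).toNat :=
    (measurable_of_countable _).comp measurable_emptyTime
  have hBnat : ∫⁻ w, (emptyTime w : ℝ≥0∞) ^ 2 ∂π =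
      ∫⁻ w, (((emptyTime w).toNat : ℕ) : ℝ≥0∞) ^ 2 ∂π := by
    refine lintegral_congr_ae ?_
    filter_upwards [hfin] with w hw
    conv_lhs => rw [← ENat.natCast_toNat hw]
    simp
  have hBint : Integrable (fun w => (((emptyTime w).toNat : ℕ) : ℝ) ^ 2) π :=
    (memLp_two_of_lintegral mB (hBnat ▸ hBfin)).integrable_sq
  -- On a path with emptying time k, `drifted` is nonnegative and at most k, which is dominated by
  -- (1 + y) k; it is constant from n = k on.
  have hlim1 : Tendsto (fun n => ∫ w, drifted y n w ^ 2 ∂π) atTop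
      (𝓝 (∫ w, ((1 - y) * ((emptyTime w).toNat : ℕ)) ^ 2 ∂π)) := by
    refine tendsto_integral_of_dominated_convergence
      (fun w => (1 + y) ^ 2 * (((emptyTime w).toNat : ℕ) : ℝ) ^ 2)
      (fun n => Measurable.aestronglyMeasurable (by fun_prop)) (hBint.const_mul _) ?_ ?_
    · intro n
      filter_upwards [hfin] with w hw
      obtain ⟨k, hk⟩ := ENat.ne_top_iff_exists.1 hw
      have e1 : stoppedWork n w ≤ k :=
        (monotone_stoppedWork w (le_max_left n k)).trans
          (busyCount_eq_of_ge hk.symm (le_max_right _ _)).2.le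
      have e2 : busyCount n w ≤ k := (busyCount_le_stoppedWork n w).trans e1
      have e3 : (stoppedWork n w : ℝ) ≤ k := by exact_mod_cast e1
      have e4 : (busyCount n w : ℝ) ≤ k := by exact_mod_cast e2
      have e5 := hpt n w
      have e6 : (0 : ℝ) ≤ busyCount n w := by positivity
      rw [← hk, ENat.toNat_natCast, norm_pow, ← mul_pow]
      refine pow_le_pow_left₀ (norm_nonneg _) ?_ 2
      rw [Real.norm_of_nonneg (le_trans (by positivity) e5)]
      simp only [drifted]
      nlinarith
    · filter_upwards [hfin] with w hw
      obtain ⟨k, hk⟩ := ENat.ne_top_iff_exists.1 hw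
      refine tendsto_atTop_of_eventually_const (i₀ := k) fun n hn => ?_
      obtain ⟨e1, e2⟩ := busyCount_eq_of_ge hk.symm hn
      simp only [drifted, e1, e2, ← hk, ENat.toNat_natCast]
      ring
  have hlim2 : Tendsto (fun n => ∫ w, drifted y n w ^ 2 ∂π) atTop
      (𝓝 (v + (u - y ^ 2) * (m / (1 - y)))) := by
    simp_rw [hD]
    exact (hcount_lim.const_mul _).const_add _
  have h1 := tendsto_nhds_unique hlim1 hlim2
  simp_rw [mul_pow] at h1
  rw [integral_const_mul, integral_natCast_sq_eq mB, ← hBnat] at h1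
  rw [← ENNReal.ofReal_toReal hBfin]
  congr 1
  rw [eq_div_iff (by positivity)]
  linarith

end SecondMoment

end Moments

end Queue

/-! ### Laws of service times and of packet generations. -/

section Laws

instance (P : Params) : Fact (0 < P.lam) := ⟨P.lam_pos⟩

variable (P : Params)

/-- The mean number of transmissions of a packet, minus one. -/
noncomputable def Params.theta : ℝ := P.lam * P.N0 * P.ell / (P.Pt * P.TB)

theorem Params.theta_pos : 0 < P.theta := by
  have := P.lam_pos; have := P.N0_pos; have := P.ell_pos; have := P.Pt_pos; have := P.TB_pos
  unfold Params.theta; positivity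

/-- The accumulated gain at which a packet is delivered. -/
noncomputable def Params.level : ℝ := P.ell * P.N0 / (P.Pt * P.TB)

theorem Params.level_pos : 0 < P.level := by
  have := P.N0_pos; have := P.ell_pos; have := P.Pt_pos; have := P.TB_pos
  unfold Params.level; positivity

theorem Params.lam_mul_level : P.lam * P.level = P.theta := by
  unfold Params.level Params.theta; ring

theorem ell_le_sum_iff (x : ℕ → ℝ) (n : ℕ) :
    P.ell ≤ ∑ i ∈ Finset.range n, blockInfo P (x i) ↔ P.level ≤ ∑ i ∈ Finset.range n, x i := by
  have h1 := P.N0_pos; have h2 := P.Pt_pos; have h3 := P.TB_pos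
  have e : ∑ i ∈ Finset.range n, blockInfo P (x i) =
      (∑ i ∈ Finset.range n, x i) * (P.Pt * P.TB) / P.N0 := by
    rw [Finset.sum_mul, Finset.sum_div]
    exact Finset.sum_congr rfl fun i _ => by unfold blockInfo; ring
  rw [e, Params.level, div_le_iff₀ (by positivity), le_div_iff₀ h1]

theorem measurable_serviceTime : Measurable (serviceTime P) := by
  unfold serviceTime
  refine measurable_sInf_nat fun n => ?_
  simp_rw [ell_le_sum_iff]
  exact measurableSet_le (by fun_prop) (by fun_prop)

/-- A service starts with nothing accumulated, so even the zeroth term is a transmission and the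
passing index is one less than the number of blocks. Hence service times are 1 + Poisson(θ). -/
theorem serviceTime_of_isPass {j : ℕ} {x : ℕ → ℝ} (h : IsPass j P.level x) :
    serviceTime P x = j + 1 := by
  unfold serviceTime
  simp_rw [ell_le_sum_iff]
  refine le_antisymm (Nat.sInf_le h.1) ?_
  by_contra hlt
  push Not at hlt
  have h1 : P.level ≤ ∑ i ∈ Finset.range (sInf {n | P.level ≤ ∑ i ∈ Finset.range n, x i}), x i :=
    Nat.sInf_mem (s := {n | P.level ≤ ∑ i ∈ Finset.range n, x i}) ⟨j + 1, h.1⟩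
  -- The value 0 is excluded because the empty sum is below the positive level.
  rcases hn : sInf {n | P.level ≤ ∑ i ∈ Finset.range n, x i} with _ | n
  · rw [hn] at h1
    simp only [Finset.range_zero, Finset.sum_empty] at h1
    exact absurd P.level_pos (not_lt.2 h1)
  · rw [hn] at h1 hlt
    exact absurd (h.2 n (by omega)) (not_lt.2 h1)

theorem ae_serviceTime_eq :
    ∀ᵐ x ∂expSeq P.lam, serviceTime P x = passTime P.level x + 1 := by
  filter_upwards [ae_exists_isPass (lam := P.lam) P.level_pos.le] with x ⟨j, hj⟩
  rw [serviceTime_of_isPass P hj, hj.passTime_eq]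

/-- The law of the number of transmissions of a packet. -/
noncomputable def serviceLaw : Measure ℕ := (expSeq P.lam).map (serviceTime P)

instance : IsProbabilityMeasure (serviceLaw P) :=
  Measure.isProbabilityMeasure_map (measurable_serviceTime P).aemeasurable

theorem lintegral_serviceLaw (f : ℕ → ℝ≥0∞) :
    ∫⁻ n, f n ∂serviceLaw P = ∫⁻ n, f (n + 1) ∂poissonMeasure P.theta.toNNReal := by
  rw [serviceLaw, lintegral_map (measurable_of_countable f) (measurable_serviceTime P),
    ← P.lam_mul_level, ← lintegral_passTime P.level_pos.le]
  refine lintegral_congr_ae ?_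
  filter_upwards [ae_serviceTime_eq P] with x hx
  rw [hx]

theorem coe_theta : ((P.theta.toNNReal : ℝ≥0) : ℝ≥0∞) = ENNReal.ofReal P.theta := rfl

theorem lintegral_serviceLaw_id :
    ∫⁻ n, (n : ℝ≥0∞) ∂serviceLaw P = ENNReal.ofReal (1 + P.theta) := by
  rw [lintegral_serviceLaw, lintegral_poisson_succ, coe_theta,
    ENNReal.ofReal_add (by norm_num) P.theta_pos.le, ENNReal.ofReal_one]

theorem lintegral_serviceLaw_sq :
    ∫⁻ n, (n : ℝ≥0∞) ^ 2 ∂serviceLaw P = ENNReal.ofReal (P.theta ^ 2 + 3 * P.theta + 1) := by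
  have := P.theta_pos
  rw [lintegral_serviceLaw P fun n => (n : ℝ≥0∞) ^ 2, lintegral_poisson_succ_sq, coe_theta,
    ENNReal.ofReal_add (by positivity) (by norm_num), ENNReal.ofReal_add (by positivity)
    (by positivity), ENNReal.ofReal_mul (by norm_num), ENNReal.ofReal_pow this.le]
  simp

theorem ae_serviceLaw_pos : ∀ᵐ n ∂serviceLaw P, 1 ≤ n := by
  rw [serviceLaw, ae_map_iff (measurable_serviceTime P).aemeasurable
    (MeasurableSet.of_discrete (s := {n | 1 ≤ n}))]
  filter_upwards [ae_serviceTime_eq P] with x hx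
  omega

open scoped Classical in
/-- The numerical value of a packet generation. -/
noncomputable def boolVal (b : Bool) : ℝ := if b = true then 1 else 0

theorem boolVal_eq_one_iff (b : Bool) : boolVal b = 1 ↔ b = true := by
  unfold boolVal; cases b <;> simp

/-- The law of the indicator of a packet generation. -/
noncomputable def genLaw : Measure ℝ :=
  (ENNReal.ofReal P.p • Measure.dirac true + ENNReal.ofReal (1 - P.p) • Measure.dirac false).map
    boolVal

instance : IsProbabilityMeasure (genLaw P) := by
  have : IsProbabilityMeasure
      (ENNReal.ofReal P.p • Measure.dirac true + ENNReal.ofReal (1 - P.p) • Measure.dirac false) := by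
    constructor
    simp only [Measure.coe_add, Measure.coe_smul, Pi.add_apply, Pi.smul_apply, measure_univ,
      smul_eq_mul, mul_one]
    rw [← ENNReal.ofReal_add P.p_nonneg (by linarith [P.p_le_one])]
    simp
  exact Measure.isProbabilityMeasure_map (measurable_of_countable _).aemeasurable

theorem genLaw_singleton_one : genLaw P {1} = ENNReal.ofReal P.p := by
  rw [genLaw, Measure.map_apply (measurable_of_countable _) (measurableSet_singleton 1)]
  have : boolVal ⁻¹' {1} = {true} := by ext b; simp [boolVal_eq_one_iff]
  rw [this]
  simp

theorem map_boolVal {Ω : Type*} [MeasurableSpace Ω] (μ : Measure Ω) [IsProbabilityMeasure μ]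
    {B : Ω → Bool} (hB : Measurable B) (h : μ {ω | B ω = true} = ENNReal.ofReal P.p) :
    μ.map (fun ω => boolVal (B ω)) = genLaw P := by
  have h1 : μ.map B =
      ENNReal.ofReal P.p • Measure.dirac true + ENNReal.ofReal (1 - P.p) • Measure.dirac false := by
    have h2 : μ (B ⁻¹' {true}) = ENNReal.ofReal P.p := h
    refine Measure.ext_of_singleton fun b => ?_
    rw [Measure.map_apply hB (measurableSet_singleton b)]
    cases b
    · have h3 : B ⁻¹' {false} = (B ⁻¹' {true})ᶜ := by ext ω; simp
      rw [h3, prob_compl_eq_one_sub (hB (measurableSet_singleton _)), h2]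
      simp [ENNReal.ofReal_sub _ P.p_nonneg]
    · rw [h2]; simp
  rw [genLaw, ← h1, Measure.map_map (measurable_of_countable _) hB]
  rfl

/-- Splitting a product measure into a factor and a sequence of factors. -/
theorem map_split_infinitePi {α I : Type*} (ν : α ⊕ (ℕ × I) → Measure ℝ)
    [∀ i, IsProbabilityMeasure (ν i)] :
    (Measure.infinitePi ν).map (fun x => (fun a => x (Sum.inl a), fun k i => x (Sum.inr (k, i)))) =
      (Measure.infinitePi fun a => ν (Sum.inl a)).prod
        (Measure.infinitePi fun k => Measure.infinitePi fun i => ν (Sum.inr (k, i))) := by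
  have h0 : iIndepFun (fun i (x : α ⊕ (ℕ × I) → ℝ) => x i) (Measure.infinitePi ν) :=
    iIndepFun_infinitePi (X := fun _ y => y) fun _ => measurable_id
  have h1 : IndepFun (fun (x : α ⊕ (ℕ × I) → ℝ) a => x (Sum.inl a))
      (fun x k i => x (Sum.inr (k, i))) (Measure.infinitePi ν) := by
    refine indepFun_of_dependsOn (s := Set.range Sum.inl) (t := Set.range Sum.inr) h0
      measurable_pi_apply ?_ (φ := fun (x : α ⊕ (ℕ × I) → ℝ) a => x (Sum.inl a))
      (ψ := fun (x : α ⊕ (ℕ × I) → ℝ) k i => x (Sum.inr (k, i))) (by fun_prop) (by fun_prop) ?_ ?_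
    · exact Set.isCompl_range_inl_range_inr.disjoint
    · intro x y h; funext a; exact h _ ⟨a, rfl⟩
    · intro x y h; funext k i; exact h _ ⟨(k, i), rfl⟩
  rw [(indepFun_iff_map_prod_eq_prod_map_map (Measurable.aemeasurable (by fun_prop))
    (Measurable.aemeasurable (by fun_prop))).1 h1,
    Measure.map_infinitePi_infinitePi_of_inj (P := ν) Sum.inl_injective]
  congr 1
  have h2 := Measure.map_infinitePi_infinitePi_of_inj (P := ν)
    (f := (Sum.inr : ℕ × I → α ⊕ (ℕ × I))) Sum.inr_injective
  rw [← Measure.infinitePi_map_curry (fun k i => ν (Sum.inr (k, i))), ← h2,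
    Measure.map_map (by fun_prop) (by fun_prop)]
  rfl

end Laws

/-! ### The downlink busy period as an emptying time. -/

section BusyPeriod

variable (P : Params)

/-- The gains and the generations of a busy period. -/
noncomputable def busyMeasure : (ℕ × ℕ) ⊕ ℕ → Measure ℝ :=
  Sum.elim (fun _ => expMeasure P.lam) fun _ => genLaw P

instance (i : (ℕ × ℕ) ⊕ ℕ) : IsProbabilityMeasure (busyMeasure P i) := by
  unfold busyMeasure; cases i <;> simp only [Sum.elim_inl, Sum.elim_inr] <;> infer_instance

open scoped Classical in
/-- The work that arrives at the queue at time `n`. -/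
noncomputable def busyWork (x : (ℕ × ℕ) ⊕ ℕ → ℝ) : ℕ → ℕ
  | 0 => serviceTime P fun n => x (Sum.inl (0, n))
  | m + 1 => if x (Sum.inr m) = 1 then serviceTime P fun n => x (Sum.inl (m + 1, n)) else 0

theorem busyPeriod_eq (a : ℕ → Bool) (g : ℕ → ℕ → ℝ) :
    busyPeriod P a g =
      emptyTime (busyWork P (Sum.elim (fun q => g q.1 q.2) fun m => boolVal (a m))) := by
  unfold busyPeriod emptyTime
  congr 1
  funext n
  simp only [totalWork, Finset.sum_range_succ', busyWork, Sum.elim_inl, Sum.elim_inr,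
    boolVal_eq_one_iff]
  rw [add_comm]

theorem measurable_busyWork (n : ℕ) : Measurable fun x => busyWork P x n := by
  cases n with
  | zero => exact (measurable_serviceTime P).comp (by fun_prop)
  | succ m =>
    refine Measurable.ite ?_ ((measurable_serviceTime P).comp (by fun_prop)) measurable_const
    exact (measurable_pi_apply (Sum.inr m)) (measurableSet_singleton 1)

theorem iIndepFun_busyWork :
    iIndepFun (fun n x => busyWork P x n) (Measure.infinitePi (busyMeasure P)) := by
  have h0 : iIndepFun (fun i (x : (ℕ × ℕ) ⊕ ℕ → ℝ) => x i) (Measure.infinitePi (busyMeasure P)) :=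
    iIndepFun_infinitePi (X := fun _ y => y) fun _ => measurable_id
  refine iIndepFun_of_dependsOn h0 measurable_pi_apply
    -- The generation in block `m` belongs with the gains of packet `m + 1`, whence the shift.
    (Sum.elim (fun q => q.1) fun m => m + 1) (φ := fun n x => busyWork P x n)
    (measurable_busyWork P) fun n => ?_
  intro x y h
  cases n with
  | zero =>
    simp only [busyWork]
    congr 1
    funext n
    exact h (Sum.inl (0, n)) rfl
  | succ m =>
    have h1 : (fun n => x (Sum.inl (m + 1, n))) = fun n => y (Sum.inl (m + 1, n)) := by
      funext n
      exact h (Sum.inl (m + 1, n)) rfl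
    have h2 : x (Sum.inr m) = y (Sum.inr m) := h (Sum.inr m) rfl
    simp only [busyWork, h1, h2]

theorem lintegral_serviceTime_busy (m : ℕ) (f : ℕ → ℝ≥0∞) :
    ∫⁻ x, f (serviceTime P fun n => x (Sum.inl (m, n))) ∂Measure.infinitePi (busyMeasure P) =
      ∫⁻ n, f n ∂serviceLaw P := by
  have h1 := Measure.map_infinitePi_infinitePi_of_inj (P := busyMeasure P)
    (f := fun n : ℕ => (Sum.inl (m, n) : (ℕ × ℕ) ⊕ ℕ)) (fun i j h => by simpa using h)
  have h2 : (Measure.infinitePi fun n : ℕ => busyMeasure P (Sum.inl (m, n))) = expSeq P.lam := rfl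
  rw [serviceLaw, lintegral_map (measurable_of_countable f) (measurable_serviceTime P), ← h2, ← h1,
    lintegral_map (f := fun x => f (serviceTime P x))
      ((measurable_of_countable f).comp (measurable_serviceTime P)) (by fun_prop)]

/-- Since `f 0 = 0`, applying `f` to the work gives the indicator of generation times `f` of the
service time, and these two are independent. -/
theorem lintegral_busyWork_succ (m : ℕ) (f : ℕ → ℝ≥0∞) (hf : f 0 = 0) :
    ∫⁻ x, f (busyWork P x (m + 1)) ∂Measure.infinitePi (busyMeasure P) =
      ENNReal.ofReal P.p * ∫⁻ n, f n ∂serviceLaw P := by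
  classical
  have h0 : iIndepFun (fun i (x : (ℕ × ℕ) ⊕ ℕ → ℝ) => x i) (Measure.infinitePi (busyMeasure P)) :=
    iIndepFun_infinitePi (X := fun _ y => y) fun _ => measurable_id
  have mS : Measurable fun x : (ℕ × ℕ) ⊕ ℕ → ℝ =>
      f (serviceTime P fun n => x (Sum.inl (m + 1, n))) :=
    (measurable_of_countable f).comp ((measurable_serviceTime P).comp (by fun_prop))
  have mI : Measurable fun x : (ℕ × ℕ) ⊕ ℕ → ℝ => ({1} : Set ℝ).indicator (fun _ => (1 : ℝ≥0∞)) (x (Sum.inr m)) :=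
    (measurable_const.indicator (measurableSet_singleton 1)).comp (measurable_pi_apply _)
  have h1 := indepFun_of_dependsOn (s := Set.range Sum.inr) (t := Set.range Sum.inl) h0
      measurable_pi_apply Set.isCompl_range_inl_range_inr.disjoint.symm
      (φ := fun x => ({1} : Set ℝ).indicator (fun _ => (1 : ℝ≥0∞)) (x (Sum.inr m)))
      (ψ := fun x => f (serviceTime P fun n => x (Sum.inl (m + 1, n)))) mI mS
      (fun x y h => by dsimp only; rw [h _ ⟨m, rfl⟩])
      (fun x y h => by
        have : (fun n => x (Sum.inl (m + 1, n))) = fun n => y (Sum.inl (m + 1, n)) := by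
          funext n; exact h _ ⟨_, rfl⟩
        simp only [this])
  have h2 := lintegral_mul_eq_lintegral_mul_lintegral_of_indepFun mI mS h1
  rw [lintegral_serviceTime_busy] at h2
  have h3 : ∫⁻ x : (ℕ × ℕ) ⊕ ℕ → ℝ, ({1} : Set ℝ).indicator (fun _ => (1 : ℝ≥0∞)) (x (Sum.inr m))
      ∂Measure.infinitePi (busyMeasure P) = ENNReal.ofReal P.p := by
    have h4 := (measurePreserving_eval_infinitePi (busyMeasure P) (Sum.inr m)).lintegral_comp
      (f := ({1} : Set ℝ).indicator (fun _ => (1 : ℝ≥0∞)))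
      (measurable_const.indicator (measurableSet_singleton 1))
    refine h4.trans ?_
    rw [lintegral_indicator_const (measurableSet_singleton 1), one_mul]
    exact genLaw_singleton_one P
  rw [h3] at h2
  rw [← h2]
  refine lintegral_congr fun x => ?_
  by_cases hx : x (Sum.inr m) = 1
  · simp [busyWork, hx]
  · simp [busyWork, hx, hf]

/-- The law of the length of a busy period. -/
noncomputable def busyLaw : Measure ℕ∞ :=
  (Measure.infinitePi (busyMeasure P)).map fun x => emptyTime (busyWork P x)

theorem measurable_emptyTime_busyWork : Measurable fun x => emptyTime (busyWork P x) :=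
  measurable_emptyTime.comp (measurable_pi_iff.2 (measurable_busyWork P))

instance : IsProbabilityMeasure (busyLaw P) :=
  Measure.isProbabilityMeasure_map (measurable_emptyTime_busyWork P).aemeasurable

/-- The law of the sequence of works that arrive at the queue. -/
noncomputable def workLaw : Measure (ℕ → ℕ) := (Measure.infinitePi (busyMeasure P)).map (busyWork P)

theorem measurable_busyWork' : Measurable (busyWork P) := measurable_pi_iff.2 (measurable_busyWork P)

instance : IsProbabilityMeasure (workLaw P) :=
  Measure.isProbabilityMeasure_map (measurable_busyWork' P).aemeasurable

theorem iIndepFun_workLaw : iIndepFun (fun n (w : ℕ → ℕ) => w n) (workLaw P) := by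
  have h := (iIndepFun_busyWork P).map_fun_eq_infinitePi_map (measurable_busyWork P)
  rw [iIndepFun_iff_map_fun_eq_infinitePi_map (fun n => measurable_pi_apply n)]
  have h1 : ∀ n, (workLaw P).map (fun w => w n) =
      (Measure.infinitePi (busyMeasure P)).map fun x => busyWork P x n := by
    intro n
    rw [workLaw, Measure.map_map (measurable_pi_apply n) (measurable_busyWork' P)]
    rfl
  simp_rw [h1]
  rw [← h]
  exact Measure.map_id

theorem lintegral_workLaw_zero (f : ℕ → ℝ≥0∞) :
    ∫⁻ w, f (w 0) ∂workLaw P = ∫⁻ n, f n ∂serviceLaw P := by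
  rw [workLaw, lintegral_map (f := fun w : ℕ → ℕ => f (w 0))
    ((measurable_of_countable f).comp (measurable_pi_apply 0))
    (measurable_busyWork' P)]
  exact lintegral_serviceTime_busy P 0 f

theorem lintegral_workLaw_succ (m : ℕ) (f : ℕ → ℝ≥0∞) (hf : f 0 = 0) :
    ∫⁻ w, f (w (m + 1)) ∂workLaw P = ENNReal.ofReal P.p * ∫⁻ n, f n ∂serviceLaw P := by
  rw [workLaw, lintegral_map (f := fun w : ℕ → ℕ => f (w (m + 1)))
    ((measurable_of_countable f).comp (measurable_pi_apply _))
    (measurable_busyWork' P)]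
  exact lintegral_busyWork_succ P m f hf

theorem lintegral_busyLaw (f : ℕ∞ → ℝ≥0∞) :
    ∫⁻ n, f n ∂busyLaw P = ∫⁻ w, f (emptyTime w) ∂workLaw P := by
  rw [busyLaw, workLaw, lintegral_map (measurable_of_countable f) (measurable_emptyTime_busyWork P),
    lintegral_map (f := fun w => f (emptyTime w))
      ((measurable_of_countable f).comp measurable_emptyTime) (measurable_busyWork' P)]

/-- The mean length of a busy period in the stable case. -/
noncomputable def Params.busyMean : ℝ := (1 + P.theta) / (1 - P.p * (1 + P.theta))

/-- The second moment of the length of a busy period in the stable case. -/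
noncomputable def Params.busySq : ℝ :=
  (P.theta ^ 2 + 3 * P.theta + 1 + (P.p * (P.theta ^ 2 + 3 * P.theta + 1) -
    (P.p * (1 + P.theta)) ^ 2) * P.busyMean) / (1 - P.p * (1 + P.theta)) ^ 2

theorem lintegral_busyLaw_id (h : P.p * (1 + P.theta) < 1) :
    ∫⁻ n, (n : ℝ≥0∞) ∂busyLaw P = ENNReal.ofReal P.busyMean := by
  have := P.theta_pos
  have := P.p_nonneg
  rw [lintegral_busyLaw]
  refine lintegral_emptyTime (iIndepFun_workLaw P) (by positivity)
    (mul_nonneg P.p_nonneg (by positivity)) ?_ ?_ h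
  · rw [lintegral_workLaw_zero P fun n => (n : ℝ≥0∞), lintegral_serviceLaw_id]
  · intro n
    rw [lintegral_workLaw_succ P n (fun n => (n : ℝ≥0∞)) (by simp), lintegral_serviceLaw_id,
      ENNReal.ofReal_mul P.p_nonneg]

theorem lintegral_busyLaw_sq (h : P.p * (1 + P.theta) < 1) :
    ∫⁻ n, (n : ℝ≥0∞) ^ 2 ∂busyLaw P = ENNReal.ofReal P.busySq := by
  have := P.theta_pos
  have := P.p_nonneg
  rw [lintegral_busyLaw P fun n => (n : ℝ≥0∞) ^ 2]
  refine lintegral_emptyTime_sq (iIndepFun_workLaw P) (by positivity) (by positivity)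
    (mul_nonneg P.p_nonneg (by positivity)) (by positivity) ?_ ?_ ?_ ?_ h
  · rw [lintegral_workLaw_zero P fun n => (n : ℝ≥0∞), lintegral_serviceLaw_id]
  · rw [lintegral_workLaw_zero P fun n => (n : ℝ≥0∞) ^ 2, lintegral_serviceLaw_sq]
  · intro n
    rw [lintegral_workLaw_succ P n (fun n => (n : ℝ≥0∞)) (by simp), lintegral_serviceLaw_id,
      ENNReal.ofReal_mul P.p_nonneg]
  · intro n
    rw [lintegral_workLaw_succ P n (fun n => (n : ℝ≥0∞) ^ 2) (by simp), lintegral_serviceLaw_sq,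
      ENNReal.ofReal_mul P.p_nonneg]

theorem lintegral_busyLaw_eq_top (h : 1 ≤ P.p * (1 + P.theta)) :
    ∫⁻ n, (n : ℝ≥0∞) ∂busyLaw P = ∞ := by
  have := P.theta_pos
  rw [lintegral_busyLaw]
  refine lintegral_emptyTime_eq_top (iIndepFun_workLaw P) (m := ENNReal.ofReal (1 + P.theta))
    (y := ENNReal.ofReal (P.p * (1 + P.theta))) ?_ ?_ ?_ ?_
  · rw [lintegral_workLaw_zero P fun n => (n : ℝ≥0∞), lintegral_serviceLaw_id]
  · intro n
    rw [lintegral_workLaw_succ P n (fun n => (n : ℝ≥0∞)) (by simp), lintegral_serviceLaw_id,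
      ENNReal.ofReal_mul P.p_nonneg]
  · simp; linarith
  · rwa [ENNReal.one_le_ofReal]

end BusyPeriod

/-! ### The number of consecutive busy periods. -/

section Geometric

/-- Weighted tail-sum formula. Weights 1 give the mean, and weights 2j the factorial moment, as
n(n-1) is the sum of 2i over i < n. -/
theorem lintegral_nat_eq_tsum {Ω : Type*} [MeasurableSpace Ω] {μ : Measure Ω} {N : Ω → ℕ}
    (hN : Measurable N) (c : ℕ → ℝ≥0∞) :
    ∫⁻ ω, ∑ j ∈ Finset.range (N ω), c j ∂μ = ∑' j, c j * μ {ω | j < N ω} := by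
  have h1 : ∀ ω, ∑ j ∈ Finset.range (N ω), c j = ∑' j, {ω | j < N ω}.indicator (fun _ => c j) ω := by
    intro ω
    rw [tsum_eq_sum (s := Finset.range (N ω)) fun j hj => by
      rw [Set.indicator_of_notMem]; simpa using hj]
    refine Finset.sum_congr rfl fun j hj => ?_
    rw [Set.indicator_of_mem]
    simpa using hj
  have hm : ∀ j, MeasurableSet {ω | j < N ω} := fun j => measurableSet_lt measurable_const hN
  simp_rw [h1]
  rw [lintegral_tsum fun j => (measurable_const.indicator (hm j)).aemeasurable]
  refine tsum_congr fun j => ?_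
  rw [lintegral_indicator_const (hm j)]

variable (P : Params)

/-- The number of generations before the first failure. -/
noncomputable def runLength (s : ℕ → ℝ) : ℕ∞ := firstTime fun j => s j ≠ 1

theorem measurable_runLength : Measurable runLength :=
  measurable_firstTime (Q := fun j (s : ℕ → ℝ) => s j ≠ 1) fun j =>
    (show Measurable fun s : ℕ → ℝ => s j from measurable_pi_apply j)
      (measurableSet_singleton (1 : ℝ)).compl

/-- The law of a sequence of generation trials. -/
noncomputable def genSeq : Measure (ℕ → ℝ) := Measure.infinitePi fun _ => genLaw P

instance : IsProbabilityMeasure (genSeq P) := by unfold genSeq; infer_instance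

theorem genSeq_lt_runLength (j : ℕ) :
    genSeq P {s | (j : ℕ∞) < runLength s} = ENNReal.ofReal P.p ^ (j + 1) := by
  have h1 : {s : ℕ → ℝ | (j : ℕ∞) < runLength s} =
      Set.pi (Finset.range (j + 1) : Finset ℕ) fun _ => {1} := by
    ext s
    simp [runLength, lt_firstTime_iff, Set.mem_pi]
  rw [h1, genSeq, Measure.infinitePi_pi _ fun _ _ => measurableSet_singleton 1]
  simp [genLaw_singleton_one]

theorem ae_runLength_ne_top (hp : P.p < 1) : ∀ᵐ s ∂genSeq P, runLength s ≠ ⊤ := by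
  rw [ae_iff]
  simp only [ne_eq, not_not]
  have h1 : ∀ j : ℕ, genSeq P {s | runLength s = ⊤} ≤ ENNReal.ofReal P.p ^ (j + 1) := by
    intro j
    rw [← genSeq_lt_runLength]
    refine measure_mono fun s hs => ?_
    simp only [Set.mem_ofPred_eq] at hs ⊢
    rw [hs]
    exact ENat.natCast_lt_top j
  have h2 : Tendsto (fun j : ℕ => ENNReal.ofReal P.p ^ (j + 1)) atTop (𝓝 0) :=
    (ENNReal.tendsto_pow_atTop_nhds_zero_of_lt_one (by
      rw [← ENNReal.ofReal_one]; exact (ENNReal.ofReal_lt_ofReal_iff (by norm_num)).2 hp)).comp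
      (tendsto_add_atTop_nat 1)
  exact le_antisymm (ge_of_tendsto' h2 h1) (zero_le)

theorem measurable_runLength_toNat : Measurable fun s => (runLength s).toNat :=
  (measurable_of_countable _).comp measurable_runLength

theorem genSeq_lt_runLength_toNat (hp : P.p < 1) (j : ℕ) :
    genSeq P {s | j < (runLength s).toNat} = ENNReal.ofReal P.p ^ (j + 1) := by
  rw [← genSeq_lt_runLength]
  refine measure_congr ?_
  filter_upwards [ae_runLength_ne_top P hp] with s hs
  apply propext
  change j < (runLength s).toNat ↔ (j : ℕ∞) < runLength s
  conv_rhs => rw [← ENat.natCast_toNat hs]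
  rw [Nat.cast_lt]

theorem lintegral_runLength (hp : P.p < 1) :
    ∫⁻ s, ((runLength s).toNat : ℝ≥0∞) ∂genSeq P = ENNReal.ofReal (P.p / (1 - P.p)) := by
  have h := lintegral_nat_eq_tsum (μ := genSeq P) measurable_runLength_toNat fun _ => 1
  simp only [Finset.sum_const, Finset.card_range, nsmul_eq_mul, mul_one, one_mul,
    genSeq_lt_runLength_toNat P hp] at h
  rw [h]
  have h2 := (hasSum_geometric_of_lt_one P.p_nonneg hp).mul_left P.p
  simp_rw [← ENNReal.ofReal_pow P.p_nonneg]
  rw [← ENNReal.ofReal_tsum_of_nonneg (fun n => pow_nonneg P.p_nonneg _)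
    (h2.summable.congr fun n => by ring)]
  congr 1
  rw [← div_eq_mul_inv] at h2
  rw [← h2.tsum_eq]
  exact tsum_congr fun n => by ring

theorem lintegral_runLength_mul_pred (hp : P.p < 1) :
    ∫⁻ s, (((runLength s).toNat * ((runLength s).toNat - 1) : ℕ) : ℝ≥0∞) ∂genSeq P =
      ENNReal.ofReal (2 * P.p ^ 2 / (1 - P.p) ^ 2) := by
  have h := lintegral_nat_eq_tsum (μ := genSeq P) measurable_runLength_toNat
    fun j => ((2 * j : ℕ) : ℝ≥0∞)
  simp only [genSeq_lt_runLength_toNat P hp, ← Nat.cast_sum] at h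
  have h1 : ∀ n : ℕ, n * (n - 1) = ∑ i ∈ Finset.range n, 2 * i := fun n => by
    rw [← Finset.sum_range_id_mul_two, mul_comm, Finset.mul_sum]
  simp_rw [h1]
  rw [h]
  have h2 := (hasSum_coe_mul_geometric_of_norm_lt_one (r := P.p)
    (by rwa [Real.norm_of_nonneg P.p_nonneg])).mul_left (2 * P.p)
  have h3 : ∀ j : ℕ, ((2 * j : ℕ) : ℝ≥0∞) * ENNReal.ofReal P.p ^ (j + 1) =
      ENNReal.ofReal (2 * P.p * (j * P.p ^ j)) := by
    intro j
    rw [← ENNReal.ofReal_pow P.p_nonneg, ← ENNReal.ofReal_natCast,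
      ← ENNReal.ofReal_mul (by positivity)]
    congr 1
    push_cast
    ring
  have := P.p_nonneg
  simp_rw [h3]
  rw [← ENNReal.ofReal_tsum_of_nonneg (fun n => by positivity) h2.summable, h2.tsum_eq]
  congr 1
  ring

end Geometric

/-! ### The gap between idle blocks. -/

section IdleGap

variable (P : Params)

/-- The gains and the generations of the busy periods that precede an idle block. -/
noncomputable def gapMeasure : ℕ ⊕ (ℕ × ((ℕ × ℕ) ⊕ ℕ)) → Measure ℝ :=
  Sum.elim (fun _ => genLaw P) fun q => busyMeasure P q.2

instance (i : ℕ ⊕ (ℕ × ((ℕ × ℕ) ⊕ ℕ))) : IsProbabilityMeasure (gapMeasure P i) := by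
  unfold gapMeasure; cases i <;> simp only [Sum.elim_inl, Sum.elim_inr] <;> infer_instance

/-- The number of blocks from an idle block (excluded) to the next one (included), in terms of the
generation trials and the lengths of the busy periods. -/
noncomputable def gapOf (q : (ℕ → ℝ) × (ℕ → ℕ∞)) : ℕ∞ := 1 + sumTo (runLength q.1) q.2

theorem measurable_gapOf : Measurable gapOf :=
  (measurable_of_countable fun n : ℕ∞ => 1 + n).comp
    (measurable_sumTo (measurable_runLength.comp measurable_fst)
      (f := fun i (q : (ℕ → ℝ) × (ℕ → ℕ∞)) => q.2 i)
      fun i => (measurable_pi_apply i).comp measurable_snd)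

/-- The number of blocks from an idle block (excluded) to the next one (included). -/
noncomputable def gap (x : ℕ ⊕ (ℕ × ((ℕ × ℕ) ⊕ ℕ)) → ℝ) : ℕ∞ :=
  gapOf (fun j => x (Sum.inl j), fun j => emptyTime (busyWork P fun b => x (Sum.inr (j, b))))

theorem measurable_gap : Measurable (gap P) := by
  refine measurable_gapOf.comp (Measurable.prodMk (by fun_prop) (measurable_pi_iff.2 fun j => ?_))
  exact (measurable_emptyTime_busyWork P).comp (by fun_prop)

/-- The law of the number of blocks between idle blocks. -/
noncomputable def gapLaw : Measure ℕ∞ := (Measure.infinitePi (gapMeasure P)).map (gap P)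

instance : IsProbabilityMeasure (gapLaw P) :=
  Measure.isProbabilityMeasure_map (measurable_gap P).aemeasurable

/-- Separates the trials, which determine the number of busy periods, from the busy periods
themselves: the gap becomes a random sum whose number of terms is independent of the terms. -/
theorem gapLaw_eq :
    gapLaw P = ((genSeq P).prod (Measure.infinitePi fun _ => busyLaw P)).map gapOf := by
  have h1 := map_split_infinitePi (gapMeasure P)
  have h2 := congrArg (fun m => m.map (Prod.map id
    fun (y : ℕ → ((ℕ × ℕ) ⊕ ℕ → ℝ)) j => emptyTime (busyWork P (y j)))) h1
  have mE : Measurable fun (y : ℕ → ((ℕ × ℕ) ⊕ ℕ → ℝ)) j => emptyTime (busyWork P (y j)) :=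
    measurable_pi_iff.2 fun j => (measurable_emptyTime_busyWork P).comp (measurable_pi_apply j)
  rw [Measure.map_map (measurable_id.prodMap mE) (by fun_prop),
    ← Measure.map_prod_map _ _ measurable_id mE, Measure.map_id,
    Measure.infinitePi_map_pi (X := fun _ : ℕ => (ℕ × ℕ) ⊕ ℕ → ℝ)
      (μ := fun k => Measure.infinitePi fun i => gapMeasure P (Sum.inr (k, i)))
      (f := fun _ y => emptyTime (busyWork P y))
      (fun _ => measurable_emptyTime_busyWork P)] at h2
  have h3 : (genSeq P).prod (Measure.infinitePi fun _ => busyLaw P) =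
    (Measure.infinitePi (gapMeasure P)).map (fun x => (fun j => x (Sum.inl j), fun j =>
      emptyTime (busyWork P fun b => x (Sum.inr (j, b))))) := h2.symm
  have m1 : Measurable fun x : ℕ ⊕ (ℕ × ((ℕ × ℕ) ⊕ ℕ)) → ℝ => (fun j => x (Sum.inl j), fun j =>
      emptyTime (busyWork P fun b => x (Sum.inr (j, b)))) :=
    Measurable.prodMk (by fun_prop) (measurable_pi_iff.2 fun j =>
      (measurable_emptyTime_busyWork P).comp (f := fun (x : ℕ ⊕ (ℕ × ((ℕ × ℕ) ⊕ ℕ)) → ℝ) b =>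
        x (Sum.inr (j, b))) (by fun_prop))
  rw [h3, Measure.map_map measurable_gapOf m1]
  rfl

/-- The mean of the gap between idle blocks, in the stable case. -/
noncomputable def Params.gapMean : ℝ := 1 + P.p / (1 - P.p) * P.busyMean

/-- The second moment of the gap between idle blocks, in the stable case. -/
noncomputable def Params.gapSq : ℝ :=
  1 + 2 * (P.p / (1 - P.p) * P.busyMean) +
    (P.p / (1 - P.p) * P.busySq + 2 * P.p ^ 2 / (1 - P.p) ^ 2 * P.busyMean ^ 2)

variable {P}

theorem Params.p_lt_one (h : P.p * (1 + P.theta) < 1) : P.p < 1 := by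
  have := P.theta_pos
  have := P.p_nonneg
  nlinarith

theorem Params.busyMean_nonneg (h : P.p * (1 + P.theta) < 1) : 0 ≤ P.busyMean := by
  have := P.theta_pos
  unfold Params.busyMean
  exact div_nonneg (by positivity) (by linarith)

theorem Params.busySq_nonneg (h : P.p * (1 + P.theta) < 1) : 0 ≤ P.busySq := by
  have h1 := P.theta_pos
  have h2 := P.p_nonneg
  have h3 := P.p_le_one
  have h4 := P.busyMean_nonneg h
  -- The variance of the work arriving in one block, written as mean conditional variance plus
  -- variance of the conditional mean, given whether a packet is generated.
  have h5 : 0 ≤ P.p * (P.theta ^ 2 + 3 * P.theta + 1) - (P.p * (1 + P.theta)) ^ 2 := by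
    have : P.p * (P.theta ^ 2 + 3 * P.theta + 1) - (P.p * (1 + P.theta)) ^ 2 =
        P.p * P.theta + P.p * (1 - P.p) * (1 + P.theta) ^ 2 := by ring
    rw [this]
    have : 0 ≤ 1 - P.p := by linarith
    positivity
  unfold Params.busySq
  positivity

section Stable

variable (h : P.p * (1 + P.theta) < 1)
include h

theorem ae_gapOf_eq : ∀ᵐ q ∂(genSeq P).prod (Measure.infinitePi fun _ => busyLaw P),
    (gapOf q : ℝ≥0∞) = 1 + ∑ j ∈ Finset.range (runLength q.1).toNat, (q.2 j : ℝ≥0∞) := by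
  have h1 := (measurePreserving_fst (μ := genSeq P)
    (ν := Measure.infinitePi fun _ : ℕ => busyLaw P)).quasiMeasurePreserving.ae
    (ae_runLength_ne_top P (Params.p_lt_one h))
  filter_upwards [h1] with q hq
  rw [gapOf]
  conv_lhs => rw [← ENat.natCast_toNat hq, sumTo_coe]
  rw [ENat.toENNReal_add, ENat.toENNReal_one]
  congr 1
  exact map_sum ENat.toENNRealRingHom _ _

theorem lintegral_gapSum :
    ∫⁻ q, ∑ j ∈ Finset.range (runLength q.1).toNat, (q.2 j : ℝ≥0∞)
      ∂(genSeq P).prod (Measure.infinitePi fun _ => busyLaw P) =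
      ENNReal.ofReal (P.p / (1 - P.p)) * ENNReal.ofReal P.busyMean ∧
    ∫⁻ q, (∑ j ∈ Finset.range (runLength q.1).toNat, (q.2 j : ℝ≥0∞)) ^ 2
      ∂(genSeq P).prod (Measure.infinitePi fun _ => busyLaw P) =
      ENNReal.ofReal (P.p / (1 - P.p)) * ENNReal.ofReal P.busySq +
        ENNReal.ofReal (2 * P.p ^ 2 / (1 - P.p) ^ 2) * ENNReal.ofReal P.busyMean ^ 2 := by
  have mc : Measurable fun n : ℕ∞ => (n : ℝ≥0∞) := measurable_of_countable _
  have hW : Measurable fun q : (ℕ → ℝ) × (ℕ → ℕ∞) => (runLength q.1).toNat :=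
    measurable_runLength_toNat.comp measurable_fst
  have hZ : ∀ i, Measurable fun q : (ℕ → ℝ) × (ℕ → ℕ∞) => (q.2 i : ℝ≥0∞) := fun i =>
    mc.comp ((measurable_pi_apply i).comp measurable_snd)
  have hcoord : ∀ (f : ℕ∞ → ℝ≥0∞) i, ∫⁻ q, f (q.2 i)
      ∂(genSeq P).prod (Measure.infinitePi fun _ : ℕ => busyLaw P) = ∫⁻ n, f n ∂busyLaw P := by
    intro f i
    rw [lintegral_prod_snd (genSeq P) _ (f := fun y : ℕ → ℕ∞ => f (y i))
      ((measurable_of_countable f).comp (measurable_pi_apply i))]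
    exact (measurePreserving_eval_infinitePi (fun _ : ℕ => busyLaw P) i).lintegral_comp
      (measurable_of_countable f)
  have ha := fun i => (hcoord (fun n => n) i).trans (lintegral_busyLaw_id P h)
  have hb := fun i => (hcoord (fun n => (n : ℝ≥0∞) ^ 2) i).trans (lintegral_busyLaw_sq P h)
  have hind : IndepFun (fun q : (ℕ → ℝ) × (ℕ → ℕ∞) => (runLength q.1).toNat)
      (fun q i => (q.2 i : ℝ≥0∞))
      ((genSeq P).prod (Measure.infinitePi fun _ : ℕ => busyLaw P)) :=
    indepFun_prod (X := fun s => (runLength s).toNat) (Y := fun (y : ℕ → ℕ∞) i => (y i : ℝ≥0∞))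
      measurable_runLength_toNat (measurable_pi_iff.2 fun i => mc.comp (measurable_pi_apply i))
  have hpair : Pairwise fun i j => IndepFun (fun q : (ℕ → ℝ) × (ℕ → ℕ∞) => (q.2 i : ℝ≥0∞))
      (fun q => (q.2 j : ℝ≥0∞)) ((genSeq P).prod (Measure.infinitePi fun _ : ℕ => busyLaw P)) := by
    intro i j hij
    exact indepFun_comp_measurePreserving (f := fun y : ℕ → ℕ∞ => (y i : ℝ≥0∞))
      (g := fun y : ℕ → ℕ∞ => (y j : ℝ≥0∞))
      ((iIndepFun_infinitePi (P := fun _ : ℕ => busyLaw P) (X := fun _ n => (n : ℝ≥0∞))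
        fun _ => mc).indepFun hij) (mc.comp (measurable_pi_apply i))
      (mc.comp (measurable_pi_apply j)) measurePreserving_snd
  have hp := Params.p_lt_one h
  have e1 := lintegral_prod_fst (genSeq P) (Measure.infinitePi fun _ : ℕ => busyLaw P)
    (f := fun s => ((runLength s).toNat : ℝ≥0∞))
    ((measurable_of_countable _).comp measurable_runLength_toNat)
  have e2 := lintegral_prod_fst (genSeq P) (Measure.infinitePi fun _ : ℕ => busyLaw P)
    (f := fun s => (((runLength s).toNat * ((runLength s).toNat - 1) : ℕ) : ℝ≥0∞))
    ((measurable_of_countable (fun n : ℕ => ((n * (n - 1) : ℕ) : ℝ≥0∞))).comp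
      measurable_runLength_toNat)
  rw [lintegral_runLength P hp] at e1
  rw [lintegral_runLength_mul_pred P hp] at e2
  constructor
  · rw [← e1]
    exact lintegral_randomSum hW hZ ha hind
  · rw [← e1, ← e2]
    exact lintegral_randomSum_sq hW hZ ha hb hpair hind

theorem lintegral_gapLaw_id : ∫⁻ n, (n : ℝ≥0∞) ∂gapLaw P = ENNReal.ofReal P.gapMean := by
  have hp := Params.p_lt_one h
  have hb := P.busyMean_nonneg h
  have h0 := P.p_nonneg
  have h1 : 0 ≤ P.p / (1 - P.p) := div_nonneg h0 (by linarith)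
  rw [gapLaw_eq, lintegral_map (measurable_of_countable _) measurable_gapOf,
    lintegral_congr_ae (ae_gapOf_eq h), lintegral_add_left measurable_const,
    (lintegral_gapSum h).1, Params.gapMean, ENNReal.ofReal_add (by norm_num) (by positivity),
    ENNReal.ofReal_mul h1]
  simp

theorem lintegral_gapLaw_sq : ∫⁻ n, (n : ℝ≥0∞) ^ 2 ∂gapLaw P = ENNReal.ofReal P.gapSq := by
  have hp := Params.p_lt_one h
  have hb := P.busyMean_nonneg h
  have hb2 := P.busySq_nonneg h
  have h0 := P.p_nonneg
  have h1 : 0 ≤ P.p / (1 - P.p) := div_nonneg h0 (by linarith)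
  have hm : Measurable fun q : (ℕ → ℝ) × (ℕ → ℕ∞) =>
      ∑ j ∈ Finset.range (runLength q.1).toNat, (q.2 j : ℝ≥0∞) :=
    measurable_comp_index (measurable_runLength_toNat.comp measurable_fst)
      (f := fun n (q : (ℕ → ℝ) × (ℕ → ℕ∞)) => ∑ j ∈ Finset.range n, (q.2 j : ℝ≥0∞)) fun n =>
      Finset.measurable_sum _ fun i _ => (measurable_of_countable (fun n : ℕ∞ => (n : ℝ≥0∞))).comp
        ((measurable_pi_apply i).comp measurable_snd)
  have e : ∀ x : ℝ≥0∞, (1 + x) ^ 2 = 1 + 2 * x + x ^ 2 := fun x => by ring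
  rw [gapLaw_eq, lintegral_map (f := fun n : ℕ∞ => (n : ℝ≥0∞) ^ 2) (measurable_of_countable _)
      measurable_gapOf,
    lintegral_congr_ae ((ae_gapOf_eq h).mono fun q hq => by rw [hq, e]),
    lintegral_add_left (by fun_prop), lintegral_add_left measurable_const,
    lintegral_const_mul _ hm, (lintegral_gapSum h).1, (lintegral_gapSum h).2, Params.gapSq,
    ENNReal.ofReal_add (by positivity) (by positivity), ENNReal.ofReal_add (by norm_num)
    (by positivity), ENNReal.ofReal_add (by positivity) (by positivity),
    ENNReal.ofReal_mul (by norm_num), ENNReal.ofReal_mul h1, ENNReal.ofReal_mul h1,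
    ENNReal.ofReal_mul (by positivity), ENNReal.ofReal_pow hb]
  simp

end Stable

/-- With probability p > 0 the gap contains a first busy period, which is independent of that event
and has infinite mean. The argument covers p = 1, where the gap may itself be infinite. -/
theorem lintegral_gapLaw_eq_top (h : 1 ≤ P.p * (1 + P.theta)) :
    ∫⁻ n, (n : ℝ≥0∞) ∂gapLaw P = ∞ := by
  have mc : Measurable fun n : ℕ∞ => (n : ℝ≥0∞) := measurable_of_countable _
  have hp : 0 < P.p := by
    rcases P.p_nonneg.lt_or_eq with h1 | h1
    · exact h1
    · rw [← h1] at h; norm_num at h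
  have mI : Measurable fun s : ℕ → ℝ => ({1} : Set ℝ).indicator (fun _ => (1 : ℝ≥0∞)) (s 0) :=
    (measurable_const.indicator (measurableSet_singleton 1)).comp (measurable_pi_apply _)
  have h1 : ∫⁻ s : ℕ → ℝ, ({1} : Set ℝ).indicator (fun _ => (1 : ℝ≥0∞)) (s 0) ∂genSeq P =
      ENNReal.ofReal P.p := by
    have h4 := (measurePreserving_eval_infinitePi (fun _ : ℕ => genLaw P) 0).lintegral_comp
      (f := ({1} : Set ℝ).indicator (fun _ => (1 : ℝ≥0∞)))
      (measurable_const.indicator (measurableSet_singleton 1))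
    refine h4.trans ?_
    rw [lintegral_indicator_const (measurableSet_singleton 1), one_mul]
    exact genLaw_singleton_one P
  have h2 : ∫⁻ y : ℕ → ℕ∞, (y 0 : ℝ≥0∞) ∂Measure.infinitePi (fun _ => busyLaw P) = ∞ := by
    rw [← lintegral_busyLaw_eq_top P h]
    exact (measurePreserving_eval_infinitePi (fun _ : ℕ => busyLaw P) 0).lintegral_comp mc
  have h3 : ∫⁻ q, ({1} : Set ℝ).indicator (fun _ => (1 : ℝ≥0∞)) (q.1 0) * (q.2 0 : ℝ≥0∞)
      ∂(genSeq P).prod (Measure.infinitePi fun _ : ℕ => busyLaw P) = ∞ := by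
    rw [lintegral_prod_mul mI.aemeasurable
      (g := fun y : ℕ → ℕ∞ => (y 0 : ℝ≥0∞)) (mc.comp (measurable_pi_apply 0)).aemeasurable, h1, h2]
    exact ENNReal.mul_top (by simpa using hp)
  rw [gapLaw_eq, lintegral_map mc measurable_gapOf, ← top_le_iff, ← h3]
  refine lintegral_mono fun q => ?_
  by_cases hq : q.1 0 = 1
  · rw [Set.indicator_of_mem (by simpa using hq), one_mul]
    refine ENat.toENNReal_le.2 ?_
    have h5 : ((1 : ℕ) : ℕ∞) ≤ runLength q.1 := by
      have : ((0 : ℕ) : ℕ∞) < runLength q.1 := by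
        rw [runLength, lt_firstTime_iff]
        intro i hi
        rw [Nat.le_zero.1 hi]
        simpa using hq
      exact_mod_cast Order.add_one_le_of_lt this
    calc q.2 0 = ∑ i ∈ Finset.range 1, q.2 i := by simp
      _ ≤ sumTo (runLength q.1) q.2 := sum_le_sumTo h5 _
      _ ≤ gapOf q := le_add_self
  · rw [Set.indicator_of_notMem (by simpa using hq), zero_mul]
    exact zero_le

end IdleGap

/-! ### The uplink as a refreshing transition from packet to packet. -/

section Packets

theorem lintegral_mul_pred {Ω : Type*} [MeasurableSpace Ω] {μ : Measure Ω} {N : Ω → ℕ}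
    (hN : Measurable N) {a b : ℝ} (ha : 0 ≤ a) (h1 : ∫⁻ ω, (N ω : ℝ≥0∞) ∂μ = ENNReal.ofReal a)
    (h2 : ∫⁻ ω, (N ω : ℝ≥0∞) ^ 2 ∂μ = ENNReal.ofReal b) :
    ∫⁻ ω, ((N ω * (N ω - 1) : ℕ) : ℝ≥0∞) ∂μ = ENNReal.ofReal (b - a) := by
  have e : ∀ n : ℕ, (n : ℝ≥0∞) ^ 2 = n + ((n * (n - 1) : ℕ) : ℝ≥0∞) := by
    intro n
    have : n ^ 2 = n + n * (n - 1) := by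
      rcases n with _ | n
      · rfl
      · simp only [Nat.add_sub_cancel]; ring
    exact_mod_cast this
  simp_rw [e] at h2
  rw [lintegral_add_left (by fun_prop), h1] at h2
  rw [ENNReal.ofReal_sub _ ha, ← h2, ENNReal.add_sub_cancel_left ENNReal.ofReal_ne_top]

variable (P : Params)

/-- The gains and the generations that concern an uplink packet. -/
noncomputable def packMeasure : ℕ ⊕ (ℕ × (ℕ ⊕ (ℕ × ((ℕ × ℕ) ⊕ ℕ)))) → Measure ℝ :=
  Sum.elim (fun _ => expMeasure P.lam) fun q => gapMeasure P q.2

instance (i : ℕ ⊕ (ℕ × (ℕ ⊕ (ℕ × ((ℕ × ℕ) ⊕ ℕ))))) : IsProbabilityMeasure (packMeasure P i) := by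
  unfold packMeasure; cases i <;> simp only [Sum.elim_inl, Sum.elim_inr] <;> infer_instance

/-- The gaps between the idle blocks and the number of transmissions of an uplink packet. -/
noncomputable def packet (x : ℕ ⊕ (ℕ × (ℕ ⊕ (ℕ × ((ℕ × ℕ) ⊕ ℕ)))) → ℝ) : (ℕ → ℕ∞) × ℕ :=
  (fun i => gap P fun z => x (Sum.inr (i, z)), serviceTime P fun i => x (Sum.inl i))

theorem measurable_packet : Measurable (packet P) :=
  Measurable.prodMk (measurable_pi_iff.2 fun i => (measurable_gap P).comp (by fun_prop))
    ((measurable_serviceTime P).comp (by fun_prop))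

/-- The law of the gaps between idle blocks. -/
noncomputable def gapSeq : Measure (ℕ → ℕ∞) := Measure.infinitePi fun _ => gapLaw P

instance : IsProbabilityMeasure (gapSeq P) := by unfold gapSeq; infer_instance

theorem map_packet :
    (Measure.infinitePi (packMeasure P)).map (packet P) = (gapSeq P).prod (serviceLaw P) := by
  have h1 := map_split_infinitePi (packMeasure P)
  have mE : Measurable fun (y : ℕ → (ℕ ⊕ (ℕ × ((ℕ × ℕ) ⊕ ℕ)) → ℝ)) j => gap P (y j) :=
    measurable_pi_iff.2 fun j => (measurable_gap P).comp (measurable_pi_apply j)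
  have h2 := congrArg (fun m => m.map (Prod.map (serviceTime P)
    fun (y : ℕ → (ℕ ⊕ (ℕ × ((ℕ × ℕ) ⊕ ℕ)) → ℝ)) j => gap P (y j))) h1
  rw [Measure.map_map ((measurable_serviceTime P).prodMap mE) (by fun_prop),
    ← Measure.map_prod_map _ _ (measurable_serviceTime P) mE,
    Measure.infinitePi_map_pi (X := fun _ : ℕ => ℕ ⊕ (ℕ × ((ℕ × ℕ) ⊕ ℕ)) → ℝ)
      (μ := fun k => Measure.infinitePi fun i => packMeasure P (Sum.inr (k, i)))
      (f := fun _ y => gap P y) (fun _ => measurable_gap P)] at h2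
  have h3 : (Measure.infinitePi (packMeasure P)).map
      (fun x => (serviceTime P fun i => x (Sum.inl i),
        fun i => gap P fun z => x (Sum.inr (i, z)))) = (serviceLaw P).prod (gapSeq P) := h2
  have m3 : Measurable fun x : ℕ ⊕ (ℕ × (ℕ ⊕ (ℕ × ((ℕ × ℕ) ⊕ ℕ)))) → ℝ =>
      (serviceTime P fun i => x (Sum.inl i), fun i => gap P fun z => x (Sum.inr (i, z))) :=
    (measurable_snd.prodMk measurable_fst).comp (measurable_packet P)
  rw [← Measure.prod_swap, ← h3, Measure.map_map measurable_swap m3]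
  rfl

/-- The law of the gaps between idle blocks and the number of transmissions of a packet. -/
noncomputable def packLaw : Measure ((ℕ → ℕ∞) × ℕ) := (gapSeq P).prod (serviceLaw P)

instance : IsProbabilityMeasure (packLaw P) := by unfold packLaw; infer_instance

/-- All gains and generations of the model. -/
noncomputable def allMeasure :
    ℕ ⊕ (ℕ × (ℕ ⊕ (ℕ × (ℕ ⊕ (ℕ × ((ℕ × ℕ) ⊕ ℕ)))))) → Measure ℝ :=
  Sum.elim (fun _ => expMeasure P.lam) fun q => packMeasure P q.2

instance (i : ℕ ⊕ (ℕ × (ℕ ⊕ (ℕ × (ℕ ⊕ (ℕ × ((ℕ × ℕ) ⊕ ℕ))))))) :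
    IsProbabilityMeasure (allMeasure P i) := by
  unfold allMeasure; cases i <;> simp only [Sum.elim_inl, Sum.elim_inr] <;> infer_instance

/-- The law of the harvesting gains and of the packets. -/
noncomputable def stateLaw : Measure ((ℕ → ℝ) × (ℕ → (ℕ → ℕ∞) × ℕ)) :=
  (expSeq P.lam).prod (Measure.infinitePi fun _ => packLaw P)

instance : IsProbabilityMeasure (stateLaw P) := by unfold stateLaw; infer_instance

theorem map_all : (Measure.infinitePi (allMeasure P)).map
    (fun x => (fun m => x (Sum.inl m), fun k => packet P fun i => x (Sum.inr (k, i)))) =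
      stateLaw P := by
  have h1 := map_split_infinitePi (allMeasure P)
  have mE : Measurable fun (y : ℕ → (ℕ ⊕ (ℕ × (ℕ ⊕ (ℕ × ((ℕ × ℕ) ⊕ ℕ)))) → ℝ)) j =>
      packet P (y j) :=
    measurable_pi_iff.2 fun j => (measurable_packet P).comp (measurable_pi_apply j)
  have h2 := congrArg (fun m => m.map (Prod.map id
    fun (y : ℕ → (ℕ ⊕ (ℕ × (ℕ ⊕ (ℕ × ((ℕ × ℕ) ⊕ ℕ)))) → ℝ)) j => packet P (y j))) h1
  rw [Measure.map_map (measurable_id.prodMap mE) (by fun_prop),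
    ← Measure.map_prod_map _ _ measurable_id mE, Measure.map_id,
    Measure.infinitePi_map_pi (X := fun _ : ℕ => ℕ ⊕ (ℕ × (ℕ ⊕ (ℕ × ((ℕ × ℕ) ⊕ ℕ)))) → ℝ)
      (μ := fun k => Measure.infinitePi fun i => allMeasure P (Sum.inr (k, i)))
      (f := fun _ y => packet P y) (fun _ => measurable_packet P)] at h2
  have h4 : ∀ k : ℕ, (Measure.infinitePi fun i => allMeasure P (Sum.inr (k, i))).map (packet P) =
      packLaw P := fun k => map_packet P
  have h5 : (Measure.infinitePi fun k : ℕ =>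
      (Measure.infinitePi fun i => allMeasure P (Sum.inr (k, i))).map (packet P)) =
      Measure.infinitePi fun _ => packLaw P := by
    congr 1
    funext k
    exact h4 k
  rw [h5] at h2
  exact h2

/-- The system time of a packet whose first transmission finds the harvesting state `y`. -/
noncomputable def packetTime (t : ℝ) (u : (ℕ → ℕ∞) × ℕ) (y : ℕ → ℝ) : ℕ∞ :=
  ∑ i ∈ Finset.range (idleBlocks t u.2 y), u.1 i

theorem measurable_packetTime (t : ℝ) :
    Measurable fun q : ((ℕ → ℕ∞) × ℕ) × (ℕ → ℝ) => packetTime t q.1 q.2 := by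
  have h1 : Measurable fun q : ((ℕ → ℕ∞) × ℕ) × (ℕ → ℝ) => idleBlocks t q.1.2 q.2 :=
    measurable_comp_index (measurable_snd.comp measurable_fst)
      (f := fun n (q : ((ℕ → ℕ∞) × ℕ) × (ℕ → ℝ)) => idleBlocks t n q.2) fun n =>
        (measurable_idleBlocks t n).comp measurable_snd
  exact measurable_comp_index h1
    (f := fun n (q : ((ℕ → ℕ∞) × ℕ) × (ℕ → ℝ)) => ∑ i ∈ Finset.range n, q.1.1 i) fun n =>
      measurable_enat_sum (f := fun i (q : ((ℕ → ℕ∞) × ℕ) × (ℕ → ℝ)) => q.1.1 i)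
        (fun i => (measurable_pi_apply i).comp (measurable_fst.comp measurable_fst)) n

theorem measurable_packetShift (t : ℝ) :
    Measurable fun q : ((ℕ → ℕ∞) × ℕ) × (ℕ → ℝ) => (passShift t)^[q.1.2] q.2 :=
  measurable_comp_index (measurable_snd.comp measurable_fst)
    (f := fun n (q : ((ℕ → ℕ∞) × ℕ) × (ℕ → ℝ)) => (passShift t)^[n] q.2) fun n =>
      ((measurable_passShift t).iterate n).comp measurable_snd

/-- The system time of the first packet. -/
noncomputable def firstTimeOf (t : ℝ) (s : (ℕ → ℝ) × (ℕ → (ℕ → ℕ∞) × ℕ)) : ℕ∞ :=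
  packetTime t (s.2 0) s.1

/-- The state after the first packet. -/
noncomputable def nextState (t : ℝ) (s : (ℕ → ℝ) × (ℕ → (ℕ → ℕ∞) × ℕ)) :
    (ℕ → ℝ) × (ℕ → (ℕ → ℕ∞) × ℕ) :=
  ((passShift t)^[(s.2 0).2] s.1, fun k => s.2 (k + 1))

theorem measurable_head_state :
    Measurable fun s : (ℕ → ℝ) × (ℕ → (ℕ → ℕ∞) × ℕ) => (s.2 0, s.1) := by
  have h : Measurable fun s : (ℕ → ℝ) × (ℕ → (ℕ → ℕ∞) × ℕ) => s.2 0 :=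
    (measurable_pi_apply 0).comp measurable_snd
  exact h.prodMk measurable_fst

theorem measurable_firstTimeOf (t : ℝ) : Measurable (firstTimeOf t) := by
  have h := (measurable_packetTime t).comp measurable_head_state
  have e : firstTimeOf t = (fun q : ((ℕ → ℕ∞) × ℕ) × (ℕ → ℝ) => packetTime t q.1 q.2) ∘
      fun s : (ℕ → ℝ) × (ℕ → (ℕ → ℕ∞) × ℕ) => (s.2 0, s.1) := by
    funext s
    simp only [firstTimeOf, Function.comp_apply]
  rw [e]
  exact h

theorem measurable_nextState (t : ℝ) : Measurable (nextState t) := by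
  have h1 : Measurable fun s : (ℕ → ℝ) × (ℕ → (ℕ → ℕ∞) × ℕ) => (passShift t)^[(s.2 0).2] s.1 :=
    Measurable.comp (g := fun q : ((ℕ → ℕ∞) × ℕ) × (ℕ → ℝ) => (passShift t)^[q.1.2] q.2)
      (measurable_packetShift t) measurable_head_state
  have h2 : Measurable fun (s : (ℕ → ℝ) × (ℕ → (ℕ → ℕ∞) × ℕ)) k => s.2 (k + 1) :=
    measurable_pi_lambda _ fun k => (measurable_pi_apply (k + 1)).comp measurable_snd
  exact h1.prodMk h2

theorem Refresh.of_map_eq {X 𝒪 : Type*} [MeasurableSpace X] [MeasurableSpace 𝒪] {m : Measure X}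
    [IsProbabilityMeasure m] {O : X → 𝒪} {N : X → X} (hO : Measurable O) (hN : Measurable N)
    {κ : Measure 𝒪} [IsProbabilityMeasure κ]
    (h : m.map (fun x => (O x, N x)) = κ.prod m) : Refresh m O N ∧ m.map O = κ := by
  have h1 : m.map O = κ := by
    have h2 := congrArg (fun q => q.map Prod.fst) h
    rw [Measure.map_map measurable_fst (hO.prodMk hN)] at h2
    exact h2.trans (by simp)
  exact ⟨⟨hO, hN, by rw [h1, h]⟩, h1⟩

/-- The law of the system time of a packet. -/
noncomputable def timeLaw (t : ℝ) : Measure ℕ∞ :=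
  ((packLaw P).prod (expSeq P.lam)).map fun q => packetTime t q.1 q.2

instance (t : ℝ) : IsProbabilityMeasure (timeLaw P t) :=
  Measure.isProbabilityMeasure_map (measurable_packetTime t).aemeasurable

/-- For a fixed packet, its system time is a function of its number of idle blocks, which is
independent of the new harvesting state. Mixing over the packet by `Refresh.param` keeps this, and
the later packets are an independent factor that is only shifted. -/
theorem refresh_nextState_and_map {t : ℝ} (ht : 0 ≤ t) :
    Refresh (stateLaw P) (firstTimeOf t) (nextState t) ∧
      (stateLaw P).map (firstTimeOf t) = timeLaw P t := by
  refine Refresh.of_map_eq (measurable_firstTimeOf t) (measurable_nextState t) ?_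
  have h1 : ((packLaw P).prod (expSeq P.lam)).map
      (fun q => (packetTime t q.1 q.2, (passShift t)^[q.1.2] q.2)) =
      (timeLaw P t).prod (expSeq P.lam) :=
    Refresh.param (O := packetTime t) (N := fun u y => (passShift t)^[u.2] y)
      (measurable_packetTime t) (measurable_packetShift t) (Eventually.of_forall fun u =>
        (refresh_idleBlocks (lam := P.lam) ht u.2).map_out
          (f := fun n => ∑ i ∈ Finset.range n, u.1 i) (measurable_of_countable _))
  have mht : Measurable fun y : ℕ → (ℕ → ℕ∞) × ℕ => (y 0, fun n => y (n + 1)) :=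
    (measurable_pi_apply 0).prodMk (measurable_pi_lambda _ fun k => measurable_pi_apply (k + 1))
  have h2 : (stateLaw P).map (fun s => (s.1, (s.2 0, fun n => s.2 (n + 1)))) =
      (expSeq P.lam).prod ((packLaw P).prod (Measure.infinitePi fun _ => packLaw P)) := by
    rw [← map_head_tail_infinitePi, ← Measure.map_id (μ := expSeq P.lam),
      Measure.map_prod_map _ _ measurable_id mht]
    rfl
  -- The first packet is moved next to the harvesting sequence; `g` below performs the transition on
  -- that pair and leaves the later packets alone.
  let f : (ℕ → ℝ) × (((ℕ → ℕ∞) × ℕ) × (ℕ → (ℕ → ℕ∞) × ℕ)) →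
      (((ℕ → ℕ∞) × ℕ) × (ℕ → ℝ)) × (ℕ → (ℕ → ℕ∞) × ℕ) := fun q => ((q.2.1, q.1), q.2.2)
  have mf : Measurable f := by fun_prop
  have h3 : ((expSeq P.lam).prod ((packLaw P).prod (Measure.infinitePi fun _ => packLaw P))).map f =
      ((packLaw P).prod (expSeq P.lam)).prod (Measure.infinitePi fun _ => packLaw P) := by
    rw [← Measure.prodAssoc_prod, Measure.map_map mf (by fun_prop),
      ← Measure.prod_swap (μ := expSeq P.lam) (ν := packLaw P),
      ← Measure.map_id (μ := Measure.infinitePi fun _ : ℕ => packLaw P),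
      Measure.map_prod_map _ _ measurable_swap measurable_id, Measure.map_id]
    rfl
  let g : ((((ℕ → ℕ∞) × ℕ) × (ℕ → ℝ)) × (ℕ → (ℕ → ℕ∞) × ℕ)) →
      (ℕ∞ × (ℕ → ℝ)) × (ℕ → (ℕ → ℕ∞) × ℕ) :=
    Prod.map (fun q => (packetTime t q.1 q.2, (passShift t)^[q.1.2] q.2)) id
  have mg0 : Measurable fun q : ((ℕ → ℕ∞) × ℕ) × (ℕ → ℝ) =>
      (packetTime t q.1 q.2, (passShift t)^[q.1.2] q.2) :=
    (measurable_packetTime t).prodMk (measurable_packetShift t)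
  have mg : Measurable g := mg0.prodMap measurable_id
  have h4 : (((packLaw P).prod (expSeq P.lam)).prod (Measure.infinitePi fun _ => packLaw P)).map g =
      ((timeLaw P t).prod (expSeq P.lam)).prod (Measure.infinitePi fun _ => packLaw P) := by
    rw [← Measure.map_prod_map _ _ mg0 measurable_id, h1, Measure.map_id]
  have ms : Measurable fun s : (ℕ → ℝ) × (ℕ → (ℕ → ℕ∞) × ℕ) =>
      (s.1, (s.2 0, fun n => s.2 (n + 1))) := measurable_fst.prodMk (mht.comp measurable_snd)
  rw [stateLaw, ← Measure.prodAssoc_prod, ← h4, ← h3, ← h2, Measure.map_map mf ms,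
    Measure.map_map mg (mf.comp ms),
    Measure.map_map (MeasurableEquiv.measurable _) (mg.comp (mf.comp ms))]
  rfl

theorem refresh_nextState {t : ℝ} (ht : 0 ≤ t) :
    Refresh (stateLaw P) (firstTimeOf t) (nextState t) := (refresh_nextState_and_map P ht).1

theorem map_firstTimeOf {t : ℝ} (ht : 0 ≤ t) : (stateLaw P).map (firstTimeOf t) = timeLaw P t :=
  (refresh_nextState_and_map P ht).2

end Packets

/-! ### Moments of the system time. -/

section TimeMoments

variable (P : Params)

/-- The energy of a transmission in units of gain. -/
noncomputable def Params.cost : ℝ := 1 / P.eta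

theorem Params.cost_pos : 0 < P.cost := by
  have := P.eta_pos
  unfold Params.cost; positivity

/-- The ratio of the rate of the gains to the efficiency of the harvesting. -/
noncomputable def Params.ratio : ℝ := P.lam / P.eta

theorem Params.lam_mul_cost : P.lam * P.cost = P.ratio := by
  unfold Params.cost Params.ratio; ring

theorem Params.ratio_pos : 0 < P.ratio := div_pos P.lam_pos P.eta_pos

/-- The mean number of idle blocks of a transmission. -/
noncomputable def Params.idleMean : ℝ := P.ratio + Real.exp (-P.ratio)

theorem Params.idleMean_pos : 0 < P.idleMean := by
  have := P.ratio_pos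
  unfold Params.idleMean; positivity

/-- The second moment of the number of idle blocks of a packet. -/
noncomputable def Params.workSq : ℝ :=
  (1 + P.theta) * (P.ratio ^ 2 + P.ratio + Real.exp (-P.ratio)) +
    (P.theta ^ 2 + 2 * P.theta) * P.idleMean ^ 2

theorem lintegral_serviceLaw_mul_pred :
    ∫⁻ n, ((n * (n - 1) : ℕ) : ℝ≥0∞) ∂serviceLaw P = ENNReal.ofReal (P.theta ^ 2 + 2 * P.theta) := by
  have := P.theta_pos
  have h := lintegral_mul_pred (μ := serviceLaw P) (N := fun n => n) measurable_id
    (a := 1 + P.theta) (by positivity) (lintegral_serviceLaw_id P) (lintegral_serviceLaw_sq P)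
  rw [h]
  congr 1
  ring

theorem lintegral_packet_idleBlocks :
    ∫⁻ q, (idleBlocks P.cost q.1 q.2 : ℝ≥0∞) ∂(serviceLaw P).prod (expSeq P.lam) =
      ENNReal.ofReal ((1 + P.theta) * P.idleMean) := by
  have := P.theta_pos
  have := P.ratio_pos
  rw [lintegral_idleBlocks P.cost_pos.le, lintegral_serviceLaw_id, P.lam_mul_cost,
    ← ENNReal.ofReal_add (by positivity) (by positivity), ← ENNReal.ofReal_mul (by positivity)]
  rfl

theorem lintegral_packet_idleBlocks_sq :
    ∫⁻ q, (idleBlocks P.cost q.1 q.2 : ℝ≥0∞) ^ 2 ∂(serviceLaw P).prod (expSeq P.lam) =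
      ENNReal.ofReal P.workSq := by
  have := P.theta_pos
  have := P.ratio_pos
  rw [lintegral_idleBlocks_sq P.cost_pos.le, lintegral_serviceLaw_id, P.lam_mul_cost,
    lintegral_serviceLaw_mul_pred,
    ← ENNReal.ofReal_pow (by positivity), ← ENNReal.ofReal_add (by positivity) (by positivity),
    ← ENNReal.ofReal_add (by positivity) (by positivity),
    ← ENNReal.ofReal_add (by positivity) (by positivity), ← ENNReal.ofReal_mul (by positivity),
    ← ENNReal.ofReal_pow (by positivity),
    ← ENNReal.ofReal_mul (by positivity), ← ENNReal.ofReal_add (by positivity) (by positivity)]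
  rfl

/-- The mean system time of a packet in the stable case. -/
noncomputable def Params.timeMean : ℝ := (1 + P.theta) * P.idleMean * P.gapMean

/-- The second moment of the system time of a packet in the stable case. -/
noncomputable def Params.timeSq : ℝ :=
  (1 + P.theta) * P.idleMean * P.gapSq +
    (P.workSq - (1 + P.theta) * P.idleMean) * P.gapMean ^ 2

/-- The left-hand difference is the factorial second moment of the number of idle blocks of a
packet. -/
theorem Params.le_workSq : 0 ≤ P.workSq - (1 + P.theta) * P.idleMean := by
  have h1 := P.theta_pos
  have h2 := P.idleMean_pos
  have h3 := P.ratio_pos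
  have h5 : P.workSq - (1 + P.theta) * P.idleMean = (1 + P.theta) * P.ratio ^ 2 +
      (P.theta ^ 2 + 2 * P.theta) * P.idleMean ^ 2 := by
    unfold Params.workSq Params.idleMean; ring
  rw [h5]; positivity

theorem Params.one_le_gapMean (h : P.p * (1 + P.theta) < 1) : 1 ≤ P.gapMean := by
  have := Params.p_lt_one h
  have := P.busyMean_nonneg h
  have : 0 ≤ P.p / (1 - P.p) := div_nonneg P.p_nonneg (by linarith)
  unfold Params.gapMean
  exact le_add_of_nonneg_right (by positivity)

theorem Params.gapSq_nonneg (h : P.p * (1 + P.theta) < 1) : 0 ≤ P.gapSq := by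
  have := Params.p_lt_one h
  have := P.busyMean_nonneg h
  have := P.busySq_nonneg h
  have := P.p_nonneg
  have : 0 ≤ P.p / (1 - P.p) := div_nonneg P.p_nonneg (by linarith)
  unfold Params.gapSq; positivity

theorem Params.timeMean_pos (h : P.p * (1 + P.theta) < 1) : 0 < P.timeMean := by
  have := P.theta_pos
  have := P.idleMean_pos
  have := P.one_le_gapMean h
  unfold Params.timeMean; positivity

theorem Params.timeSq_nonneg (h : P.p * (1 + P.theta) < 1) : 0 ≤ P.timeSq := by
  have := P.theta_pos
  have := P.idleMean_pos
  have := P.le_workSq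
  have := P.gapSq_nonneg h
  unfold Params.timeSq; positivity

/-- Regroups the product so that the gaps form one factor and the number of idle blocks depends on
the other; the random sum lemmas then apply. -/
theorem lintegral_timeLaw (f : ℕ∞ → ℝ≥0∞) :
    ∫⁻ n, f n ∂timeLaw P P.cost = ∫⁻ q : (ℕ → ℕ∞) × (ℕ × (ℕ → ℝ)),
      f (∑ i ∈ Finset.range (idleBlocks P.cost q.2.1 q.2.2), q.1 i)
        ∂(gapSeq P).prod ((serviceLaw P).prod (expSeq P.lam)) := by
  rw [timeLaw, lintegral_map (measurable_of_countable f) (measurable_packetTime _), packLaw]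
  have h := (measurePreserving_prodAssoc (gapSeq P) (serviceLaw P) (expSeq P.lam)).lintegral_comp_emb
    (MeasurableEquiv.measurableEmbedding _) (fun q : (ℕ → ℕ∞) × (ℕ × (ℕ → ℝ)) =>
      f (∑ i ∈ Finset.range (idleBlocks P.cost q.2.1 q.2.2), q.1 i))
  exact h

theorem coe_enat_sum (s : Finset ℕ) (f : ℕ → ℕ∞) :
    ((∑ i ∈ s, f i : ℕ∞) : ℝ≥0∞) = ∑ i ∈ s, (f i : ℝ≥0∞) :=
  map_sum ENat.toENNRealRingHom _ _

variable {P}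

section Stable

variable (h : P.p * (1 + P.theta) < 1)
include h

theorem lintegral_timeLaw_moments :
    ∫⁻ n, (n : ℝ≥0∞) ∂timeLaw P P.cost = ENNReal.ofReal P.timeMean ∧
      ∫⁻ n, (n : ℝ≥0∞) ^ 2 ∂timeLaw P P.cost = ENNReal.ofReal P.timeSq := by
  have mc : Measurable fun n : ℕ∞ => (n : ℝ≥0∞) := measurable_of_countable _
  have hW0 : Measurable fun q : ℕ × (ℕ → ℝ) => idleBlocks P.cost q.1 q.2 :=
    measurable_comp_index measurable_fst
      (f := fun n (q : ℕ × (ℕ → ℝ)) => idleBlocks P.cost n q.2) fun n =>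
        (measurable_idleBlocks P.cost n).comp measurable_snd
  set ρ := (gapSeq P).prod ((serviceLaw P).prod (expSeq P.lam)) with hρ
  have hW : Measurable fun q : (ℕ → ℕ∞) × (ℕ × (ℕ → ℝ)) => idleBlocks P.cost q.2.1 q.2.2 :=
    hW0.comp measurable_snd
  have hZ : ∀ i, Measurable fun q : (ℕ → ℕ∞) × (ℕ × (ℕ → ℝ)) => (q.1 i : ℝ≥0∞) := fun i =>
    mc.comp ((measurable_pi_apply i).comp measurable_fst)
  have hcoord : ∀ (f : ℕ∞ → ℝ≥0∞) i, ∫⁻ q, f (q.1 i) ∂ρ = ∫⁻ n, f n ∂gapLaw P := by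
    intro f i
    rw [hρ, lintegral_prod_fst (gapSeq P) _ (f := fun y : ℕ → ℕ∞ => f (y i))
      ((measurable_of_countable f).comp (measurable_pi_apply i))]
    exact (measurePreserving_eval_infinitePi (fun _ : ℕ => gapLaw P) i).lintegral_comp
      (measurable_of_countable f)
  have ha := fun i => (hcoord (fun n => n) i).trans (lintegral_gapLaw_id h)
  have hb := fun i => (hcoord (fun n => (n : ℝ≥0∞) ^ 2) i).trans (lintegral_gapLaw_sq h)
  have hind : IndepFun (fun q : (ℕ → ℕ∞) × (ℕ × (ℕ → ℝ)) => idleBlocks P.cost q.2.1 q.2.2)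
      (fun q i => (q.1 i : ℝ≥0∞)) ρ :=
    (indepFun_prod (X := fun (y : ℕ → ℕ∞) i => (y i : ℝ≥0∞))
      (Y := fun q : ℕ × (ℕ → ℝ) => idleBlocks P.cost q.1 q.2)
      (measurable_pi_iff.2 fun i => mc.comp (measurable_pi_apply i)) hW0).symm
  have hpair : Pairwise fun i j => IndepFun
      (fun q : (ℕ → ℕ∞) × (ℕ × (ℕ → ℝ)) => (q.1 i : ℝ≥0∞)) (fun q => (q.1 j : ℝ≥0∞)) ρ := by
    intro i j hij
    exact indepFun_comp_measurePreserving (f := fun y : ℕ → ℕ∞ => (y i : ℝ≥0∞))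
      (g := fun y : ℕ → ℕ∞ => (y j : ℝ≥0∞))
      ((iIndepFun_infinitePi (P := fun _ : ℕ => gapLaw P) (X := fun _ n => (n : ℝ≥0∞))
        fun _ => mc).indepFun hij) (mc.comp (measurable_pi_apply i))
      (mc.comp (measurable_pi_apply j)) measurePreserving_fst
  have h1 := P.theta_pos
  have h2 := P.idleMean_pos
  have hw1 : 0 ≤ (1 + P.theta) * P.idleMean := by positivity
  have e1 := lintegral_prod_snd (gapSeq P) ((serviceLaw P).prod (expSeq P.lam))
    (f := fun q => (idleBlocks P.cost q.1 q.2 : ℝ≥0∞)) ((measurable_of_countable _).comp hW0)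
  rw [lintegral_packet_idleBlocks] at e1
  have e2 := lintegral_prod_snd (gapSeq P) ((serviceLaw P).prod (expSeq P.lam))
    (f := fun q => ((idleBlocks P.cost q.1 q.2 * (idleBlocks P.cost q.1 q.2 - 1) : ℕ) : ℝ≥0∞))
    ((measurable_of_countable (fun n : ℕ => ((n * (n - 1) : ℕ) : ℝ≥0∞))).comp hW0)
  rw [lintegral_mul_pred hW0 hw1 (lintegral_packet_idleBlocks P)
    (lintegral_packet_idleBlocks_sq P)] at e2
  have hws := P.le_workSq
  have hgm : 0 ≤ P.gapMean := zero_le_one.trans (P.one_le_gapMean h)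
  have hgs := P.gapSq_nonneg h
  constructor
  · rw [lintegral_timeLaw P fun n => n]
    simp_rw [coe_enat_sum]
    rw [Params.timeMean, ENNReal.ofReal_mul hw1, ← e1]
    exact lintegral_randomSum hW hZ ha hind
  · rw [lintegral_timeLaw P fun n => (n : ℝ≥0∞) ^ 2]
    simp_rw [coe_enat_sum]
    rw [Params.timeSq, ENNReal.ofReal_add (by positivity) (by positivity), ENNReal.ofReal_mul hw1,
      ENNReal.ofReal_mul hws, ENNReal.ofReal_pow hgm, ← e1, ← e2]
    exact lintegral_randomSum_sq hW hZ ha hb hpair hind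

end Stable

/-- A packet uses at least one idle block, so its system time dominates the first gap. -/
theorem lintegral_timeLaw_eq_top (h : 1 ≤ P.p * (1 + P.theta)) :
    ∫⁻ n, (n : ℝ≥0∞) ∂timeLaw P P.cost = ∞ := by
  have mc : Measurable fun n : ℕ∞ => (n : ℝ≥0∞) := measurable_of_countable _
  have h1 : ∫⁻ q : (ℕ → ℕ∞) × (ℕ × (ℕ → ℝ)), (q.1 0 : ℝ≥0∞)
      ∂(gapSeq P).prod ((serviceLaw P).prod (expSeq P.lam)) = ∞ := by
    rw [lintegral_prod_fst (gapSeq P) _ (f := fun y : ℕ → ℕ∞ => (y 0 : ℝ≥0∞))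
      (mc.comp (measurable_pi_apply 0)), ← lintegral_gapLaw_eq_top h]
    exact (measurePreserving_eval_infinitePi (fun _ : ℕ => gapLaw P) 0).lintegral_comp mc
  have h2 : ∀ᵐ q ∂(gapSeq P).prod ((serviceLaw P).prod (expSeq P.lam)), 1 ≤ q.2.1 :=
    (measurePreserving_fst.comp measurePreserving_snd).quasiMeasurePreserving.ae
      (ae_serviceLaw_pos P)
  rw [lintegral_timeLaw P fun n => n, ← top_le_iff, ← h1]
  refine lintegral_mono_ae ?_
  filter_upwards [h2] with q hq
  refine ENat.toENNReal_le.2 ?_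
  have h3 : 1 ≤ idleBlocks P.cost q.2.1 q.2.2 := hq.trans (le_idleBlocks _ _ _)
  calc q.1 0 = ∑ i ∈ Finset.range 1, q.1 i := by simp
    _ ≤ _ := Finset.sum_le_sum_of_subset (Finset.range_mono h3)

end TimeMoments

/-! ### Pathwise identification of the model with the abstract transition. -/

section Pathwise

variable (P : Params)

/-- The stored energy `e` in units of gain. -/
noncomputable def Params.stored (e : ℝ) : ℝ := e / (P.eta * P.Pt * P.TB)

/-- Divide all energies by η Pt TB. The stored energy is the zeroth term, so `j` harvesting blocks
correspond to `j + 1` terms and no unit has to be added. The two sets coincide, so the equality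
holds on every path, default values included. -/
theorem harvestCount_eq (e : ℝ) (x : ℕ → ℝ) :
    harvestCount P e x = passTime P.cost (seqCons (P.stored e) x) := by
  unfold harvestCount passTime
  congr 1
  ext j
  have h1 := P.eta_pos; have h2 := P.Pt_pos; have h3 := P.TB_pos
  have h4 : e + ∑ i ∈ Finset.range j, blockEnergy P (x i) =
      (∑ i ∈ Finset.range (j + 1), seqCons (P.stored e) x i) * (P.eta * P.Pt * P.TB) := by
    rw [Finset.sum_range_succ', add_mul, Finset.sum_mul, add_comm]
    simp only [seqCons_succ, seqCons_zero, Params.stored]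
    congr 1
    · refine Finset.sum_congr rfl fun i _ => ?_
      unfold blockEnergy; ring
    · field_simp
  have h5 : P.Pt * P.TB = P.cost * (P.eta * P.Pt * P.TB) := by
    unfold Params.cost; field_simp
  simp only [Set.mem_ofPred_eq]
  rw [h4, h5]
  exact mul_le_mul_iff_left₀ (by positivity)

theorem passShift_seqCons (t a : ℝ) (x : ℕ → ℝ) :
    passShift t (seqCons a x) =
      seqCons (a + ∑ i ∈ Finset.range (passTime t (seqCons a x)), x i - t)
        fun n => x (passTime t (seqCons a x) + n) := by
  unfold passShift shiftAt
  congr 1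
  · rw [Finset.sum_range_succ']
    simp only [seqCons_succ, seqCons_zero]
    ring
  · funext n
    rw [show passTime t (seqCons a x) + 1 + n = passTime t (seqCons a x) + n + 1 by ring,
      seqCons_succ]

/-- The stored energy followed by the unused gains is an orbit of `passShift`: the overshoot is
exactly the energy left after paying for the transmission. -/
theorem seqCons_battery (e₀ : ℝ) (x : ℕ → ℝ) (r : ℕ) :
    seqCons (P.stored (battery P e₀ x r).2) (fun n => x ((battery P e₀ x r).1 + n)) =
      (passShift P.cost)^[r] (seqCons (P.stored e₀) x) := by
  induction r with
  | zero => simp [battery]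
  | succ r ih =>
    rw [Function.iterate_succ_apply', ← ih, passShift_seqCons, ← harvestCount_eq]
    simp only [battery]
    congr 1
    · have h1 := P.eta_pos; have h2 := P.Pt_pos; have h3 := P.TB_pos
      unfold Params.stored Params.cost blockEnergy
      simp only [mul_assoc, ← Finset.mul_sum, ← Finset.sum_mul]
      field_simp
    · funext n
      rw [add_assoc]

theorem tauH_eq (e₀ : ℝ) (x : ℕ → ℝ) (r : ℕ) :
    tauH P e₀ x r = passTime P.cost ((passShift P.cost)^[r] (seqCons (P.stored e₀) x)) := by
  rw [tauH, harvestCount_eq, seqCons_battery]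

theorem nextState_iterate (t : ℝ) (s : (ℕ → ℝ) × (ℕ → (ℕ → ℕ∞) × ℕ)) (k : ℕ) :
    (nextState t)^[k] s =
      ((passShift t)^[∑ i ∈ Finset.range k, (s.2 i).2] s.1, fun j => s.2 (j + k)) := by
  induction k with
  | zero => simp
  | succ k ih =>
    rw [Function.iterate_succ_apply', ih]
    simp only [nextState, zero_add]
    rw [← Function.iterate_add_apply, Finset.sum_range_succ, add_comm]
    congr 1
    funext j
    rw [add_right_comm, add_assoc]

/-- The gain or generation with the given index in the independent family. -/
def source : ℕ ⊕ (ℕ × (ℕ ⊕ (ℕ × (ℕ ⊕ (ℕ × ((ℕ × ℕ) ⊕ ℕ)))))) → Slot ⊕ Trial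
  | .inl m => .inl (.harvest m)
  | .inr (k, .inl i) => .inl (.up k i)
  | .inr (k, .inr (i, .inl j)) => .inr (.start k i j)
  | .inr (k, .inr (i, .inr (j, .inl (m, n)))) => .inl (.down k i j m n)
  | .inr (k, .inr (i, .inr (j, .inr m))) => .inr (.during k i j m)

theorem source_injective : Function.Injective source := by
  rintro (m | ⟨k, i | ⟨i, j | ⟨j, ⟨m, n⟩ | m⟩⟩⟩) (m' | ⟨k', i' | ⟨i', j' | ⟨j', ⟨m', n'⟩ | m'⟩⟩⟩) h <;>
    simp_all [source]

variable (g : Slot → ℝ) (a : Trial → Bool)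

/-- The gains and the indicators of the generations. -/
noncomputable def values : Slot ⊕ Trial → ℝ := Sum.elim g fun t => boolVal (a t)

/-- The harvesting gains and the packets of the model. -/
noncomputable def modelState : (ℕ → ℝ) × (ℕ → (ℕ → ℕ∞) × ℕ) :=
  (fun m => g (.harvest m), fun k => packet P fun i => values g a (source (.inr (k, i))))

theorem modelState_snd (k : ℕ) : ((modelState P g a).2 k).2 = upService P g k := rfl

theorem modelState_fst (k i : ℕ) :
    ((modelState P g a).2 k).1 i = 1 + sumTo (numBusy a k i) (busyLength P g a k i) := by
  have h1 : runLength (fun j => values g a (source (.inr (k, .inr (i, .inl j))))) =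
      numBusy a k i := by
    unfold runLength numBusy
    congr 1
    funext j
    simp only [values, source, Sum.elim_inr, ne_eq, boolVal_eq_one_iff, Bool.not_eq_true]
  have h2 : (fun j => emptyTime (busyWork P fun b =>
      values g a (source (.inr (k, .inr (i, .inr (j, b))))))) = busyLength P g a k i := by
    funext j
    rw [busyLength, busyPeriod_eq]
    congr 2
    funext b
    rcases b with ⟨m, n⟩ | m <;> rfl
  simp only [modelState, packet, gap, gapOf]
  rw [h1, h2]

/-- Each idle block contributes itself and the busy periods before it, that is, one gap; and the
transmissions of the earlier packets have advanced the harvesting state by the sum of their numbers.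
-/
theorem systemTime_eq (e₀ : ℝ) (k : ℕ) :
    systemTime P e₀ g a k = firstTimeOf P.cost ((nextState P.cost)^[k]
      (seqCons (P.stored e₀) (modelState P g a).1, (modelState P g a).2)) := by
  rw [nextState_iterate]
  have h : upServiceUL P e₀ g k = idleBlocks P.cost (upService P g k)
      ((passShift P.cost)^[∑ i ∈ Finset.range k, upService P g i]
        (seqCons (P.stored e₀) (modelState P g a).1)) := by
    unfold upServiceUL idleBlocks
    refine Finset.sum_congr rfl fun i _ => ?_
    rw [upBlocks, tauH_eq, ← Function.iterate_add_apply, add_comm i]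
    rfl
  simp only [firstTimeOf, packetTime, zero_add, modelState_snd, modelState_fst]
  rw [← h, systemTime, Finset.sum_add_distrib]
  simp

end Pathwise

/-! ### The law of the state, and how a deterministic initial energy is forgotten. -/

section Law

variable {Ω : Type*} [MeasurableSpace Ω] {μ : Measure Ω} [IsProbabilityMeasure μ] {P : Params}
  {γ : Slot → Ω → ℝ} {A : Trial → Ω → Bool}

theorem measurable_boolVal : Measurable boolVal := measurable_of_countable _

/-- Coding the generations as reals merges gains and generations into one real family, to which the
reindexing and block lemmas apply. A finite intersection splits into its gain part and its
generation part. -/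
theorem IsModel.iIndepFun_values (h : IsModel P μ γ A) :
    iIndepFun (fun i ω => values (fun s => γ s ω) (fun t => A t ω) i) μ := by
  classical
  rw [iIndepFun_iff_measure_inter_preimage_eq_mul]
  intro S sets hsets
  have h1 : (⋂ i ∈ S, (fun ω => values (fun s => γ s ω) (fun t => A t ω) i) ⁻¹' sets i) =
      (⋂ s ∈ S.toLeft, γ s ⁻¹' sets (.inl s)) ∩
        ⋂ t ∈ S.toRight, A t ⁻¹' (boolVal ⁻¹' sets (.inr t)) := by
    ext ω
    simp only [Set.mem_iInter, Set.mem_inter_iff, Set.mem_preimage, Sum.forall, Finset.mem_toLeft,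
      Finset.mem_toRight, values, Sum.elim_inl, Sum.elim_inr]
  have h2 := h.gain_gen_indep.measure_inter_preimage_eq_mul
    (⋂ s ∈ S.toLeft, (fun x => x s) ⁻¹' sets (.inl s))
    (⋂ t ∈ S.toRight, (fun x => x t) ⁻¹' (boolVal ⁻¹' sets (.inr t)))
    (Finset.measurableSet_biInter _ fun s hs =>
      measurable_pi_apply s (hsets _ (Finset.mem_toLeft.1 hs)))
    (Finset.measurableSet_biInter _ fun t ht =>
      measurable_pi_apply t (measurable_boolVal (hsets _ (Finset.mem_toRight.1 ht))))
  simp only [Set.preimage_iInter, ← Set.preimage_comp, Function.comp_def] at h2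
  have h3 := h.gain_indep.measure_inter_preimage_eq_mul S.toLeft
    (sets := fun s => sets (.inl s)) fun s hs => hsets _ (Finset.mem_toLeft.1 hs)
  have h4 := h.gen_indep.measure_inter_preimage_eq_mul S.toRight
    (sets := fun t => boolVal ⁻¹' sets (.inr t))
    fun t ht => measurable_boolVal (hsets _ (Finset.mem_toRight.1 ht))
  rw [h1]
  refine h2.trans ?_
  refine (congrArg₂ (· * ·) h3 h4).trans ?_
  conv_rhs => rw [← S.toLeft_disjSum_toRight, Finset.prod_disjSum]
  rfl

theorem IsModel.measurable_values (h : IsModel P μ γ A) (i : Slot ⊕ Trial) :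
    Measurable fun ω => values (fun s => γ s ω) (fun t => A t ω) i := by
  cases i with
  | inl s => exact h.measurable_gain s
  | inr t => exact measurable_boolVal.comp (h.measurable_gen t)

theorem IsModel.map_modelState (h : IsModel P μ γ A) :
    μ.map (fun ω => modelState P (fun s => γ s ω) fun t => A t ω) = stateLaw P := by
  have h1 := map_comp_embedding h.iIndepFun_values h.measurable_values source_injective
  have h2 : (fun i => μ.map fun ω => values (fun s => γ s ω) (fun t => A t ω) (source i)) =
      allMeasure P := by
    funext i
    rcases i with m | ⟨k, i | ⟨i, j | ⟨j, ⟨m, n⟩ | m⟩⟩⟩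
    · exact h.gain_law _
    · exact h.gain_law _
    · exact map_boolVal P μ (h.measurable_gen _) (h.gen_law _)
    · exact h.gain_law _
    · exact map_boolVal P μ (h.measurable_gen _) (h.gen_law _)
  rw [h2] at h1
  have mp : Measurable fun x : ℕ ⊕ (ℕ × (ℕ ⊕ (ℕ × (ℕ ⊕ (ℕ × ((ℕ × ℕ) ⊕ ℕ)))))) → ℝ =>
      (fun m => x (Sum.inl m), fun k => packet P fun i => x (Sum.inr (k, i))) :=
    Measurable.prodMk (by fun_prop) (measurable_pi_lambda _ fun k =>
      (measurable_packet P).comp (by fun_prop))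
  rw [← map_all, ← h1, Measure.map_map mp (measurable_pi_lambda _ fun i => h.measurable_values _)]
  rfl

theorem measurePreserving_shift (k : ℕ) :
    MeasurePreserving (fun (w : ℕ → (ℕ → ℕ∞) × ℕ) j => w (j + k))
      (Measure.infinitePi fun _ => packLaw P) (Measure.infinitePi fun _ => packLaw P) := by
  refine ⟨by fun_prop, ?_⟩
  have h := map_comp_embedding (μ := Measure.infinitePi fun _ : ℕ => packLaw P)
    (X := fun i (w : ℕ → (ℕ → ℕ∞) × ℕ) => w i)
    (iIndepFun_infinitePi (X := fun _ u => u) fun _ => measurable_id)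
    (fun i => measurable_pi_apply i) (add_left_injective k)
  refine h.trans ?_
  congr 1
  funext j
  exact (measurePreserving_eval_infinitePi (fun _ : ℕ => packLaw P) (j + k)).map_eq

theorem ae_packets : ∀ᵐ w ∂Measure.infinitePi fun _ : ℕ => packLaw P,
    ∀ k, 1 ≤ (w k).2 ∧ ∀ i, 1 ≤ (w k).1 i := by
  rw [ae_all_iff]
  intro k
  have h1 : ∀ᵐ u ∂packLaw P, 1 ≤ u.2 :=
    measurePreserving_snd.quasiMeasurePreserving.ae (ae_serviceLaw_pos P)
  have h2 : ∀ᵐ n ∂gapLaw P, 1 ≤ n := by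
    rw [gapLaw, ae_map_iff (measurable_gap P).aemeasurable
      (MeasurableSet.of_discrete (s := {n : ℕ∞ | 1 ≤ n}))]
    exact Eventually.of_forall fun x => le_self_add
  have h3 : ∀ᵐ u ∂packLaw P, ∀ i, 1 ≤ u.1 i := by
    refine (measurePreserving_fst (μ := gapSeq P) (ν := serviceLaw P)).quasiMeasurePreserving.ae
      (p := fun y => ∀ i, 1 ≤ y i) (ae_all_iff.2 fun i => ?_)
    exact (measurePreserving_eval_infinitePi (fun _ : ℕ => gapLaw P) i).quasiMeasurePreserving.ae h2
  exact (measurePreserving_eval_infinitePi (fun _ : ℕ => packLaw P) k).quasiMeasurePreserving.ae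
    (h1.and h3)

theorem ae_packets_ne_top (hs : P.p * (1 + P.theta) < 1) :
    ∀ᵐ w ∂Measure.infinitePi fun _ : ℕ => packLaw P, ∀ k i, (w k).1 i ≠ ⊤ := by
  rw [ae_all_iff]
  intro k
  have h2 : ∀ᵐ n ∂gapLaw P, n ≠ ⊤ := by
    have := ae_lt_top (μ := gapLaw P) (f := fun n : ℕ∞ => (n : ℝ≥0∞)) (measurable_of_countable _)
      (by rw [lintegral_gapLaw_id hs]; exact ENNReal.ofReal_ne_top)
    filter_upwards [this] with n hn
    rintro rfl
    simp at hn
  have h3 : ∀ᵐ u ∂packLaw P, ∀ i, u.1 i ≠ ⊤ := by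
    refine (measurePreserving_fst (μ := gapSeq P) (ν := serviceLaw P)).quasiMeasurePreserving.ae
      (p := fun y => ∀ i, y i ≠ ⊤) (ae_all_iff.2 fun i => ?_)
    exact (measurePreserving_eval_infinitePi (fun _ : ℕ => gapLaw P) i).quasiMeasurePreserving.ae h2
  exact (measurePreserving_eval_infinitePi (fun _ : ℕ => packLaw P) k).quasiMeasurePreserving.ae h3

theorem one_le_packetTime {t : ℝ} {u : (ℕ → ℕ∞) × ℕ} (h1 : 1 ≤ u.2) (h2 : ∀ i, 1 ≤ u.1 i)
    (y : ℕ → ℝ) : 1 ≤ packetTime t u y := by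
  have h3 : 1 ≤ idleBlocks t u.2 y := h1.trans (le_idleBlocks t u.2 y)
  unfold packetTime
  refine (h2 0).trans (Finset.single_le_sum (f := u.1) (fun _ _ => bot_le) ?_)
  simp; omega

theorem packetTime_ne_top {t : ℝ} {u : (ℕ → ℕ∞) × ℕ} (h : ∀ i, u.1 i ≠ ⊤) (y : ℕ → ℝ) :
    packetTime t u y ≠ ⊤ := by
  unfold packetTime
  exact WithTop.sum_ne_top.2 fun i _ => h i

/-- Fix all packets. The first `k` of them make n ≥ k transmissions, so e < n t and the initial
energy is used up. The harvesting state then has the stationary law whatever the packets are, so it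
is independent of those still to come. -/
theorem map_nextState_iterate_seqCons {t : ℝ} (ht : 0 < t) {e : ℝ} (he : 0 ≤ e) {k : ℕ}
    (hk : e < k * t) :
    (stateLaw P).map (fun s => (nextState t)^[k] (seqCons e s.1, s.2)) = stateLaw P := by
  set m := Measure.infinitePi fun _ : ℕ => packLaw P with hm
  have hN : ∀ᵐ w ∂m, k ≤ ∑ i ∈ Finset.range k, (w i).2 := by
    filter_upwards [ae_packets] with w hw
    calc k = ∑ i ∈ Finset.range k, 1 := by simp
      _ ≤ _ := Finset.sum_le_sum fun i _ => (hw i).1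
  have mΦ : Measurable fun s : (ℕ → ℝ) × (ℕ → (ℕ → ℕ∞) × ℕ) => (seqCons e s.1, s.2) := by
    have : Measurable fun s : (ℕ → ℝ) × (ℕ → (ℕ → ℕ∞) × ℕ) => seqCons e s.1 :=
      measurable_seqCons.comp (measurable_const.prodMk measurable_fst)
    exact this.prodMk measurable_snd
  have mF := ((measurable_nextState t).iterate k).comp mΦ
  refine (Measure.prod_eq fun C D hC hD => ?_).symm
  refine (Measure.map_apply mF (hC.prod hD)).trans ?_
  rw [stateLaw,
    Measure.prod_apply_symm (mF (hC.prod hD))]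
  -- For almost every fixed sequence of packets the section has the measure of `C` if the shifted
  -- packets lie in `D`, and measure zero otherwise.
  have h1 : ∀ᵐ w ∂m, expSeq P.lam ((fun y => (y, w)) ⁻¹' ((nextState t)^[k] ∘
      (fun s : (ℕ → ℝ) × (ℕ → (ℕ → ℕ∞) × ℕ) => (seqCons e s.1, s.2)) ⁻¹' C ×ˢ D)) =
      Set.indicator ((fun (w : ℕ → (ℕ → ℕ∞) × ℕ) j => w (j + k)) ⁻¹' D)
        (fun _ => expSeq P.lam C) w := by
    filter_upwards [hN] with w hw
    set n := ∑ i ∈ Finset.range k, (w i).2 with hn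
    have h2 := map_iterate_passShift_seqCons (lam := P.lam) ht n he
      (hk.trans_le (mul_le_mul_of_nonneg_right (by exact_mod_cast hw) ht.le))
    by_cases hw' : (fun j => w (j + k)) ∈ D
    · rw [Set.indicator_of_mem (by exact hw')]
      have m2 : Measurable fun x : ℕ → ℝ => (passShift t)^[n] (seqCons e x) :=
        ((measurable_passShift t).iterate n).comp
          (measurable_seqCons.comp (measurable_const.prodMk measurable_id))
      conv_rhs => rw [← h2, Measure.map_apply m2 hC]
      congr 1
      ext y
      simp only [Set.mem_preimage, Function.comp_apply, nextState_iterate, Set.mem_prod, hw',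
        and_true, hn]
    · rw [Set.indicator_of_notMem (by exact hw')]
      convert measure_empty (μ := expSeq P.lam)
      ext y
      simp only [Set.mem_preimage, Function.comp_apply, nextState_iterate, Set.mem_prod, hw',
        and_false, Set.mem_empty_iff_false]
  rw [lintegral_congr_ae h1, lintegral_indicator_const ((measurePreserving_shift (P := P) k).measurable hD),
    (measurePreserving_shift k).measure_preimage hD.nullMeasurableSet]

end Law

/-! ### Cesàro averages. -/

section Averages

/-- The averages of the first terms of `u` tend to `c`. -/
def AvgTendsto (u : ℕ → ℝ) (c : ℝ) : Prop :=
  Tendsto (fun n : ℕ => (∑ i ∈ Finset.range n, u i) / n) atTop (𝓝 c)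

theorem AvgTendsto.of_even_odd {u : ℕ → ℝ} {c : ℝ} (h0 : AvgTendsto (fun i => u (2 * i)) c)
    (h1 : AvgTendsto (fun i => u (2 * i + 1)) c) : AvgTendsto u c := by
  have e0 : ∀ n, ∑ i ∈ Finset.range (2 * n), u i =
      ∑ i ∈ Finset.range n, u (2 * i) + ∑ i ∈ Finset.range n, u (2 * i + 1) := by
    intro n
    induction n with
    | zero => simp
    | succ n ih =>
      rw [show 2 * (n + 1) = 2 * n + 1 + 1 by ring, Finset.sum_range_succ, Finset.sum_range_succ, ih,
        Finset.sum_range_succ, Finset.sum_range_succ]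
      ring
  have hx : Tendsto (fun n : ℕ => (n : ℝ) / (2 * n + 1)) atTop (𝓝 (1 / 2)) := by
    have := tendsto_natCast_div_add_atTop (𝕜 := ℝ) (1 / 2)
    have h2 := this.mul_const (1 / 2 : ℝ)
    rw [one_mul] at h2
    refine h2.congr fun n => ?_
    have : (0 : ℝ) < 2 * n + 1 := by positivity
    have : (0 : ℝ) < n + 1 / 2 := by positivity
    field_simp
  have hy : Tendsto (fun n : ℕ => ((n : ℝ) + 1) / (2 * n + 1)) atTop (𝓝 (1 / 2)) := by
    have h2 := (tendsto_const_nhds (x := (1 : ℝ))).sub hx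
    norm_num at h2
    refine (h2.congr fun n => ?_)
    have : (0 : ℝ) < 2 * n + 1 := by positivity
    field_simp
    ring
  have he : Tendsto (fun n : ℕ => (∑ i ∈ Finset.range (2 * n), u i) / ((2 * n : ℕ) : ℝ)) atTop
      (𝓝 c) := by
    have := (h0.add h1).mul_const (1 / 2 : ℝ)
    rw [show (c + c) * (1 / 2) = c by ring] at this
    refine this.congr fun n => ?_
    rw [e0]
    push_cast
    rw [← add_div]
    ring
  have ho : Tendsto (fun n : ℕ => (∑ i ∈ Finset.range (2 * n + 1), u i) / ((2 * n + 1 : ℕ) : ℝ))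
      atTop (𝓝 c) := by
    have h3 := ((tendsto_add_atTop_iff_nat 1).2 h0).mul hy
    have h4 := h1.mul hx
    have := h3.add h4
    rw [show c * (1 / 2) + c * (1 / 2) = c by ring] at this
    refine this.congr fun n => ?_
    rw [Finset.sum_range_succ _ (2 * n), e0, Finset.sum_range_succ]
    rcases n with _ | n
    · simp
    have : (0 : ℝ) < 2 * ((n + 1 : ℕ) : ℝ) + 1 := by positivity
    have : (0 : ℝ) < ((n + 1 : ℕ) : ℝ) := by positivity
    push_cast at *
    field_simp
    ring
  refine Filter.tendsto_def.2 fun s hs => ?_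
  obtain ⟨N0, hN0⟩ := eventually_atTop.1 (he.eventually_mem hs)
  obtain ⟨N1, hN1⟩ := eventually_atTop.1 (ho.eventually_mem hs)
  refine eventually_atTop.2 ⟨2 * (N0 + N1) + 1, fun n hn => ?_⟩
  obtain ⟨k, hk | hk⟩ := Nat.even_or_odd' n
  · subst hk
    exact hN0 k (by omega)
  · subst hk
    exact hN1 k (by omega)

theorem AvgTendsto.of_shift {u : ℕ → ℝ} {c : ℝ} (k : ℕ) (h : AvgTendsto (fun i => u (i + k)) c) :
    AvgTendsto u c := by
  unfold AvgTendsto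
  rw [← tendsto_add_atTop_iff_nat k]
  have h1 : Tendsto (fun n : ℕ => (n : ℝ) / (n + k)) atTop (𝓝 1) :=
    tendsto_natCast_div_add_atTop (k : ℝ)
  have h2 : Tendsto (fun n : ℕ => (∑ i ∈ Finset.range k, u i) / ((n + k : ℕ) : ℝ)) atTop (𝓝 0) :=
    (tendsto_const_nhds.div_atTop tendsto_natCast_atTop_atTop).comp (tendsto_add_atTop_nat k)
  have h3 := (h.mul h1).add h2
  rw [mul_one, add_zero] at h3
  refine h3.congr' ?_
  filter_upwards [eventually_gt_atTop 0] with n hn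
  have h5 : ∑ i ∈ Finset.range (n + k), u i =
      ∑ i ∈ Finset.range k, u i + ∑ i ∈ Finset.range n, u (i + k) := by
    rw [add_comm n, Finset.sum_range_add]
    simp only [add_comm]
  rw [h5]
  have : (0 : ℝ) < n := by exact_mod_cast hn
  push_cast
  field_simp
  ring

theorem AvgTendsto.add {u v : ℕ → ℝ} {c d : ℝ} (hu : AvgTendsto u c) (hv : AvgTendsto v d) :
    AvgTendsto (fun i => u i + v i) (c + d) := by
  refine (Tendsto.add hu hv).congr fun n => ?_
  rw [Finset.sum_add_distrib, add_div]

theorem AvgTendsto.mul_const {u : ℕ → ℝ} {c : ℝ} (hu : AvgTendsto u c) (r : ℝ) :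
    AvgTendsto (fun i => u i * r) (c * r) := by
  refine (Tendsto.mul_const r hu).congr fun n => ?_
  rw [← Finset.sum_mul]
  ring

end Averages

/-! ### Strong laws along the orbit of a refreshing transition. -/

section StrongLaw

variable {X : Type*} [MeasurableSpace X] {𝒪 : Type*} [MeasurableSpace 𝒪] {m : Measure X}
  [IsProbabilityMeasure m] {O : X → 𝒪} {N : X → X}

theorem Refresh.strong_law (h : Refresh m O N) {f : 𝒪 → ℝ} (hf : Measurable f)
    (hi : Integrable (fun x => f (O x)) m) :
    ∀ᵐ x ∂m, AvgTendsto (fun i => f (O (N^[i] x))) (∫ x, f (O x) ∂m) := by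
  have h1 := (h.iIndepFun_iterate).comp (fun _ => f) fun _ => hf
  refine strong_law_ae_real (fun i x => f (O (N^[i] x))) hi (fun i j hij => h1.indepFun hij)
    fun i => ?_
  have h2 := h.measurePreserving.iterate i
  have m1 : Measurable fun x => f (O x) := hf.comp h.measurable_out
  refine ⟨(m1.comp h2.measurable).aemeasurable, m1.aemeasurable, ?_⟩
  have h3 := Measure.map_map (μ := m) (g := fun x => f (O x)) (f := N^[i]) m1 h2.measurable
  rw [h2.map_eq] at h3
  exact h3.symm

/-- Neighbouring products share a factor, but the products at even indices are independent, and so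
are those at odd indices: each is a sequence of outputs of the doubled transition supplied by
`Refresh.comp`. -/
theorem Refresh.strong_law_mul_next (h : Refresh m O N) {f : 𝒪 → ℝ} (hf : Measurable f)
    (hi : Integrable (fun x => f (O x)) m) :
    ∀ᵐ x ∂m, AvgTendsto (fun i => f (O (N^[i] x)) * f (O (N^[i + 1] x)))
      ((∫ x, f (O x) ∂m) ^ 2) := by
  have h2 := h.comp h
  have hI : IndepFun (fun x => f (O x)) (fun x => f (O (N x))) m :=
    (h.iIndepFun_iterate.comp (fun _ => f) fun _ => hf).indepFun zero_ne_one
  have hi' : Integrable (fun x => f (O (N x))) m := h.measurePreserving.integrable_comp_of_integrable hi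
  have e : ∫ x, f (O x) * f (O (N x)) ∂m = (∫ x, f (O x) ∂m) ^ 2 := by
    rw [hI.integral_fun_mul_eq_mul_integral hi.aestronglyMeasurable hi'.aestronglyMeasurable, sq]
    congr 1
    have m1 : Measurable fun x => f (O x) := hf.comp h.measurable_out
    have := integral_map (φ := N) h.measurable_next.aemeasurable (f := fun x => f (O x)) (μ := m)
      m1.aestronglyMeasurable
    rw [← this, h.measurePreserving.map_eq]
  have h3 := h2.strong_law (f := fun q => f q.1 * f q.2) (by fun_prop)
    (hI.integrable_mul hi hi')
  simp only [e] at h3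
  -- The odd indices seen from x are the even ones seen from N x, and N preserves the measure.
  have h4 := h.measurePreserving.quasiMeasurePreserving.ae h3
  have hN : ∀ i x, (fun x => N (N x))^[i] x = N^[2 * i] x := by
    intro i x
    rw [Function.iterate_mul]
    rfl
  filter_upwards [h3, h4] with x hx hx'
  refine AvgTendsto.of_even_odd ?_ ?_
  · refine hx.congr fun n => ?_
    simp only [hN, Function.iterate_succ_apply']
  · refine hx'.congr fun n => ?_
    simp only [hN, ← Function.iterate_succ_apply, Function.iterate_succ_apply']

end StrongLaw

/-! ### Averages of the system times in the stationary regime. -/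

section SystemTimes

variable (P : Params)

/-- The system time of the `k`-th packet from the state `s`. -/
noncomputable def timeOf (s : (ℕ → ℝ) × (ℕ → (ℕ → ℕ∞) × ℕ)) (k : ℕ) : ℕ∞ :=
  firstTimeOf P.cost ((nextState P.cost)^[k] s)

variable {P}

theorem ae_one_le_timeOf_seqCons (e : ℝ) :
    ∀ᵐ s ∂stateLaw P, ∀ k, 1 ≤ timeOf P (seqCons e s.1, s.2) k := by
  have h := (measurePreserving_snd (μ := expSeq P.lam)
    (ν := Measure.infinitePi fun _ : ℕ => packLaw P)).quasiMeasurePreserving.ae (ae_packets (P := P))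
  filter_upwards [h] with s hs k
  rw [timeOf, nextState_iterate]
  exact one_le_packetTime (hs _).1 (hs _).2 _

theorem ae_timeOf_seqCons_ne_top (hs : P.p * (1 + P.theta) < 1) (e : ℝ) :
    ∀ᵐ s ∂stateLaw P, ∀ k, timeOf P (seqCons e s.1, s.2) k ≠ ⊤ := by
  have h := (measurePreserving_snd (μ := expSeq P.lam)
    (ν := Measure.infinitePi fun _ : ℕ => packLaw P)).quasiMeasurePreserving.ae
    (ae_packets_ne_top hs)
  filter_upwards [h] with s hs k
  rw [timeOf, nextState_iterate]
  exact packetTime_ne_top (hs _) _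

theorem lintegral_firstTimeOf (f : ℕ∞ → ℝ≥0∞) :
    ∫⁻ s, f (firstTimeOf P.cost s) ∂stateLaw P = ∫⁻ n, f n ∂timeLaw P P.cost := by
  rw [← map_firstTimeOf P P.cost_pos.le,
    lintegral_map (measurable_of_countable f) (measurable_firstTimeOf _)]

theorem integrable_and_integral_of_lintegral {X : Type*} [MeasurableSpace X] {m : Measure X}
    {g : X → ℝ} (hg : Measurable g) (h0 : ∀ x, 0 ≤ g x) {r : ℝ} (hr : 0 ≤ r)
    (h : ∫⁻ x, ENNReal.ofReal (g x) ∂m = ENNReal.ofReal r) :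
    Integrable g m ∧ ∫ x, g x ∂m = r := by
  refine ⟨⟨hg.aestronglyMeasurable, ?_⟩, ?_⟩
  · rw [hasFiniteIntegral_iff_ofReal (Eventually.of_forall h0), h]
    exact ENNReal.ofReal_lt_top
  · rw [integral_eq_lintegral_of_nonneg_ae (Eventually.of_forall h0) hg.aestronglyMeasurable, h,
      ENNReal.toReal_ofReal hr]

section Stable

variable (h : P.p * (1 + P.theta) < 1)
include h

theorem lintegral_toNat_pow (j : ℕ) {r : ℝ}
    (hr : ∫⁻ n, (n : ℝ≥0∞) ^ j ∂timeLaw P P.cost = ENNReal.ofReal r) :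
    ∫⁻ s, ENNReal.ofReal (((firstTimeOf P.cost s).toNat : ℝ) ^ j) ∂stateLaw P =
      ENNReal.ofReal r := by
  rw [lintegral_firstTimeOf fun n => ENNReal.ofReal ((n.toNat : ℝ) ^ j), ← hr]
  have h1 := ae_lt_top (μ := timeLaw P P.cost) (f := fun n : ℕ∞ => (n : ℝ≥0∞))
    (measurable_of_countable _) (by
      rw [(lintegral_timeLaw_moments h).1]; exact ENNReal.ofReal_ne_top)
  refine lintegral_congr_ae ?_
  filter_upwards [h1] with n hn
  cases n with
  | top => simp at hn
  | coe n => simp [ENNReal.ofReal_pow]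

theorem ae_avgTendsto_timeOf :
    ∀ᵐ s ∂stateLaw P, AvgTendsto (fun k => ((timeOf P s k).toNat : ℝ)) P.timeMean ∧
      AvgTendsto (fun k => ((timeOf P s k).toNat : ℝ) ^ 2) P.timeSq ∧
      AvgTendsto (fun k => ((timeOf P s k).toNat : ℝ) * ((timeOf P s (k + 1)).toNat : ℝ))
        (P.timeMean ^ 2) := by
  have hR := refresh_nextState P P.cost_pos.le
  have hm := lintegral_timeLaw_moments h
  have mf : Measurable fun n : ℕ∞ => (n.toNat : ℝ) := measurable_of_countable _
  obtain ⟨i1, e1⟩ := integrable_and_integral_of_lintegral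
    (mf.comp (measurable_firstTimeOf P.cost)) (fun s => Nat.cast_nonneg _) (P.timeMean_pos h).le
    (by simpa using lintegral_toNat_pow h 1 (by simpa using hm.1))
  obtain ⟨i2, e2⟩ := integrable_and_integral_of_lintegral
    ((mf.pow_const 2).comp (measurable_firstTimeOf P.cost)) (fun s => sq_nonneg _) (P.timeSq_nonneg h)
    (lintegral_toNat_pow h 2 hm.2)
  have l1 := hR.strong_law mf i1
  have l2 := hR.strong_law (mf.pow_const 2) i2
  have l3 := hR.strong_law_mul_next mf i1
  simp only [Function.comp_def] at e1 e2
  rw [e1] at l1 l3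
  rw [e2] at l2
  filter_upwards [l1, l2, l3] with s h1 h2 h3
  exact ⟨h1, h2, h3⟩

end Stable

/-- The strong law for the system times truncated at a level `M`, which are bounded and have a mean
greater than `C`. -/
theorem ae_eventually_le_sum_timeOf (h : 1 ≤ P.p * (1 + P.theta)) :
    ∀ᵐ s ∂stateLaw P, ∀ C : ℕ, ∀ᶠ n : ℕ in atTop,
      ((C * n : ℕ) : ℕ∞) ≤ ∑ k ∈ Finset.range n, timeOf P s k := by
  rw [ae_all_iff]
  intro C
  have hR := refresh_nextState P P.cost_pos.le
  -- By monotone convergence the truncated means grow to infinity; `C + 1` leaves room for the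
  -- strict inequality used in the limit.
  have hlim : ∃ M : ℕ, ENNReal.ofReal (C + 1) ≤ ∫⁻ n, ((min n M : ℕ∞) : ℝ≥0∞) ∂timeLaw P P.cost := by
    have h1 : ∫⁻ n : ℕ∞, ⨆ M : ℕ, ((min n M : ℕ∞) : ℝ≥0∞) ∂timeLaw P P.cost = ∞ := by
      rw [← lintegral_timeLaw_eq_top h]
      refine lintegral_congr fun n => ?_
      refine le_antisymm (iSup_le fun M => by gcongr; exact min_le_left _ _) ?_
      cases n with
      | top =>
        simp only [le_top, min_eq_right, ENat.toENNReal_coe, ENat.toENNReal_top]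
        rw [ENNReal.iSup_natCast]
      | coe n => exact le_iSup_of_le n (by simp)
    rw [lintegral_iSup (fun M => measurable_of_countable _) (fun M M' hM n => by
      simp only; gcongr)] at h1
    obtain ⟨M, hM⟩ := (iSup_eq_top.1 h1) (ENNReal.ofReal (C + 1)) ENNReal.ofReal_lt_top
    exact ⟨M, hM.le⟩
  obtain ⟨M, hM⟩ := hlim
  have mf : Measurable fun n : ℕ∞ => ((min n M).toNat : ℝ) := measurable_of_countable _
  have hb : ∀ n : ℕ∞, ((min n M).toNat : ℝ) ≤ M := fun n => by
    have := ENat.toNat_le_toNat (min_le_right n (M : ℕ∞)) (ENat.natCast_ne_top M)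
    exact_mod_cast this
  have hc : ∀ n : ℕ∞, ENNReal.ofReal ((min n M).toNat : ℝ) = ((min n M : ℕ∞) : ℝ≥0∞) := by
    intro n
    obtain ⟨k, hk⟩ := ENat.ne_top_iff_exists.1
      (ne_top_of_le_ne_top (ENat.natCast_ne_top M) (min_le_right n (M : ℕ∞)))
    rw [← hk]
    simp
  have mg := mf.comp (measurable_firstTimeOf P.cost)
  have hi : Integrable (fun s => (((min (firstTimeOf P.cost s) M).toNat : ℕ) : ℝ)) (stateLaw P) := by
    refine Integrable.of_bound mg.aestronglyMeasurable (M : ℝ) (Eventually.of_forall fun s => ?_)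
    rw [Real.norm_of_nonneg (Nat.cast_nonneg _)]
    exact hb _
  have hI : (C : ℝ) + 1 ≤ ∫ s, (((min (firstTimeOf P.cost s) M).toNat : ℕ) : ℝ) ∂stateLaw P := by
    rw [← ENNReal.ofReal_le_ofReal_iff (integral_nonneg fun s => Nat.cast_nonneg _),
      ofReal_integral_eq_lintegral_ofReal hi (Eventually.of_forall fun s => Nat.cast_nonneg _)]
    refine hM.trans_eq ?_
    rw [← lintegral_firstTimeOf]
    exact lintegral_congr fun s => (hc _).symm
  filter_upwards [hR.strong_law mf hi] with s hs
  filter_upwards [hs.eventually_const_lt (lt_of_lt_of_le (lt_add_one (C : ℝ)) hI),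
    eventually_gt_atTop 0] with n hn hn0
  rw [lt_div_iff₀ (by exact_mod_cast hn0)] at hn
  have h5 : C * n ≤ ∑ k ∈ Finset.range n, (min (timeOf P s k) M).toNat := by
    exact_mod_cast hn.le
  calc ((C * n : ℕ) : ℕ∞) ≤ ((∑ k ∈ Finset.range n, (min (timeOf P s k) M).toNat : ℕ) : ℕ∞) := by
        exact_mod_cast h5
    _ = ∑ k ∈ Finset.range n, ((min (timeOf P s k) M).toNat : ℕ∞) := by push_cast; rfl
    _ ≤ _ := Finset.sum_le_sum fun k _ => (ENat.natCast_toNat_le_self _).trans (min_le_left _ _)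

end SystemTimes

/-! ### Deterministic renewal argument for the delivery rate and the age. -/

section Counting

variable {P : Params} {e₀ : ℝ} {d₀ : ℕ} {g : Slot → ℝ} {a : Trial → Bool}

theorem genEpoch_succ (k : ℕ) :
    genEpoch P e₀ g a (k + 1) = genEpoch P e₀ g a k + systemTime P e₀ g a k :=
  Finset.sum_range_succ _ _

theorem genEpoch_mono : Monotone (genEpoch P e₀ g a) :=
  monotone_nat_of_le_succ fun k => by rw [genEpoch_succ]; exact le_self_add

theorem le_genEpoch (h : ∀ k, 1 ≤ systemTime P e₀ g a k) (n : ℕ) :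
    (n : ℕ∞) ≤ genEpoch P e₀ g a n := by
  induction n with
  | zero => simp
  | succ n ih =>
    rw [genEpoch_succ]
    push_cast
    exact add_le_add ih (h n)

theorem delivered_eq {N K : ℕ} (h1 : genEpoch P e₀ g a K ≤ N)
    (h2 : (N : ℕ∞) < genEpoch P e₀ g a (K + 1)) : delivered P e₀ g a N = K := by
  have h3 : {k : ℕ | genEpoch P e₀ g a (k + 1) ≤ (N : ℕ∞)} = Set.Iio K := by
    ext k
    simp only [Set.mem_ofPred_eq, Set.mem_Iio]
    constructor
    · intro hk
      by_contra hlt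
      exact absurd (h2.trans_le (genEpoch_mono (by omega : K + 1 ≤ k + 1))) (not_lt.2 hk)
    · intro hk
      exact (genEpoch_mono (by omega : k + 1 ≤ K)).trans h1
  rw [delivered, h3, Set.ncard_eq_toFinset_card']
  simp

theorem delivered_spec (h : ∀ k, 1 ≤ systemTime P e₀ g a k) (N : ℕ) :
    genEpoch P e₀ g a (delivered P e₀ g a N) ≤ N ∧
      (N : ℕ∞) < genEpoch P e₀ g a (delivered P e₀ g a N + 1) := by
  classical
  have hex : ∃ k, (N : ℕ∞) < genEpoch P e₀ g a (k + 1) :=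
    ⟨N, lt_of_lt_of_le (by exact_mod_cast Nat.lt_succ_self N) (le_genEpoch h (N + 1))⟩
  have h2 := Nat.find_spec hex
  have h1 : genEpoch P e₀ g a (Nat.find hex) ≤ N := by
    rcases hK : Nat.find hex with _ | K
    · simp [genEpoch]
    · exact not_lt.1 (Nat.find_min hex (by omega : K < Nat.find hex))
  rw [delivered_eq h1 h2]
  exact ⟨h1, h2⟩

theorem delivered_mono (h : ∀ k, 1 ≤ systemTime P e₀ g a k) : Monotone (delivered P e₀ g a) := by
  intro M N hMN
  by_contra hlt
  have h1 := (delivered_spec h M).1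
  have h2 := (delivered_spec h N).2
  have h3 : genEpoch P e₀ g a (delivered P e₀ g a N + 1) ≤
      genEpoch P e₀ g a (delivered P e₀ g a M) := genEpoch_mono (by omega)
  have h4 : (M : ℕ∞) ≤ N := by exact_mod_cast hMN
  exact absurd (h2.trans_le (h3.trans (h1.trans h4))) (lt_irrefl _)

theorem latestGen_le (h : ∀ k, 1 ≤ systemTime P e₀ g a k) (N : ℕ) :
    latestGen P e₀ d₀ g a (N + 1) ≤
      ((genEpoch P e₀ g a (delivered P e₀ g a N)).toNat : ℝ) := by
  unfold latestGen
  simp only [Nat.add_sub_cancel]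
  split_ifs with hK
  · have : (0 : ℝ) ≤ (d₀ : ℝ) := Nat.cast_nonneg _
    exact (neg_nonpos.2 this).trans (Nat.cast_nonneg _)
  · exact_mod_cast ENat.toNat_le_toNat (genEpoch_mono (Nat.sub_le _ _))
      (ne_top_of_le_ne_top (ENat.natCast_ne_top N) (delivered_spec h N).1)

theorem toNat_genEpoch_le (h : ∀ k, 1 ≤ systemTime P e₀ g a k) (N : ℕ) :
    (genEpoch P e₀ g a (delivered P e₀ g a N)).toNat ≤ N :=
  ENat.toNat_le_of_le_natCast (delivered_spec h N).1

theorem age_nonneg (h : ∀ k, 1 ≤ systemTime P e₀ g a k) (N : ℕ) :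
    0 ≤ age P e₀ d₀ g a (N + 1) := by
  have h1 := latestGen_le (d₀ := d₀) h N
  have h2 : ((genEpoch P e₀ g a (delivered P e₀ g a N)).toNat : ℝ) ≤ N := by
    exact_mod_cast toNat_genEpoch_le h N
  unfold age
  push_cast
  linarith

section Unstable

variable (h : ∀ k, 1 ≤ systemTime P e₀ g a k)
  (hC : ∀ C : ℕ, ∀ᶠ n : ℕ in atTop, ((C * n : ℕ) : ℕ∞) ≤ genEpoch P e₀ g a n)
include h hC

/-- The K packets delivered by time N satisfy C K ≤ `genEpoch` K ≤ N once K is large, so the rate is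
at most 1/C. -/
theorem tendsto_upRate_zero : Tendsto (upRate P e₀ g a) atTop (𝓝 0) := by
  rw [Metric.tendsto_atTop]
  intro ε hε
  obtain ⟨C, hCε⟩ := exists_nat_gt (1 / ε)
  obtain ⟨n₀, hn₀⟩ := eventually_atTop.1 (hC C)
  -- If fewer than `n₀` packets are delivered, C K ≤ N holds because N itself exceeds `C * n₀`.
  refine ⟨C * n₀ + 1, fun N hN => ?_⟩
  have hN0 : (0 : ℝ) < N := by
    have : 0 < N := by omega
    exact_mod_cast this
  have hC0 : (0 : ℝ) < C := (by positivity : 0 < 1 / ε).trans hCε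
  have hK : C * delivered P e₀ g a N ≤ N := by
    by_cases hk : n₀ ≤ delivered P e₀ g a N
    · exact_mod_cast (hn₀ _ hk).trans (delivered_spec h N).1
    · have : C * delivered P e₀ g a N ≤ C * n₀ := Nat.mul_le_mul_left _ (by omega)
      omega
  have hK' : (C : ℝ) * delivered P e₀ g a N ≤ N := by exact_mod_cast hK
  rw [Real.dist_eq, sub_zero, upRate, abs_of_nonneg (by positivity), div_lt_iff₀ hN0]
  rw [div_lt_iff₀ hε] at hCε
  by_contra hlt
  push Not at hlt
  have := mul_le_mul_of_nonneg_left hlt hC0.le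
  nlinarith

-- A delivered packet with system time t contributes at least 1 + … + t ≥ t²/2 ≥ L t - L²/2; the
-- blocks since the last delivery contribute at least half the square of their number. The second
-- form turns into the first when a delivery occurs.
omit hC in
theorem le_sum_age (L : ℝ) (N : ℕ) :
    L * (genEpoch P e₀ g a (delivered P e₀ g a N)).toNat - delivered P e₀ g a N * (L ^ 2 / 2) +
        (N - (genEpoch P e₀ g a (delivered P e₀ g a N)).toNat : ℝ) ^ 2 / 2 ≤
      ∑ n ∈ Finset.Icc 1 N, age P e₀ d₀ g a n := by
  induction N with
  | zero =>
    have h0 : delivered P e₀ g a 0 = 0 := by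
      refine delivered_eq (by simp [genEpoch]) ?_
      exact lt_of_lt_of_le (by norm_num) (le_genEpoch h (0 + 1))
    rw [h0]
    simp [genEpoch]
  | succ N ih =>
    rw [Finset.sum_Icc_succ_top (by omega)]
    have hage : (N : ℝ) + 1 - (genEpoch P e₀ g a (delivered P e₀ g a N)).toNat ≤
        age P e₀ d₀ g a (N + 1) := by
      have := latestGen_le (d₀ := d₀) h N
      unfold age
      push_cast
      linarith
    have hs := delivered_spec h N
    have hle : ((genEpoch P e₀ g a (delivered P e₀ g a N)).toNat : ℝ) ≤ N := by
      exact_mod_cast toNat_genEpoch_le h N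
    by_cases hd : ((N + 1 : ℕ) : ℕ∞) < genEpoch P e₀ g a (delivered P e₀ g a N + 1)
    · have hK : delivered P e₀ g a (N + 1) = delivered P e₀ g a N :=
        delivered_eq (hs.1.trans (by exact_mod_cast Nat.le_succ N)) hd
      rw [hK]
      push_cast
      nlinarith
    · have h1 : genEpoch P e₀ g a (delivered P e₀ g a N + 1) = ((N + 1 : ℕ) : ℕ∞) := by
        refine le_antisymm (not_lt.1 hd) ?_
        push_cast
        exact Order.add_one_le_of_lt hs.2
      have hK : delivered P e₀ g a (N + 1) = delivered P e₀ g a N + 1 := by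
        refine delivered_eq h1.le ?_
        rw [genEpoch_succ, h1]
        have := h (delivered P e₀ g a N + 1)
        calc ((N + 1 : ℕ) : ℕ∞) < ((N + 1 + 1 : ℕ) : ℕ∞) := by exact_mod_cast Nat.lt_succ_self _
          _ ≤ _ := by push_cast; gcongr
      rw [hK, h1, ENat.toNat_natCast]
      push_cast
      -- The hint is (t - L)² ≥ 0 for the system time t of the packet delivered at the end of this
      -- block.
      nlinarith [sq_nonneg ((N : ℝ) + 1 - (genEpoch P e₀ g a (delivered P e₀ g a N)).toNat - L)]

/-- The unfinished period also obeys x²/2 ≥ L x - L²/2, so the average age is at least L minus terms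
that vanish with the delivery rate and with 1/N. -/
theorem tendsto_avgAge_atTop : Tendsto (avgAge P e₀ d₀ g a) atTop atTop := by
  rw [tendsto_atTop]
  intro B
  set L : ℝ := |B| + 1 with hL
  have hr := tendsto_upRate_zero h hC
  have h1 : Tendsto (fun N : ℕ => L - upRate P e₀ g a N * (L ^ 2 / 2) - (L ^ 2 / 2) / N) atTop
      (𝓝 (L - 0 * (L ^ 2 / 2) - 0)) :=
    (tendsto_const_nhds.sub (hr.mul_const _)).sub
      (tendsto_const_nhds.div_atTop tendsto_natCast_atTop_atTop)
  have hB : B < L - 0 * (L ^ 2 / 2) - 0 := by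
    have := le_abs_self B
    rw [hL]; linarith
  filter_upwards [h1.eventually_const_lt hB, eventually_gt_atTop 0] with N hN hN0
  have hN0' : (0 : ℝ) < N := by exact_mod_cast hN0
  refine hN.le.trans ?_
  have h2 := le_sum_age (d₀ := d₀) h L N
  rw [avgAge, one_div, ← div_eq_inv_mul, le_div_iff₀ hN0', upRate]
  have h3 : (L - (delivered P e₀ g a N : ℝ) / N * (L ^ 2 / 2) - L ^ 2 / 2 / N) * N =
      L * N - delivered P e₀ g a N * (L ^ 2 / 2) - L ^ 2 / 2 := by
    field_simp
  rw [h3]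
  nlinarith [sq_nonneg ((N : ℝ) - (genEpoch P e₀ g a (delivered P e₀ g a N)).toNat - L)]

end Unstable

section Stable

variable {t : ℕ → ℕ} (ht : ∀ k, systemTime P e₀ g a k = t k) (ht1 : ∀ k, 1 ≤ t k)
include ht

theorem genEpoch_eq (k : ℕ) : genEpoch P e₀ g a k = (∑ i ∈ Finset.range k, t i : ℕ) := by
  unfold genEpoch
  push_cast
  exact Finset.sum_congr rfl fun i _ => ht i

include ht1

theorem sum_range_delivered (N : ℕ) :
    ∑ i ∈ Finset.range (delivered P e₀ g a N), t i ≤ N ∧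
      N < ∑ i ∈ Finset.range (delivered P e₀ g a N + 1), t i := by
  have h := delivered_spec (P := P) (e₀ := e₀) (g := g) (a := a)
    (fun k => by rw [ht k]; exact_mod_cast ht1 k) N
  rw [genEpoch_eq ht, genEpoch_eq ht] at h
  exact ⟨by exact_mod_cast h.1, by exact_mod_cast h.2⟩

theorem tendsto_delivered : Tendsto (delivered P e₀ g a) atTop atTop := by
  refine tendsto_atTop_atTop_of_monotone
    (delivered_mono fun k => by rw [ht k]; exact_mod_cast ht1 k) fun b => ?_
  refine ⟨∑ i ∈ Finset.range b, t i, ?_⟩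
  by_contra hlt
  have h := (sum_range_delivered ht ht1 (∑ i ∈ Finset.range b, t i)).2
  have : ∑ i ∈ Finset.range (delivered P e₀ g a (∑ i ∈ Finset.range b, t i) + 1), t i ≤
      ∑ i ∈ Finset.range b, t i :=
    Finset.sum_le_sum_of_subset (Finset.range_mono (by omega))
  omega

/-- With K deliveries by time N, N/K lies between the sums of the first K and of the first K + 1
system times, each divided by K; both tend to `m`. -/
theorem tendsto_upRate {m : ℝ} (hm : 0 < m) (h : AvgTendsto (fun k => (t k : ℝ)) m) :
    Tendsto (upRate P e₀ g a) atTop (𝓝 (1 / m)) := by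
  have hK := tendsto_delivered ht ht1
  have h1 := h.comp hK
  have h2 := h.comp ((tendsto_add_atTop_nat 1).comp hK)
  have hKr : Tendsto (fun N => (delivered P e₀ g a N : ℝ)) atTop atTop :=
    tendsto_natCast_atTop_atTop.comp hK
  have h3 : Tendsto (fun N => 1 + 1 / (delivered P e₀ g a N : ℝ)) atTop (𝓝 (1 + 0)) :=
    tendsto_const_nhds.add (tendsto_const_nhds.div_atTop hKr)
  have h4 := h2.mul h3
  rw [add_zero, mul_one] at h4
  have h5 : Tendsto (fun N : ℕ => (N : ℝ) / delivered P e₀ g a N) atTop (𝓝 m) := by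
    refine tendsto_of_tendsto_of_tendsto_of_le_of_le' h1 h4 ?_ ?_
    · refine Eventually.of_forall fun N => ?_
      have := (sum_range_delivered ht ht1 N).1
      simp only [Function.comp_apply]
      gcongr
      exact_mod_cast this
    · filter_upwards [hK.eventually_gt_atTop 0] with N hN
      have h6 := (sum_range_delivered ht ht1 N).2
      have h7 : (N : ℝ) ≤ ∑ i ∈ Finset.range (delivered P e₀ g a N + 1), (t i : ℝ) := by
        exact_mod_cast h6.le
      have h8 : (0 : ℝ) < delivered P e₀ g a N := by exact_mod_cast hN
      simp only [Function.comp_apply]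
      push_cast
      have h9 : (∑ i ∈ Finset.range (delivered P e₀ g a N + 1), (t i : ℝ)) /
          ((delivered P e₀ g a N : ℝ) + 1) * (1 + 1 / (delivered P e₀ g a N : ℝ)) =
          (∑ i ∈ Finset.range (delivered P e₀ g a N + 1), (t i : ℝ)) / delivered P e₀ g a N := by
        field_simp
      rw [h9]
      gcongr
  have h6 := h5.inv₀ hm.ne'
  rw [one_div]
  refine h6.congr fun N => ?_
  rw [inv_div]
  rfl

-- While packet `k` is under way, the latest received packet is `k - 1`, generated `t (k - 1)`
-- blocks before packet `k`. For `k = 0` the initial age takes this role.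
omit ht1 in
theorem age_eq {k j : ℕ} (hj : j < t k) :
    age P e₀ d₀ g a (∑ i ∈ Finset.range k, t i + j + 1) =
      (if k = 0 then (d₀ : ℝ) else t (k - 1)) + (j + 1) := by
  have hd : delivered P e₀ g a (∑ i ∈ Finset.range k, t i + j) = k := by
    refine delivered_eq ?_ ?_
    · rw [genEpoch_eq ht]
      exact_mod_cast Nat.le_add_right _ _
    · rw [genEpoch_eq ht, Finset.sum_range_succ]
      exact_mod_cast Nat.add_lt_add_left hj _
  unfold age latestGen
  simp only [Nat.add_sub_cancel, hd]
  rcases k with _ | k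
  · simp
    ring
  · rw [if_neg (by omega), if_neg (by omega), genEpoch_eq ht, ENat.toNat_natCast,
      Nat.add_sub_cancel, Finset.sum_range_succ]
    push_cast
    ring

omit ht1 in
theorem sum_age_eq (K : ℕ) :
    ∑ n ∈ Finset.range (∑ i ∈ Finset.range K, t i), age P e₀ d₀ g a (n + 1) =
      ∑ k ∈ Finset.range K, (t k * (if k = 0 then (d₀ : ℝ) else t (k - 1)) +
        ((t k : ℝ) ^ 2 + t k) * (1 / 2)) := by
  induction K with
  | zero => simp
  | succ K ih =>
    rw [Finset.sum_range_succ t, Finset.sum_range_add, ih, Finset.sum_range_succ _ K]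
    congr 1
    rw [Finset.sum_congr rfl fun j hj => age_eq (d₀ := d₀) ht (Finset.mem_range.1 hj),
      Finset.sum_add_distrib, Finset.sum_const, Finset.card_range, nsmul_eq_mul]
    congr 1
    have : ∀ n : ℕ, ∑ j ∈ Finset.range n, ((j : ℝ) + 1) = ((n : ℝ) ^ 2 + n) * (1 / 2) := by
      intro n
      induction n with
      | zero => simp
      | succ n ih => rw [Finset.sum_range_succ, ih]; push_cast; ring
    exact this _

/-- Ages are nonnegative, so the sum up to N lies between the sums over the first K and the first K
+ 1 complete periods. Multiply the average per period by the limit rate 1/m. -/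
theorem tendsto_avgAge {m v : ℝ} (hm : 0 < m) (h : AvgTendsto (fun k => (t k : ℝ)) m)
    (hv : AvgTendsto (fun k => (t k : ℝ) ^ 2) v)
    (hmm : AvgTendsto (fun k => (t k : ℝ) * t (k + 1)) (m ^ 2)) :
    Tendsto (avgAge P e₀ d₀ g a) atTop (𝓝 (m + v / (2 * m) + 1 / 2)) := by
  set c : ℕ → ℝ := fun k => t k * (if k = 0 then (d₀ : ℝ) else t (k - 1)) +
    ((t k : ℝ) ^ 2 + t k) * (1 / 2) with hc
  have hcl : AvgTendsto c (m ^ 2 + (v + m) * (1 / 2)) := by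
    -- Dropping the first term removes the initial age and leaves products of consecutive system
    -- times.
    refine AvgTendsto.add (AvgTendsto.of_shift 1 ?_) ((hv.add h).mul_const _)
    refine hmm.congr fun n => ?_
    congr 1
    refine Finset.sum_congr rfl fun k _ => ?_
    simp [mul_comm]
  have h1 : ∀ k, 1 ≤ systemTime P e₀ g a k := fun k => by rw [ht k]; exact_mod_cast ht1 k
  have hK := tendsto_delivered ht ht1
  have hr := tendsto_upRate ht ht1 hm h
  have hKN : Tendsto (fun N : ℕ => ((delivered P e₀ g a N + 1 : ℕ) : ℝ) / N) atTop
      (𝓝 (1 / m)) := by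
    have := hr.add (tendsto_const_nhds (x := (1 : ℝ)).div_atTop tendsto_natCast_atTop_atTop)
    rw [add_zero] at this
    refine this.congr fun N => ?_
    rw [upRate]
    push_cast
    ring
  have hl := (hcl.comp hK).mul hr
  have hu := (hcl.comp ((tendsto_add_atTop_nat 1).comp hK)).mul hKN
  have he : (m ^ 2 + (v + m) * (1 / 2)) * (1 / m) = m + v / (2 * m) + 1 / 2 := by
    field_simp
    ring
  rw [he] at hl hu
  have hS : ∀ N, avgAge P e₀ d₀ g a N =
      (∑ n ∈ Finset.range N, age P e₀ d₀ g a (n + 1)) / N := by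
    intro N
    rw [avgAge, one_div, ← div_eq_inv_mul, Finset.range_eq_Ico,
      Finset.sum_Ico_add' (fun n => age P e₀ d₀ g a n) 0 N 1]
    rfl
  have hmono : ∀ {M N : ℕ}, M ≤ N → ∑ n ∈ Finset.range M, age P e₀ d₀ g a (n + 1) ≤
      ∑ n ∈ Finset.range N, age P e₀ d₀ g a (n + 1) := fun hMN =>
    Finset.sum_le_sum_of_subset_of_nonneg (Finset.range_mono hMN) fun n _ _ => age_nonneg h1 n
  refine tendsto_of_tendsto_of_tendsto_of_le_of_le' hl hu ?_ ?_
  · filter_upwards [hK.eventually_gt_atTop 0] with N hN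
    have h8 : (0 : ℝ) < delivered P e₀ g a N := by exact_mod_cast hN
    rw [hS, upRate]
    simp only [Function.comp_apply]
    rw [div_mul_div_cancel₀ h8.ne', ← sum_age_eq ht]
    exact div_le_div_of_nonneg_right (hmono (sum_range_delivered ht ht1 N).1) (Nat.cast_nonneg _)
  · refine Eventually.of_forall fun N => ?_
    have h8 : (0 : ℝ) < ((delivered P e₀ g a N + 1 : ℕ) : ℝ) := by positivity
    rw [hS]
    simp only [Function.comp_apply]
    rw [div_mul_div_cancel₀ h8.ne', ← sum_age_eq ht]
    exact div_le_div_of_nonneg_right (hmono (sum_range_delivered ht ht1 N).2.le)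
      (Nat.cast_nonneg _)

end Stable

end Counting

/-! ### Almost sure limits and the closed formulas. -/

section Limits

variable {Ω : Type*} [MeasurableSpace Ω] {μ : Measure Ω} [IsProbabilityMeasure μ] {P : Params}
  {γ : Slot → Ω → ℝ} {A : Trial → Ω → Bool}

theorem IsModel.measurable_modelState (h : IsModel P μ γ A) :
    Measurable fun ω => modelState P (fun s => γ s ω) fun t => A t ω := by
  have h2 := h.measurable_values
  refine Measurable.prodMk ?_ ?_
  · exact measurable_pi_lambda _ fun m => h.measurable_gain _
  · exact measurable_pi_lambda _ fun k =>
      (measurable_packet P).comp (measurable_pi_lambda _ fun i => h2 _)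

theorem Params.stored_nonneg {e : ℝ} (he : 0 ≤ e) : 0 ≤ P.stored e := by
  have h1 := P.eta_pos; have h2 := P.Pt_pos; have h3 := P.TB_pos
  unfold Params.stored; positivity

theorem IsModel.ae_of_ae_stateLaw (h : IsModel P μ γ A)
    {Q : (ℕ → ℝ) × (ℕ → (ℕ → ℕ∞) × ℕ) → Prop} (hQ : ∀ᵐ s ∂stateLaw P, Q s) :
    ∀ᵐ ω ∂μ, Q (modelState P (fun s => γ s ω) fun t => A t ω) :=
  ae_of_ae_map h.measurable_modelState.aemeasurable (by rwa [h.map_modelState])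

/-- More than `stored / cost` packets exhaust the initial energy, so one deterministic `k₀` serves
every property `Q`; from then on the system times have the stationary joint law. -/
theorem IsModel.exists_shift (h : IsModel P μ γ A) {e₀ : ℝ} (he₀ : 0 ≤ e₀) :
    ∃ k₀ : ℕ, ∀ Q : (ℕ → ℕ∞) → Prop, (∀ᵐ s ∂stateLaw P, Q (timeOf P s)) →
      ∀ᵐ ω ∂μ, Q fun k => systemTime P e₀ (fun s => γ s ω) (fun t => A t ω) (k + k₀) := by
  obtain ⟨k₀, hk₀⟩ := exists_nat_gt (P.stored e₀ / P.cost)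
  rw [div_lt_iff₀ P.cost_pos] at hk₀
  refine ⟨k₀, fun Q hQ => ?_⟩
  have h1 := map_nextState_iterate_seqCons (P := P) P.cost_pos (Params.stored_nonneg he₀) hk₀
  have m1 : Measurable fun s : (ℕ → ℝ) × (ℕ → (ℕ → ℕ∞) × ℕ) =>
      (nextState P.cost)^[k₀] (seqCons (P.stored e₀) s.1, s.2) := by
    have : Measurable fun s : (ℕ → ℝ) × (ℕ → (ℕ → ℕ∞) × ℕ) => seqCons (P.stored e₀) s.1 :=
      measurable_seqCons.comp (measurable_const.prodMk measurable_fst)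
    exact ((measurable_nextState P.cost).iterate k₀).comp (this.prodMk measurable_snd)
  rw [← h1] at hQ
  filter_upwards [h.ae_of_ae_stateLaw (ae_of_ae_map m1.aemeasurable hQ)] with ω hω
  convert hω using 1
  funext k
  rw [systemTime_eq, timeOf, Function.iterate_add_apply]

theorem IsModel.ae_one_le_systemTime (h : IsModel P μ γ A) (e₀ : ℝ) :
    ∀ᵐ ω ∂μ, ∀ k, 1 ≤ systemTime P e₀ (fun s => γ s ω) (fun t => A t ω) k := by
  filter_upwards [h.ae_of_ae_stateLaw (ae_one_le_timeOf_seqCons (P.stored e₀))] with ω hω k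
  rw [systemTime_eq]
  exact hω k

theorem IsModel.ae_tendsto_stable (h : IsModel P μ γ A) {e₀ : ℝ} (he₀ : 0 ≤ e₀) (d₀ : ℕ)
    (hs : P.p * (1 + P.theta) < 1) :
    ∀ᵐ ω ∂μ,
      Tendsto (avgAge P e₀ d₀ (fun s => γ s ω) fun t => A t ω) atTop
        (𝓝 (P.timeMean + P.timeSq / (2 * P.timeMean) + 1 / 2)) ∧
      Tendsto (upRate P e₀ (fun s => γ s ω) fun t => A t ω) atTop (𝓝 (1 / P.timeMean)) := by
  obtain ⟨k₀, hk₀⟩ := h.exists_shift he₀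
  filter_upwards [h.ae_one_le_systemTime e₀,
    h.ae_of_ae_stateLaw (ae_timeOf_seqCons_ne_top hs (P.stored e₀)),
    hk₀ (fun T => AvgTendsto (fun k => ((T k).toNat : ℝ)) P.timeMean ∧
      AvgTendsto (fun k => ((T k).toNat : ℝ) ^ 2) P.timeSq ∧
      AvgTendsto (fun k => ((T k).toNat : ℝ) * ((T (k + 1)).toNat : ℝ)) (P.timeMean ^ 2))
      (ae_avgTendsto_timeOf hs)] with ω h1 h2 ⟨h3, h4, h5⟩
  have ht : ∀ k, systemTime P e₀ (fun s => γ s ω) (fun t => A t ω) k =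
      ((systemTime P e₀ (fun s => γ s ω) (fun t => A t ω) k).toNat : ℕ∞) := by
    intro k
    refine (ENat.natCast_toNat ?_).symm
    rw [systemTime_eq]
    exact h2 k
  have ht1 : ∀ k, 1 ≤ (systemTime P e₀ (fun s => γ s ω) (fun t => A t ω) k).toNat := by
    intro k
    have := h1 k
    rw [ht k] at this
    exact_mod_cast this
  have hm := P.timeMean_pos hs
  have l1 := AvgTendsto.of_shift k₀
    (u := fun k => ((systemTime P e₀ (fun s => γ s ω) (fun t => A t ω) k).toNat : ℝ)) h3
  have l2 := AvgTendsto.of_shift k₀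
    (u := fun k => ((systemTime P e₀ (fun s => γ s ω) (fun t => A t ω) k).toNat : ℝ) ^ 2) h4
  have l3 := AvgTendsto.of_shift k₀
    (u := fun k => ((systemTime P e₀ (fun s => γ s ω) (fun t => A t ω) k).toNat : ℝ) *
      ((systemTime P e₀ (fun s => γ s ω) (fun t => A t ω) (k + 1)).toNat : ℝ)) (by
    simpa only [add_right_comm] using h5)
  exact ⟨tendsto_avgAge ht ht1 hm l1 l2 l3, tendsto_upRate ht ht1 hm l1⟩

theorem IsModel.ae_tendsto_unstable (h : IsModel P μ γ A) {e₀ : ℝ} (he₀ : 0 ≤ e₀) (d₀ : ℕ)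
    (hs : 1 ≤ P.p * (1 + P.theta)) :
    ∀ᵐ ω ∂μ,
      Tendsto (avgAge P e₀ d₀ (fun s => γ s ω) fun t => A t ω) atTop atTop ∧
      Tendsto (upRate P e₀ (fun s => γ s ω) fun t => A t ω) atTop (𝓝 0) := by
  obtain ⟨k₀, hk₀⟩ := h.exists_shift he₀
  filter_upwards [h.ae_one_le_systemTime e₀,
    hk₀ (fun T => ∀ C : ℕ, ∀ᶠ n : ℕ in atTop, ((C * n : ℕ) : ℕ∞) ≤ ∑ k ∈ Finset.range n, T k)
      (ae_eventually_le_sum_timeOf hs)] with ω h1 h2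
  have hC : ∀ C : ℕ, ∀ᶠ n : ℕ in atTop,
      ((C * n : ℕ) : ℕ∞) ≤ genEpoch P e₀ (fun s => γ s ω) (fun t => A t ω) n := by
    intro C
    -- The factor 2 absorbs the first `k₀` packets: `C * (k₀ + j) ≤ 2 * C * j` as soon as `j ≥ k₀`.
    obtain ⟨N, hN⟩ := eventually_atTop.1 (h2 (2 * C))
    refine eventually_atTop.2 ⟨N + 2 * k₀, fun n hn => ?_⟩
    obtain ⟨j, rfl⟩ : ∃ j, n = k₀ + j := ⟨n - k₀, by omega⟩
    have h3 := hN j (by omega)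
    have h4 : C * (k₀ + j) ≤ 2 * C * j := by
      rw [mul_comm 2 C, mul_assoc]
      exact Nat.mul_le_mul_left C (by omega)
    unfold genEpoch
    rw [Finset.sum_range_add]
    refine le_add_of_le_right ((show ((C * (k₀ + j) : ℕ) : ℕ∞) ≤ (2 * C * j : ℕ) by
      exact_mod_cast h4).trans ?_)
    simpa only [add_comm] using h3
  exact ⟨tendsto_avgAge_atTop h1 hC, tendsto_upRate_zero h1 hC⟩

theorem Params.gapMean_eq (h : P.p * (1 + P.theta) < 1) :
    P.gapMean = (1 - P.p + P.p ^ 2 + P.theta * P.p ^ 2) /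
      ((1 - P.p) * (1 - P.p - P.theta * P.p)) := by
  have h3 := Params.p_lt_one h
  unfold Params.gapMean Params.busyMean
  -- Opaque names keep the denominators unexpanded while they are cleared.
  obtain ⟨q, hq⟩ : ∃ q, q = 1 - P.p := ⟨_, rfl⟩
  obtain ⟨D, hD⟩ : ∃ D, D = 1 - P.p - P.theta * P.p := ⟨_, rfl⟩
  have hq0 : q ≠ 0 := by rw [hq]; linarith
  have hD0 : D ≠ 0 := by rw [hD]; linarith
  rw [show 1 - P.p * (1 + P.theta) = D by rw [hD]; ring, ← hD, ← hq]
  field_simp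
  rw [hD, hq]
  ring

/-- The left-hand side is the variance of the gap over twice its mean, the only way in which the
second moment of the downlink enters the age. -/
theorem Params.gapSq_eq (h : P.p * (1 + P.theta) < 1) :
    P.gapSq / (2 * P.gapMean) - P.gapMean / 2 =
      (P.p * (1 + P.theta) ^ 2 - P.p ^ 3 * (2 - P.p) * (1 + P.theta) ^ 3 +
          P.theta * P.p * (1 - P.p)) /
        (2 * (1 - P.p) * (1 - P.p - P.theta * P.p) ^ 2 *
          (1 - P.p + P.p ^ 2 + P.theta * P.p ^ 2)) := by
  have h1 := P.theta_pos
  have h3 := Params.p_lt_one h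
  have h8 : 0 < 1 - P.p + P.p ^ 2 + P.theta * P.p ^ 2 := by
    have : 0 < 1 - P.p := by linarith
    positivity
  rw [Params.gapMean_eq h]
  unfold Params.gapSq Params.busySq Params.busyMean
  obtain ⟨q, hq⟩ : ∃ q, q = 1 - P.p := ⟨_, rfl⟩
  obtain ⟨D, hD⟩ : ∃ D, D = 1 - P.p - P.theta * P.p := ⟨_, rfl⟩
  obtain ⟨E, hE⟩ : ∃ E, E = 1 - P.p + P.p ^ 2 + P.theta * P.p ^ 2 := ⟨_, rfl⟩
  have hq0 : q ≠ 0 := by rw [hq]; linarith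
  have hD0 : D ≠ 0 := by rw [hD]; linarith
  have hE0 : E ≠ 0 := by rw [hE]; exact h8.ne'
  rw [show 1 - P.p * (1 + P.theta) = D by rw [hD]; ring, ← hE, ← hD, ← hq]
  field_simp
  rw [hE, hD, hq]
  ring

theorem Params.one_div_timeMean (h : P.p * (1 + P.theta) < 1) :
    1 / P.timeMean = (1 - P.p) * (1 - P.p - P.theta * P.p) /
      (P.idleMean * (1 + P.theta) * (1 - P.p + P.p ^ 2 + P.theta * P.p ^ 2)) := by
  unfold Params.timeMean
  rw [Params.gapMean_eq h, mul_div_assoc', one_div_div, mul_comm (1 + P.theta)]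

theorem Params.meanAge_eq (h : P.p * (1 + P.theta) < 1) :
    P.timeMean + P.timeSq / (2 * P.timeMean) + 1 / 2 =
      (1 - P.p + P.p ^ 2 + P.theta * P.p ^ 2) /
          (2 * (1 - P.p) * (1 - P.p - P.theta * P.p)) *
        ((P.ratio ^ 2 + P.ratio + Real.exp (-P.ratio)) / P.idleMean +
          P.idleMean * ((3 * P.theta ^ 2 + 6 * P.theta + 2) / (1 + P.theta))) +
      (P.p * (1 + P.theta) ^ 2 - P.p ^ 3 * (2 - P.p) * (1 + P.theta) ^ 3 +
          P.theta * P.p * (1 - P.p)) /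
        (2 * (1 - P.p) * (1 - P.p - P.theta * P.p) ^ 2 *
          (1 - P.p + P.p ^ 2 + P.theta * P.p ^ 2)) + 1 / 2 := by
  have h1 := P.theta_pos
  have h4 := P.idleMean_pos
  have h10 : 0 < P.gapMean := zero_lt_one.trans_le (P.one_le_gapMean h)
  -- With W idle blocks and gap G, E T = E W · E G and E T² = E W · E G² + E[W(W-1)] (E G)².
  -- Collecting the terms proportional to E G leaves Var G / (2 E G).
  have e1 : P.timeMean + P.timeSq / (2 * P.timeMean) =
      P.gapMean / 2 * ((P.ratio ^ 2 + P.ratio + Real.exp (-P.ratio)) / P.idleMean +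
          P.idleMean * ((3 * P.theta ^ 2 + 6 * P.theta + 2) / (1 + P.theta))) +
        (P.gapSq / (2 * P.gapMean) - P.gapMean / 2) := by
    unfold Params.timeMean Params.timeSq Params.workSq
    field_simp
    ring
  rw [e1, Params.gapSq_eq h, Params.gapMean_eq h, div_div,
    mul_comm ((1 - P.p) * (1 - P.p - P.theta * P.p)) 2, ← mul_assoc (2 : ℝ)]

end Limits

end TwoWay

theorem theorem1 {Ω : Type*} [MeasurableSpace Ω] (μ : Measure Ω) [IsProbabilityMeasure μ]
    (P : TwoWay.Params) (γ : TwoWay.Slot → Ω → ℝ) (A : TwoWay.Trial → Ω → Bool)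
    (hmodel : TwoWay.IsModel P μ γ A)
    (e₀ : ℝ) (he₀ : 0 ≤ e₀) (d₀ : ℕ)
    (p θ r c : ℝ) (hp : p = P.p)
    (hθ : θ = P.lam * P.N0 * P.ell / (P.Pt * P.TB))
    (hr : r = P.lam / P.eta) (hc : c = r + Real.exp (-r)) :
    ((θ + 1) * p < 1 →
      ∀ᵐ ω ∂μ,
        Tendsto (fun N : ℕ => TwoWay.avgAge P e₀ d₀ (fun s => γ s ω) (fun t => A t ω) N) atTop
          (𝓝 ((1 - p + p ^ 2 + θ * p ^ 2) / (2 * (1 - p) * (1 - p - θ * p)) *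
                ((r ^ 2 + r + Real.exp (-r)) / c + c * ((3 * θ ^ 2 + 6 * θ + 2) / (1 + θ)))
              + (p * (1 + θ) ^ 2 - p ^ 3 * (2 - p) * (1 + θ) ^ 3 + θ * p * (1 - p)) /
                (2 * (1 - p) * (1 - p - θ * p) ^ 2 * (1 - p + p ^ 2 + θ * p ^ 2))
              + 1 / 2)) ∧
        Tendsto (fun N : ℕ => TwoWay.upRate P e₀ (fun s => γ s ω) (fun t => A t ω) N) atTop
          (𝓝 ((1 - p) * (1 - p - θ * p) /
            (c * (1 + θ) * (1 - p + p ^ 2 + θ * p ^ 2))))) ∧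
    (1 ≤ (θ + 1) * p →
      ∀ᵐ ω ∂μ,
        Tendsto (fun N : ℕ => TwoWay.avgAge P e₀ d₀ (fun s => γ s ω) (fun t => A t ω) N) atTop
          atTop ∧
        Tendsto (fun N : ℕ => TwoWay.upRate P e₀ (fun s => γ s ω) (fun t => A t ω) N) atTop
          (𝓝 0)) := by
  have hθ' : θ = P.theta := hθ
  have hr' : r = P.ratio := hr
  have hc' : c = P.idleMean := by rw [hc, hr']; rfl
  subst hp hθ' hr' hc'
  rw [show (P.theta + 1) * P.p = P.p * (1 + P.theta) by ring]
  refine ⟨fun h => ?_, fun h => hmodel.ae_tendsto_unstable he₀ d₀ h⟩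
  rw [← TwoWay.Params.meanAge_eq h, ← TwoWay.Params.one_div_timeMean h]
  exact hmodel.ae_tendsto_stable he₀ d₀ h
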